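/- Let $n\ge 1$, let $d_1,\dots,d_n\ge 1$ be integers, and let $t\ge 0$ be an integer. Let $A=\mathbb Z[a_{\alpha_i}]_{|\alpha_i|=d_i,\ i=1,\dots,n}$, let $f_i=\sum_{|\alpha_i|=d_i}a_{\alpha_i}X^{\alpha_i}\in A[X_1,\dots,X_n]$ be the generic homogeneous polynomials of degrees $d_i$, and let $t_n=\sum_i(d_i-1)$. Let ${\rm Res}={\rm Res}_{d_1,\dots,d_n}\in A$ be the resultant: the irreducible polynomial in the coefficients that vanishes, at coefficients in any algebraically closed field, exactly when $f_1,\dots,f_n$ have a common zero in projective space, with value $1$ at $X_1^{d_1},\dots,X_n^{d_n}$. Let $S_u$ be the free $A$-module of homogeneous polynomials of degree $u$ ($S_u=0$ for $u<0$), with its monomial basis. Let $K(t)^{-j}=\bigoplus_{i_1<\dots<i_j}S_{t-d_{i_1}-\dots-d_{i_j}}$ be the terms of the Koszul complex of $f_1,\dots,f_n$ in degree $t$, with Koszul differentials $\delta_{-j}:K(t)^{-(j+1)}\to K(t)^{-j}$, and let $K(t_n-t)^{j}=\bigoplus_{i_1<\dots<i_j}S^*_{t_n-t-d_{i_1}-\dots-d_{i_j}}$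 be the terms of the dual of the Koszul complex in degree $t_n-t$, with differentials $\delta_j^*:K(t_n-t)^j\to K(t_n-t)^{j+1}$. Let $\Delta_{ij}(X,Y)=\dfrac{f_i(Y_1,\dots,Y_{j-1},X_j,\dots,X_n)-f_i(Y_1,\dots,Y_j,X_{j+1},\dots,X_n)}{X_j-Y_j}$, write $\det(\Delta_{ij}(X,Y))=\sum_\gamma\Delta_\gamma(X)Y^\gamma$, and let $\psi_{1,t}:S_{t_n-t}^*\to S_t$ send the element $T_\gamma$ of the dual monomial basis to $\Delta_\gamma(X)$. Let $C^\bullet(t;f_1,\dots,f_n)$ be the complex $0\to C^{-n}\to\dots\to C^{-1}\xrightarrow{\partial_0}C^0\to\dots\to C^{n-1}\to 0$ with $C^{-j}=K(t)^{-j}$ for $2\le j\le n$, $C^{-1}=S_{t_n-t}^*\oplus K(t)^{-1}$, $C^0=S_t\oplus K(t_n-t)^1$, $C^j=K(t_n-t)^{j+1}$ for $1\le j\le n-1$, whose differentials are the Koszul differentials on the Koszul part and their duals on the dual part (extended by $0$ on the other summand where $C^{-1}$ or $C^0$ is involved), except that $$\partial_0(T,g)=(\psi_{1,t}(T)+\delta_0(g),\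 \delta_0^*(T)).$$ Then: 1. The complex is generically exact, i.e. exact over the field of fractions of $A$. 2. For every algebraically closed field $k$ and every specialization of the coefficients to a point $a$ with entries in $k$, the specialized complex is exact if and only if ${\rm Res}(a)\neq 0$. 3. Let $D\in{\rm Frac}(A)$ be the determinant (torsion) of the complex with respect to the monomial bases (normalized so that for a complex with only the terms $C^{-1}\to C^0$ it is the determinant of $\partial_0$). It is well defined once the bases are ordered, and $D=\pm{\rm Res}$, where the sign depends only on the orders of the bases; for suitable orders $D={\rm Res}$. 4. ${\rm Res}$, i.e. $D$ up to sign, is a greatest common divisor in $A$ of all maximal minors (the minors of size the rank of $\partial_0$) of a matrix representing $\partial_0$ in any bases of $C^{-1}$ and $C^0$. -/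

import Mathlib

open MvPolynomial

noncomputable section

namespace ResultantComplex

universe u v

/-! ### Graded pieces of the polynomial ring -/

/-- Exponent vectors `γ` in `n` variables with `|γ| = u`; there are none if `u < 0`. -/
def monSet (n : ℕ) (u : ℤ) : Set (Fin n →₀ ℕ) := {γ | (γ.degree : ℤ) = u}

/-- The index type of the monomials of degree `u` in `n` variables. -/
abbrev Mon (n : ℕ) (u : ℤ) : Type := monSet n u

instance instFiniteMon (n : ℕ) (u : ℤ) : Finite (Mon n u) :=
  Set.Finite.to_subtype <| (Finsupp.finite_of_degree_le (σ := Fin n) u.toNat).subset fun γ hγ => by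
    have h : (γ.degree : ℤ) = u := hγ
    simp only [Set.mem_ofPred_eq]
    omega

instance instFintypeMon (n : ℕ) (u : ℤ) : Fintype (Mon n u) := Fintype.ofFinite _

/-- `S_u`: the homogeneous polynomials of degree `u` in `X_1, …, X_n` (zero if `u < 0`). -/
def S (R : Type u) [CommRing R] (n : ℕ) (u : ℤ) : Submodule R (MvPolynomial (Fin n) R) :=
  restrictSupport R (monSet n u)

/-- The monomial basis of `S_u`. -/
def sBasis (R : Type u) [CommRing R] (n : ℕ) (u : ℤ) : Module.Basis (Mon n u) R (S R n u) :=
  basisRestrictSupport R (monSet n u)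

section

variable {R : Type u} [CommRing R] {n : ℕ}

theorem sBasis_coe (u : ℤ) (γ : Mon n u) :
    (sBasis R n u γ : MvPolynomial (Fin n) R) = monomial γ.1 1 := by
  have : sBasis R n u γ =
      ⟨monomial γ.1 1, (monomial_mem_restrictSupport R).2 (Or.inl γ.2)⟩ := by
    apply (sBasis R n u).repr.injective
    rw [Module.Basis.repr_self]
    ext δ
    change _ = coeff δ.1 (monomial γ.1 (1 : R))
    rw [coeff_monomial, Finsupp.single_apply]
    simp [Subtype.ext_iff]
  rw [this]

theorem mem_S {u : ℤ} {p : MvPolynomial (Fin n) R} :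
    p ∈ S R n u ↔ ∀ γ, coeff γ p ≠ 0 → (γ.degree : ℤ) = u := by
  simp only [S, mem_restrictSupport_iff, Set.subset_def, Finset.mem_coe, mem_support_iff]
  rfl

theorem mul_mem_S {u v w : ℤ} (h : u + v = w) {p q : MvPolynomial (Fin n) R}
    (hp : p ∈ S R n u) (hq : q ∈ S R n v) : p * q ∈ S R n w := by
  classical
  rw [mem_S] at *
  intro γ hγ
  rw [coeff_mul] at hγ
  obtain ⟨x, hx, hne⟩ := Finset.exists_ne_zero_of_sum_ne_zero hγ
  have h1 := hp x.1 (left_ne_zero_of_mul hne)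
  have h2 := hq x.2 (right_ne_zero_of_mul hne)
  rw [← (Finset.HasAntidiagonal.mem_antidiagonal.1 hx), map_add]
  push_cast
  omega

end

/-! ### The polynomials `f_1, …, f_n` -/

/-- The index set of all the coefficients `a_{α_i}`, `|α_i| = d_i`, `i = 1, …, n`. -/
abbrev Coeffs {n : ℕ} (d : Fin n → ℕ) : Type := Σ i : Fin n, Mon n (d i)

/-- The homogeneous polynomial `f_i(a) = ∑_{|α| = d_i} a_{i,α} X^α` with coefficients `a`. -/
def poly {R : Type u} [CommRing R] {n : ℕ} {d : Fin n → ℕ} (a : Coeffs d → R) (i : Fin n) :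
    MvPolynomial (Fin n) R :=
  ∑ α : Mon n (d i), monomial α.1 (a ⟨i, α⟩)

/-- The ring `A = ℤ[a_{α_i}]` of the generic coefficients. -/
abbrev CoeffRing {n : ℕ} (d : Fin n → ℕ) : Type := MvPolynomial (Coeffs d) ℤ

/-- The generic coefficients: `poly (generic d) i` is the generic polynomial `f_i`. -/
def generic {n : ℕ} (d : Fin n → ℕ) : Coeffs d → CoeffRing d := X

/-- The generic coefficients, in the field of fractions of `A`. -/
def genericFrac {n : ℕ} (d : Fin n → ℕ) : Coeffs d → FractionRing (CoeffRing d) :=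
  fun c => algebraMap (CoeffRing d) (FractionRing (CoeffRing d)) (X c)

/-- The coefficients of `X_1^{d_1}, …, X_n^{d_n}`. -/
def powerCoeffs {n : ℕ} (d : Fin n → ℕ) : Coeffs d → ℤ :=
  fun c => if c.2.1 = Finsupp.single c.1 (d c.1) then 1 else 0

/-! ### The resultant -/

/-- `r` is the resultant in degrees `d_1, …, d_n`: the irreducible polynomial with integer
coefficients in the coefficients of `f_1, …, f_n` that vanishes, over every algebraically closed
field, exactly when `f_1, …, f_n` have a common root in projective space, with the sign
normalized by the value `1` at `X_1^{d_1}, …, X_n^{d_n}`. -/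
structure IsResultant {n : ℕ} (d : Fin n → ℕ) (r : CoeffRing d) : Prop where
  irreducible : Irreducible r
  vanishes_iff : ∀ (k : Type) [Field k] [IsAlgClosed k] (a : Coeffs d → k),
    aeval a r = 0 ↔ ∃ p : Fin n → k, p ≠ 0 ∧ ∀ i, eval p (poly a i) = 0
  normalized : aeval (powerCoeffs d) r = 1

open scoped Classical in
/-- The resultant `Res_{d_1, …, d_n}` (the polynomial with the property `IsResultant`). -/
def resultant {n : ℕ} (d : Fin n → ℕ) : CoeffRing d :=
  if h : ∃ r, IsResultant d r then h.choose else 0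

/-! ### The Bezoutian

Polynomials in two sets of variables `X`, `Y` are polynomials in `Y` over `R[X]`. -/

section Bezoutian

variable {R : Type u} [CommRing R] {n : ℕ}

/-- The variable `X_l` in `R[X][Y]`. -/
def xVar (R : Type u) [CommRing R] {n : ℕ} (l : Fin n) :
    MvPolynomial (Fin n) (MvPolynomial (Fin n) R) := C (X l)

/-- The variable `Y_l` in `R[X][Y]`. -/
def yVar (R : Type u) [CommRing R] {n : ℕ} (l : Fin n) :
    MvPolynomial (Fin n) (MvPolynomial (Fin n) R) := X l

/-- The incremental quotient of the monomial `X^α` in the variable `j`: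
`Y_1^{α_1} ⋯ Y_{j-1}^{α_{j-1}} ⋅ (X_j^{α_j} - Y_j^{α_j}) / (X_j - Y_j) ⋅
X_{j+1}^{α_{j+1}} ⋯ X_n^{α_n}`. -/
def incrMonomial (R : Type u) [CommRing R] {n : ℕ} (α : Fin n →₀ ℕ) (j : Fin n) :
    MvPolynomial (Fin n) (MvPolynomial (Fin n) R) :=
  (∏ l ∈ Finset.Iio j, yVar R l ^ α l) *
    (∑ b ∈ Finset.range (α j), xVar R j ^ b * yVar R j ^ (α j - 1 - b)) *
    ∏ l ∈ Finset.Ioi j, xVar R l ^ α l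

/-- The incremental quotient
`(f(Y_1,…,Y_{j-1},X_j,…,X_n) - f(Y_1,…,Y_j,X_{j+1},…,X_n)) / (X_j - Y_j)`
(see `incr_mul`). -/
def incr (f : MvPolynomial (Fin n) R) (j : Fin n) :
    MvPolynomial (Fin n) (MvPolynomial (Fin n) R) :=
  ∑ α ∈ f.support, C (C (coeff α f)) * incrMonomial R α j

/-- The point `(Y_1, …, Y_m, X_{m+1}, …, X_n)`. -/
def mixed (R : Type u) [CommRing R] {n : ℕ} (m : ℕ) (l : Fin n) :
    MvPolynomial (Fin n) (MvPolynomial (Fin n) R) :=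
  if (l : ℕ) < m then yVar R l else xVar R l

theorem prod_split {M : Type*} [CommMonoid M] (g : Fin n → M) (j : Fin n) :
    ∏ l, g l = (∏ l ∈ Finset.Iio j, g l) * g j * ∏ l ∈ Finset.Ioi j, g l := by
  classical
  have h : (Finset.univ : Finset (Fin n)) = (insert j (Finset.Iio j)) ∪ Finset.Ioi j := by
    ext l
    simp only [Finset.mem_univ, Finset.mem_union, Finset.mem_insert, Finset.mem_Iio,
      Finset.mem_Ioi, true_iff]
    rcases lt_trichotomy l j with h | h | h <;> simp [h]
  rw [h, Finset.prod_union, Finset.prod_insert (by simp), mul_comm (g j)]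
  rw [Finset.disjoint_left]
  intro l hl
  simp only [Finset.mem_insert, Finset.mem_Iio, Finset.mem_Ioi] at *
  rcases hl with rfl | hl
  · simp
  · exact not_lt.2 hl.le

theorem incr_mul (f : MvPolynomial (Fin n) R) (j : Fin n) :
    incr f j * (xVar R j - yVar R j) =
      aeval (mixed R (j : ℕ)) f - aeval (mixed R ((j : ℕ) + 1)) f := by
  rw [aeval_def, aeval_def, eval₂_eq', eval₂_eq', incr, Finset.sum_mul, ← Finset.sum_sub_distrib]
  refine Finset.sum_congr rfl fun α _ => ?_
  rw [← mul_sub, mul_assoc]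
  congr 1
  rw [prod_split _ j, prod_split (fun l => mixed R ((j : ℕ) + 1) l ^ α l) j, incrMonomial]
  have e1 : ∏ l ∈ Finset.Iio j, mixed R (j : ℕ) l ^ α l = ∏ l ∈ Finset.Iio j, yVar R l ^ α l :=
    Finset.prod_congr rfl fun l hl => by
      have : (l : ℕ) < j := Fin.lt_def.1 (Finset.mem_Iio.1 hl)
      simp [mixed, this]
  have e2 : ∏ l ∈ Finset.Iio j, mixed R ((j : ℕ) + 1) l ^ α l =
      ∏ l ∈ Finset.Iio j, yVar R l ^ α l :=
    Finset.prod_congr rfl fun l hl => by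
      have : (l : ℕ) < j := Fin.lt_def.1 (Finset.mem_Iio.1 hl)
      simp [mixed, Nat.lt_succ_of_lt this]
  have e3 : ∏ l ∈ Finset.Ioi j, mixed R (j : ℕ) l ^ α l = ∏ l ∈ Finset.Ioi j, xVar R l ^ α l :=
    Finset.prod_congr rfl fun l hl => by
      have : (j : ℕ) < l := Fin.lt_def.1 (Finset.mem_Ioi.1 hl)
      simp [mixed, not_lt.2 this.le]
  have e4 : ∏ l ∈ Finset.Ioi j, mixed R ((j : ℕ) + 1) l ^ α l =
      ∏ l ∈ Finset.Ioi j, xVar R l ^ α l :=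
    Finset.prod_congr rfl fun l hl => by
      have : (j : ℕ) < l := Fin.lt_def.1 (Finset.mem_Ioi.1 hl)
      simp [mixed, not_lt.2 (Nat.succ_le_of_lt this)]
  rw [e1, e2, e3, e4]
  have e5 : mixed R (j : ℕ) j = xVar R j := by simp [mixed]
  have e6 : mixed R ((j : ℕ) + 1) j = yVar R j := by simp [mixed]
  rw [e5, e6, ← sub_mul, ← mul_sub, ← geom_sum₂_mul (xVar R j) (yVar R j) (α j)]
  ring

/-- The Bezoutian `Δ(X, Y) = det (Δ_{ij}(X, Y))` of `f_1, …, f_n`. -/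
def bezoutian (f : Fin n → MvPolynomial (Fin n) R) :
    MvPolynomial (Fin n) (MvPolynomial (Fin n) R) :=
  (Matrix.of fun i j => incr (f i) j).det

/-- The coefficients `Δ_γ(X)` in `Δ(X, Y) = ∑_γ Δ_γ(X) Y^γ`. -/
def bezoutCoeff (f : Fin n → MvPolynomial (Fin n) R) (γ : Fin n →₀ ℕ) :
    MvPolynomial (Fin n) R :=
  coeff γ (bezoutian f)

/-- `P(X, Y)` is homogeneous of degree `m` in all the variables. -/
def TotHom (m : ℤ) (P : MvPolynomial (Fin n) (MvPolynomial (Fin n) R)) : Prop :=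
  ∀ γ, coeff γ P ∈ S R n (m - γ.degree)

theorem TotHom.mul {m m' w : ℤ} (h : m + m' = w)
    {P Q : MvPolynomial (Fin n) (MvPolynomial (Fin n) R)}
    (hP : TotHom m P) (hQ : TotHom m' Q) : TotHom w (P * Q) := by
  classical
  intro γ
  rw [coeff_mul]
  refine Submodule.sum_mem _ fun x hx => mul_mem_S ?_ (hP x.1) (hQ x.2)
  rw [← (Finset.HasAntidiagonal.mem_antidiagonal.1 hx), map_add]
  push_cast
  omega

theorem TotHom.sum {ι : Type*} {m : ℤ} (s : Finset ι)
    {P : ι → MvPolynomial (Fin n) (MvPolynomial (Fin n) R)}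
    (hP : ∀ i ∈ s, TotHom m (P i)) : TotHom m (∑ i ∈ s, P i) := by
  intro γ
  rw [coeff_sum]
  exact Submodule.sum_mem _ fun i hi => hP i hi γ

theorem TotHom.smul {m : ℤ} (z : ℤˣ) {P : MvPolynomial (Fin n) (MvPolynomial (Fin n) R)}
    (hP : TotHom m P) : TotHom m (z • P) := by
  intro γ
  rcases Int.units_eq_one_or z with rfl | rfl
  · simpa using hP γ
  · simpa using hP γ

theorem TotHom.const (c : R) :
    TotHom 0 (C (C c) : MvPolynomial (Fin n) (MvPolynomial (Fin n) R)) := by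
  classical
  intro γ
  rw [coeff_C]
  split_ifs with h
  · subst h
    rw [mem_S]
    intro δ hδ
    rw [coeff_C] at hδ
    have : 0 = δ := by
      by_contra h
      simp [h] at hδ
    simp [← this]
  · exact Submodule.zero_mem _

theorem TotHom.one : TotHom 0 (1 : MvPolynomial (Fin n) (MvPolynomial (Fin n) R)) := by
  simpa using TotHom.const (n := n) (1 : R)

theorem TotHom.xVar (l : Fin n) : TotHom 1 (xVar R l) := by
  classical
  intro γ
  rw [ResultantComplex.xVar, coeff_C]
  split_ifs with h
  · subst h
    rw [mem_S]
    intro δ hδ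
    rw [coeff_X] at hδ
    have : Finsupp.single l 1 = δ := by
      by_contra h
      simp [h] at hδ
    simp [← this]
  · exact Submodule.zero_mem _

theorem TotHom.yVar (l : Fin n) : TotHom 1 (yVar R l) := by
  classical
  intro γ
  rw [ResultantComplex.yVar, coeff_X]
  split_ifs with h
  · subst h
    rw [mem_S]
    intro δ hδ
    rw [coeff_one] at hδ
    have : 0 = δ := by
      by_contra h
      simp [h] at hδ
    simp [← this]
  · exact Submodule.zero_mem _

theorem TotHom.prod {ι : Type*} (s : Finset ι) {m : ι → ℤ}
    {P : ι → MvPolynomial (Fin n) (MvPolynomial (Fin n) R)}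
    (hP : ∀ i ∈ s, TotHom (m i) (P i)) : TotHom (∑ i ∈ s, m i) (∏ i ∈ s, P i) := by
  classical
  induction s using Finset.induction_on with
  | empty => simpa using TotHom.one
  | insert i s hi ih =>
    rw [Finset.sum_insert hi, Finset.prod_insert hi]
    exact TotHom.mul rfl (hP i (by simp)) (ih fun j hj => hP j (by simp [hj]))

theorem TotHom.pow {m : ℤ} (e : ℕ) {P : MvPolynomial (Fin n) (MvPolynomial (Fin n) R)}
    (hP : TotHom m P) : TotHom (e * m) (P ^ e) := by
  simpa using TotHom.prod (Finset.range e) (m := fun _ => m) (P := fun _ => P) fun _ _ => hP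

theorem totHom_incrMonomial (α : Fin n →₀ ℕ) (j : Fin n) :
    TotHom ((α.degree : ℤ) - 1) (incrMonomial R α j) := by
  have h : (α.degree : ℤ) = ∑ l ∈ Finset.Iio j, (α l : ℤ) * 1 + α j +
      ∑ l ∈ Finset.Ioi j, (α l : ℤ) * 1 := by
    have := prod_split (M := Multiplicative ℤ) (fun l => Multiplicative.ofAdd (α l : ℤ)) j
    rw [Finsupp.degree_eq_sum]
    push_cast
    simp only [mul_one]
    exact this
  refine TotHom.mul (m := ∑ l ∈ Finset.Iio j, (α l : ℤ) * 1 + ((α j : ℤ) - 1))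
    (m' := ∑ l ∈ Finset.Ioi j, (α l : ℤ) * 1) (by rw [h]; ring)
    (TotHom.mul rfl (TotHom.prod _ fun l _ => (TotHom.yVar l).pow _) ?_)
    (TotHom.prod _ fun l _ => (TotHom.xVar l).pow _)
  refine TotHom.sum _ fun b hb => TotHom.mul ?_ ((TotHom.xVar j).pow _) ((TotHom.yVar j).pow _)
  have := Finset.mem_range.1 hb
  omega

theorem poly_mem {d : Fin n → ℕ} (a : Coeffs d → R) (i : Fin n) : poly a i ∈ S R n (d i) :=
  Submodule.sum_mem _ fun α _ => (monomial_mem_restrictSupport R).2 (Or.inl α.2)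

theorem totHom_incr {e : ℤ} {f : MvPolynomial (Fin n) R} (hf : f ∈ S R n e) (j : Fin n) :
    TotHom (e - 1) (incr f j) := by
  refine TotHom.sum _ fun α hα => TotHom.mul (zero_add _) (TotHom.const _) ?_
  rw [← mem_S.1 hf α (mem_support_iff.1 hα)]
  exact totHom_incrMonomial α j

/-- The critical degree `t_n = ∑ (d_i - 1)`. -/
def critDeg (d : Fin n → ℕ) : ℤ := ∑ i, ((d i : ℤ) - 1)

theorem bezoutCoeff_mem {d : Fin n → ℕ} (a : Coeffs d → R) (γ : Fin n →₀ ℕ) :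
    bezoutCoeff (poly a) γ ∈ S R n (critDeg d - γ.degree) := by
  have h : TotHom (critDeg d) (bezoutian (poly a)) := by
    rw [bezoutian, Matrix.det_apply]
    refine TotHom.sum _ fun σ _ => TotHom.smul _ ?_
    rw [critDeg, ← Equiv.sum_comp σ]
    exact TotHom.prod _ fun i _ => totHom_incr (poly_mem a _) i
  exact h γ

end Bezoutian

/-! ### The Koszul complex in degree `t` -/

/-- The sets `{i_1 < ⋯ < i_p}` of `p` indices (there are none if `p < 0`). -/
abbrev Sub (n : ℕ) (p : ℤ) : Type := {I : Finset (Fin n) // (I.card : ℤ) = p}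

/-- `d_{i_1} + ⋯ + d_{i_p}`. -/
def dSum {n : ℕ} (d : Fin n → ℕ) (I : Finset (Fin n)) : ℤ := ∑ i ∈ I, (d i : ℤ)

/-- The Koszul module `K(t)^{-p} = ⨁_{i_1 < ⋯ < i_p} S_{t - d_{i_1} - ⋯ - d_{i_p}}`
(zero if `p < 0` or `p > n`). -/
abbrev K (R : Type u) [CommRing R] {n : ℕ} (d : Fin n → ℕ) (t p : ℤ) : Type u :=
  (I : Sub n p) → S R n (t - dSum d I.1)

/-- The index set of the monomial basis of `K(t)^{-p}`. -/
abbrev KIdx {n : ℕ} (d : Fin n → ℕ) (t p : ℤ) : Type := Σ I : Sub n p, Mon n (t - dSum d I.1)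

/-- The monomial basis of `K(t)^{-p}`. -/
def kBasis (R : Type u) [CommRing R] {n : ℕ} (d : Fin n → ℕ) (t p : ℤ) :
    Module.Basis (KIdx d t p) R (K R d t p) :=
  Pi.basis fun I => sBasis R n (t - dSum d I.1)

section Koszul

variable {R : Type u} [CommRing R] {n : ℕ} {d : Fin n → ℕ}

theorem dSum_insert {I : Finset (Fin n)} {i : Fin n} (hi : i ∉ I) :
    dSum d (insert i I) = d i + dSum d I := by
  rw [dSum, Finset.sum_insert hi, dSum]

/-- The sign of `e_{I \ i}` in the Koszul differential of `e_I`: it is `(-1)^(m-1)` if `i` is the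
`m`-th smallest element of `I`. -/
def kSign (i : Fin n) (I : Finset (Fin n)) : ℤ := (-1) ^ (I.filter (· < i)).card

/-- Multiplication by `f_i`, as a map `S_u → S_w`, `w = d_i + u`. -/
def mulPoly (a : Coeffs d → R) (i : Fin n) {u w : ℤ} (h : d i + u = w) :
    S R n u →ₗ[R] S R n w :=
  (LinearMap.mulLeft R (poly a i)).restrict fun _ hg => mul_mem_S h (poly_mem a i) hg

theorem mulPoly_degree {t : ℤ} {J : Finset (Fin n)} {i : Fin n} (hi : i ∉ J) :
    d i + (t - dSum d (insert i J)) = t - dSum d J := by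
  rw [dSum_insert hi]
  ring

theorem card_insert_eq {p q : ℤ} (h : p = q + 1) (J : Sub n q) {i : Fin n} (hi : i ∉ J.1) :
    ((insert i J.1).card : ℤ) = p := by
  have := J.2
  rw [Finset.card_insert_of_notMem hi]
  push_cast
  omega

/-- The Koszul differential `K(t)^{-p} → K(t)^{-q}`, `p = q + 1`. On `⨁_I S_{t - d_I} e_I` it is
`g e_I ↦ ∑_{i ∈ I} ± g f_i e_{I \ i}`, so that the component at `J` of the image of `g` is
`∑_{i ∉ J} ± f_i g_{J ∪ i}`. -/
def koszulD (a : Coeffs d → R) (t p q : ℤ) (h : p = q + 1) : K R d t p →ₗ[R] K R d t q :=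
  LinearMap.pi fun J => ∑ i : {i : Fin n // i ∉ J.1},
    kSign i.1 J.1 • (mulPoly a i.1 (mulPoly_degree i.2) ∘ₗ
      LinearMap.proj (⟨insert i.1 J.1, card_insert_eq h J i.2⟩ : Sub n p))

/-- The components of an element of `K(t)^{-p}`, extended by zero to all sets of indices. -/
def kExt {t p : ℤ} (g : K R d t p) (I : Finset (Fin n)) : MvPolynomial (Fin n) R :=
  if h : (I.card : ℤ) = p then (g ⟨I, h⟩ : MvPolynomial (Fin n) R) else 0

theorem koszulD_coe (a : Coeffs d → R) (t p q : ℤ) (h : p = q + 1) (g : K R d t p)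
    (J : Sub n q) : (koszulD a t p q h g J : MvPolynomial (Fin n) R) =
      ∑ i ∈ Finset.univ.filter (· ∉ J.1), kSign i J.1 • (poly a i * kExt g (insert i J.1)) := by
  rw [koszulD, LinearMap.pi_apply, LinearMap.sum_apply, AddSubmonoidClass.coe_finsetSum]
  rw [← Finset.sum_subtype_eq_sum_filter, Finset.subtype_univ]
  refine Finset.sum_congr rfl fun i _ => ?_
  have : kExt g (insert i.1 J.1) = (g ⟨insert i.1 J.1, card_insert_eq h J i.2⟩).1 :=
    dif_pos (card_insert_eq h J i.2)
  rw [this]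
  rfl

theorem kSign_swap {J : Finset (Fin n)} {i l : Fin n} (hi : i ∉ J) (hl : l ∉ J) (hil : i ≠ l) :
    kSign i J * kSign l (insert i J) + kSign l J * kSign i (insert l J) = 0 := by
  have key : ∀ {i l : Fin n}, i ∉ J → l ∉ J → i < l →
      kSign i J * kSign l (insert i J) + kSign l J * kSign i (insert l J) = 0 := by
    intro i l hi hl h
    have e1 : kSign l (insert i J) = - kSign l J := by
      rw [kSign, kSign, Finset.filter_insert, if_pos h,
        Finset.card_insert_of_notMem (by simp [hi]), pow_succ]
      ring
    have e2 : kSign i (insert l J) = kSign i J := by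
      rw [kSign, kSign, Finset.filter_insert, if_neg (not_lt.2 h.le)]
    rw [e1, e2]
    ring
  rcases lt_or_gt_of_ne hil with h | h
  · exact key hi hl h
  · rw [add_comm]
    exact key hl hi h

theorem koszulD_koszulD (a : Coeffs d → R) (t p q r : ℤ) (h : p = q + 1) (h' : q = r + 1)
    (g : K R d t p) : koszulD a t q r h' (koszulD a t p q h g) = 0 := by
  funext J
  apply Subtype.ext
  rw [koszulD_coe]
  have e : ∀ i ∈ Finset.univ.filter (· ∉ J.1),
      kSign i J.1 • (poly a i * kExt (koszulD a t p q h g) (insert i J.1)) =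
      ∑ l ∈ Finset.univ.filter (· ∉ insert i J.1), (kSign i J.1 * kSign l (insert i J.1)) •
        (poly a i * poly a l * kExt g (insert l (insert i J.1))) := by
    intro i hi
    have hi' : i ∉ J.1 := (Finset.mem_filter.1 hi).2
    have hc : ((insert i J.1).card : ℤ) = q := card_insert_eq h' J hi'
    rw [kExt, dif_pos hc, koszulD_coe, Finset.mul_sum, Finset.smul_sum]
    refine Finset.sum_congr rfl fun l _ => ?_
    rw [mul_smul_comm, smul_smul, mul_assoc]
  rw [Finset.sum_congr rfl e, Finset.sum_sigma']
  refine Finset.sum_involution (fun x _ => ⟨x.2, x.1⟩) ?_ ?_ ?_ ?_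
  · rintro ⟨i, l⟩ hx
    simp only [Finset.mem_sigma, Finset.mem_filter, Finset.mem_univ, true_and,
      Finset.mem_insert, not_or] at hx
    rw [Finset.insert_comm i l, mul_comm (poly a l), ← add_smul,
      kSign_swap hx.1 hx.2.2 (Ne.symm hx.2.1), zero_smul]
  · rintro ⟨i, l⟩ hx _ heq
    simp only [Finset.mem_sigma, Finset.mem_filter, Finset.mem_univ, true_and,
      Finset.mem_insert, not_or] at hx
    simp only [Sigma.mk.injEq] at heq
    exact hx.2.1 heq.1
  · rintro ⟨i, l⟩ hx
    simp only [Finset.mem_sigma, Finset.mem_filter, Finset.mem_univ, true_and,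
      Finset.mem_insert, not_or] at hx ⊢
    exact ⟨hx.2.2, Ne.symm hx.2.1, hx.1⟩
  · rintro ⟨i, l⟩ _
    rfl

/-- The polynomial `Δ_γ(X)`, `|γ| = t_n - t`, as an element of `S_t`; the argument `I` is the empty
set of indices. -/
def bezoutElt (a : Coeffs d → R) (t : ℤ) {I : Finset (Fin n)} (hI : (I.card : ℤ) = 0)
    (γ : Mon n (critDeg d - t - dSum d ∅)) : S R n (t - dSum d I) :=
  ⟨bezoutCoeff (poly a) γ.1, by
    have h1 : I = ∅ := by
      rw [← Finset.card_eq_zero]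
      omega
    have h2 : (γ.1.degree : ℤ) = critDeg d - t - dSum d ∅ := γ.2
    have h3 : t - dSum d I = critDeg d - γ.1.degree := by
      rw [h1, h2]
      simp [dSum]
    rw [h3]
    exact bezoutCoeff_mem a γ.1⟩

/-- The map `ψ_{1,t} : S_{t_n-t}^* → S_t`, `T ↦ ∑_γ T(X^γ) Δ_γ(X)`, where `|γ| = t_n - t`, which
sends the element `T_γ` of the dual monomial basis to `Δ_γ(X)`. It is written as a map from
`(K(t_n-t)^{-p})^*` to `K(t)^{-q}`, where `p = q = 0`. -/
def bezoutMap (a : Coeffs d → R) (t p q : ℤ) (hp : p = 0) (hq : q = 0) :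
    Module.Dual R (K R d (critDeg d - t) p) →ₗ[R] K R d t q :=
  LinearMap.pi fun I => ∑ γ : Mon n (critDeg d - t - dSum d ∅),
    (LinearMap.applyₗ (kBasis R d (critDeg d - t) p ⟨⟨∅, by simp [hp]⟩, γ⟩)).smulRight
      (bezoutElt a t (I.2.trans hq) γ)

/-! ### The coupled complex -/

/-- The term `C^j` of the coupled complex `C^•(t; f_1, …, f_n)`. Since `K(t)^{-p} = 0` for `p < 0`,
`C^j` is `K(t)^j` for `j ≤ -2`, it is `K(t)^{-1} ⊕ S_{t_n-t}^*` for `j = -1`, it is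
`S_t ⊕ (K(t_n-t)^{-1})^*` for `j = 0`, and it is `(K(t_n-t)^{-(j+1)})^*` for `j ≥ 1`. -/
abbrev Coupled (R : Type u) [CommRing R] {n : ℕ} (d : Fin n → ℕ) (t j : ℤ) : Type u :=
  K R d t (-j) × Module.Dual R (K R d (critDeg d - t) (j + 1))

/-- The differential `∂_{j+1} : C^j → C^{j+1}`: it is the Koszul differential on the Koszul terms
and its dual on the dual Koszul terms, and for `j = -1` the map `ψ_{1,t} : S_{t_n-t}^* → S_t` is
added. -/
def coupledD (a : Coeffs d → R) (t j : ℤ) : Coupled R d t j →ₗ[R] Coupled R d t (j + 1) :=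
  LinearMap.prod
    (koszulD a t (-j) (-(j + 1)) (by ring) ∘ₗ LinearMap.fst R _ _ +
      if h : j = -1 then
        bezoutMap a t (j + 1) (-(j + 1)) (by omega) (by omega) ∘ₗ LinearMap.snd R _ _
      else 0)
    ((koszulD a (critDeg d - t) (j + 1 + 1) (j + 1) rfl).dualMap ∘ₗ LinearMap.snd R _ _)

/-- The coupled complex is a complex. -/
theorem coupledD_coupledD (a : Coeffs d → R) (t j : ℤ) (x : Coupled R d t j) :
    coupledD a t (j + 1) (coupledD a t j x) = 0 := by
  have h2 : ((koszulD a (critDeg d - t) (j + 1 + 1 + 1) (j + 1 + 1) rfl).dualMap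
      ((koszulD a (critDeg d - t) (j + 1 + 1) (j + 1) rfl).dualMap x.2)) = 0 := by
    refine LinearMap.ext fun g => ?_
    simp [LinearMap.dualMap_apply, koszulD_koszulD]
  refine Prod.ext ?_ h2
  by_cases h : j + 1 = -1
  · have hj : j ≠ -1 := by omega
    have h0 : (koszulD a (critDeg d - t) (j + 1 + 1) (j + 1) rfl).dualMap x.2 = 0 := by
      refine LinearMap.ext fun g => ?_
      rw [LinearMap.dualMap_apply]
      have : koszulD a (critDeg d - t) (j + 1 + 1) (j + 1) rfl g = 0 := by
        funext J
        have := J.2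
        omega
      rw [this, map_zero, LinearMap.zero_apply]
    simp [coupledD, h, hj, h0, koszulD_koszulD]
  · by_cases hj : j = -1
    · have h0 : ∀ y : K R d t (-(j + 1)),
          koszulD a t (-(j + 1)) (-(j + 1 + 1)) (by ring) y = 0 := by
        intro y
        funext J
        have := J.2
        omega
      simp [coupledD, h, h0]
    · simp [coupledD, h, hj, koszulD_koszulD]

/-- The index set of the monomial basis of `C^j`. -/
abbrev CoupledIdx {n : ℕ} (d : Fin n → ℕ) (t j : ℤ) : Type :=
  KIdx d t (-j) ⊕ KIdx d (critDeg d - t) (j + 1)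

open scoped Classical in
/-- The monomial basis of `C^j`: monomials in the Koszul terms, and the dual monomial basis in the
dual Koszul terms. -/
def coupledBasis (R : Type u) [CommRing R] {n : ℕ} (d : Fin n → ℕ) (t j : ℤ) :
    Module.Basis (CoupledIdx d t j) R (Coupled R d t j) :=
  (kBasis R d t (-j)).prod (kBasis R d (critDeg d - t) (j + 1)).dualBasis

end Koszul

/-! ### Exactness and the determinant of a based complex -/

/-- The complex `(V^•, D)` is exact (in all degrees). -/
def IsExactComplex {R : Type u} [CommRing R] {V : ℤ → Type v} [∀ j, AddCommGroup (V j)]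
    [∀ j, Module R (V j)] (D : ∀ j, V j →ₗ[R] V (j + 1)) : Prop :=
  ∀ j, Function.Exact (D j) (D (j + 1))

section Det

variable {F : Type u} [Field F] {V : ℤ → Type v} [∀ j, AddCommGroup (V j)] [∀ j, Module F (V j)]

/-- The vectors `∂ v_1, …, ∂ v_r, v'_1, …, v'_{r'}`, in this order, in `V^{j+1}`, where the `v_i`
lie in `V^j` and the `v'_i` lie in `V^{j+1}`. -/
def liftFamily (D : ∀ j, V j →ₗ[F] V (j + 1)) {r N : ℤ → ℕ} (w : ∀ j, Fin (r j) → V j)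
    (h : ∀ j, r j + r (j + 1) = N (j + 1)) (j : ℤ) : Fin (N (j + 1)) → V (j + 1) :=
  fun m => Fin.append (fun i => D j (w j i)) (w (j + 1)) (Fin.cast (h j).symm m)

/-- `x` is the determinant (torsion) of the bounded exact complex `(V^•, D)` of vector spaces with
respect to the ordered bases `b^j`: for some families `w^j` of vectors of `V^j` such that for all
`j` the family `D w^{j-1}, w^j` is a basis of `V^j`, it is the alternating product
`∏_j det(D w^{j-1}, w^j)^{(-1)^j}`, where the determinants are computed in the bases `b^j`. For a
complex with two terms in degrees `-1` and `0` it is the determinant of the differential. -/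
def IsComplexDet (D : ∀ j, V j →ₗ[F] V (j + 1)) {N : ℤ → ℕ}
    (b : ∀ j, Module.Basis (Fin (N j)) F (V j)) (x : F) : Prop :=
  ∃ (r : ℤ → ℕ) (w : ∀ j, Fin (r j) → V j) (h : ∀ j, r j + r (j + 1) = N (j + 1)),
    (∀ j, (b (j + 1)).det (liftFamily D w h j) ≠ 0) ∧
    x = ∏ᶠ j : ℤ, (b (j + 1)).det (liftFamily D w h j) ^ ((j + 1).negOnePow : ℤ)

end Det

/-! ### Maximal minors -/

/-- `m` is a maximal minor of the matrix `M` over the domain `A`: the determinant of a square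
submatrix of size the rank of `M` (over the field of fractions). -/
def IsMaximalMinor {A : Type u} [CommRing A] [IsDomain A] {ι κ : Type*} [Fintype κ]
    (M : Matrix ι κ A) (m : A) : Prop :=
  ∃ (row : Fin (M.map (algebraMap A (FractionRing A))).rank ↪ ι)
    (col : Fin (M.map (algebraMap A (FractionRing A))).rank ↪ κ),
    m = (M.submatrix row col).det

/-- `g` is a greatest common divisor of the elements of `s`. -/
def IsGCDOf {A : Type u} [CommRing A] (s : Set A) (g : A) : Prop :=
  (∀ m ∈ s, g ∣ m) ∧ ∀ x : A, (∀ m ∈ s, x ∣ m) → x ∣ g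

end ResultantComplex

end

/-!
The proof goes through the determinant of a based complex and rests on three facts.

*Exactness.* Over an algebraically closed field the coupled complex is exact if and only if the
polynomials have no common zero in projective space (`isExactComplex_iff`). If they have none, the
ideal `I` which they generate contains powers of all the variables, so the Koszul complex is acyclic
(`koszulExact_of_pow_mem`), and it remains to see that `ψ_{1,t}` induces an isomorphism from the
dual of `(k[X]/I)_{t_n-t}` to `(k[X]/I)_t`. By Cramer's rule the product of the Bezoutian `Δ` with
`u(X) - u(Y)` lies in the ideal of the `f_i(X) - f_i(Y)` (`bezoutian_mul_sub_mem`), so modulo `I`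
the map `T ↦ ∑ T(X^γ) Δ_γ(X)` is linear over `k[X]` on the functionals `T` which kill `I`. Its image
contains `1`, because `Δ(0, Y)` does not lie in `I` (`det_notMem`, `exists_functional`); hence it is
onto, and comparing the dimensions in the degrees `t` and `t_n - t` shows that it is bijective
(`bezoutQuot_injective`). Conversely, if there is a common zero `p`, then all the boundaries in the
summand `S_t` of `C^0` vanish at `p`, but the cycle `X_l^t` with `p_l ≠ 0` does not
(`not_isExactComplex`).

*Specialization.* The determinant of an exact complex is unique (`IsComplexDet.unique`), and it can
be computed from subfamilies of the bases, with integral determinants `liftDet`. The subfamilies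
which work for an exact specialization also work for the generic complex. So the generic complex is
exact, and its determinant `D` is a fraction whose numerator and denominator do not vanish at this
specialization (`Realizes.specialize`, `exists_fraction`).

*The resultant.* The polynomials in the coefficients which vanish at all systems with a common zero
form a prime ideal `resIdeal`, the kernel of the specialization to the general system with a common
zero. Let `q` be a prime element of it. For any other prime element `p`, up to units, the complex is
exact at the specialization with the kernel `(p)`, so that `p` does not occur in `D`; therefore `D =
± q^m` (`exists_eq_zpow`). Multiplying `f_i` by `c` is an isomorphism of complexes, and counting
monomials shows that `D` is homogeneous of degree `e = ∏_{l ≠ i} d_l` in the coefficients of `f_i`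
(`IsComplexDet.scaleAt`). As there is a line in the space of the coefficients of `f_i` on which `q`
has at least `e` zeros without vanishing identically (`exists_line`), it follows that `m = 1`
(`exponent_eq_one`). Then `q` vanishes exactly at the systems with a common zero. Its value at
`X_1^{d_1}, …, X_n^{d_n}` is not divisible by any prime number, so `± q` is the resultant
(`exists_isResultant`). This shows the existence of the resultant, too.

The sign of `D` changes when two elements of a basis are interchanged (`exists_isComplexDet_neg`).
If no basis has two elements, the determinant is computed at `X_1^{d_1}, …, X_n^{d_n}`
(`isComplexDet_powerCoeffs`).

For the maximal minors of `∂_0`, consider the system `X_1^{d_1}, …, X_{n-1}^{d_{n-1}}, 0`. It has a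
common zero, but its complex is exact except at `C^{-1}` and `C^0` (`exists_almost_exact`). There
the subfamilies can be chosen such that only the determinant in `C^0` vanishes; as polynomials, the
other ones are prime to the resultant, and so the resultant and the determinant in `C^0`, which is a
combination of maximal minors of `∂_0`, agree up to factors prime to the resultant
(`exists_resultant_mul_eq`). A maximal minor not divisible by the resultant could be combined with
the other determinants to give exactness at the general system with a common zero
(`resultant_dvd_minor`). A common divisor of the maximal minors has no prime factor other than the
resultant, which occurs at most once (`dvd_resultant_of_dvd_minor`). For arbitrary bases, minors of
a product of matrices are combinations of minors of each factor (`dvd_det_submatrix_mul`).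
-/

open MvPolynomial

noncomputable section

namespace ResultantComplex

universe u v

/-! ### Determinants of based complexes of vector spaces -/

section LinearAlgebra

open Module

variable {F : Type u} [Field F]

theorem exists_linearIndependent_subfamily {V W : Type*} [AddCommGroup V] [Module F V]
    [AddCommGroup W] [Module F W] {N : ℕ} (b : Basis (Fin N) F V) (L : V →ₗ[F] W) :
    ∃ I : Fin (finrank F (LinearMap.range L)) → Fin N,
      LinearIndependent F (fun i => L (b (I i))) := by
  obtain ⟨κ, a, ha, hs, hl⟩ := exists_linearIndependent' F (L ∘ b)
  have : Finite κ := Finite.of_injective a ha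
  have := Fintype.ofFinite κ
  have hspan : Submodule.span F (Set.range (L ∘ b)) = LinearMap.range L := by
    rw [Set.range_comp, ← Submodule.map_span, b.span_eq, Submodule.map_top]
  have hc : Fintype.card κ = finrank F (LinearMap.range L) := by
    rw [← hspan, ← hs, finrank_span_eq_card hl]
  exact ⟨fun i => a ((Fintype.equivFinOfCardEq hc).symm i), hl.comp _ (Equiv.injective _)⟩

/-- A linearly independent family in the kernel of `L`, followed by a family with linearly
independent images under `L`. -/
theorem linearIndependent_append {V W : Type*} [AddCommGroup V] [Module F V]
    [AddCommGroup W] [Module F W] {r s : ℕ} (L : V →ₗ[F] W) {x : Fin r → V}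
    (hx : LinearIndependent F x) (hL : ∀ i, L (x i) = 0) {y : Fin s → V}
    (hy : LinearIndependent F (fun i => L (y i))) :
    LinearIndependent F (Fin.append x y) := by
  rw [Fintype.linearIndependent_iff] at *
  intro c hc
  rw [Fin.sum_univ_add] at hc
  simp only [Fin.append_left, Fin.append_right] at hc
  have h2 : ∀ i, c (Fin.natAdd r i) = 0 := hy _ <| by
    have := congrArg L hc
    simpa [map_sum, hL] using this
  have h1 : ∀ i, c (Fin.castAdd s i) = 0 := hx _ <| by
    simpa [h2] using hc
  intro i
  refine Fin.addCases h1 h2 i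

theorem det_ne_zero_of_linearIndependent {V : Type*} [AddCommGroup V] [Module F V] {N : ℕ}
    (b : Basis (Fin N) F V) {x : Fin N → V} (hx : LinearIndependent F x) : b.det x ≠ 0 := by
  have := Module.Finite.of_basis b
  refine IsUnit.ne_zero ((b.is_basis_iff_det).1 ⟨hx, ?_⟩)
  exact hx.span_eq_top_of_card_eq_finrank' (by rw [finrank_eq_card_basis b])

theorem linearIndependent_of_det_ne_zero {V : Type*} [AddCommGroup V] [Module F V] {N : ℕ}
    (b : Basis (Fin N) F V) {x : Fin N → V} (hx : b.det x ≠ 0) : LinearIndependent F x :=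
  ((b.is_basis_iff_det).2 (Ne.isUnit hx)).1

theorem span_of_det_ne_zero {V : Type*} [AddCommGroup V] [Module F V] {N : ℕ}
    (b : Basis (Fin N) F V) {x : Fin N → V} (hx : b.det x ≠ 0) :
    Submodule.span F (Set.range x) = ⊤ :=
  ((b.is_basis_iff_det).2 (Ne.isUnit hx)).2

theorem sumElim_finSumFinEquiv_symm {V : Type*} {r s : ℕ} (x : Fin r → V) (y : Fin s → V) :
    Sum.elim x y ∘ finSumFinEquiv.symm = Fin.append x y := by
  funext m
  refine Fin.addCases (fun i => ?_) (fun i => ?_) m <;> simp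

/-- A complex with finitely many non-zero terms contributes finitely many factors to an alternating
product over all the integers, since determinants of size zero are `1`. -/
theorem hasFiniteMulSupport_of_succ {B : Type*} [One B] {N : ℤ → ℕ}
    (hN : {j | N j ≠ 0}.Finite) {f : ℤ → B}
    (hf : ∀ j, N (j + 1) = 0 → f j = 1) : Function.HasFiniteMulSupport f := by
  have h := hN.preimage (f := fun j : ℤ => j + 1) (fun _ _ _ _ h => by simpa using h)
  refine h.subset fun j hj => ?_
  simp only [Set.mem_preimage, Set.mem_ofPred_eq]
  exact fun h0 => hj (hf j h0)

theorem finprod_int_add_one (f : ℤ → F) : ∏ᶠ j, f (j + 1) = ∏ᶠ j, f j :=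
  finprod_comp_equiv (Equiv.addRight (1 : ℤ))

/-- The ranks in an exact complex are determined by the dimensions of its terms. -/
theorem ranks_unique {N r r' : ℤ → ℕ} (hN : {j | N j ≠ 0}.Finite)
    (h : ∀ j, r j + r (j + 1) = N (j + 1)) (h' : ∀ j, r' j + r' (j + 1) = N (j + 1)) :
    r = r' := by
  obtain ⟨J, hJ⟩ := hN.bddAbove
  have h0 : ∀ j, J < j → N j = 0 := fun j hj => by
    by_contra hne
    exact absurd (hJ hne) (not_le.2 hj)
  have key : ∀ k : ℕ, ∀ j : ℤ, J < j + k → r j = r' j := by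
    intro k
    induction k with
    | zero =>
      intro j hj
      have h1 := h (j - 1)
      have h2 := h' (j - 1)
      rw [sub_add_cancel, h0 j (by simpa using hj)] at h1 h2
      omega
    | succ k ih =>
      intro j hj
      have h1 := h j
      have h2 := h' j
      have := ih (j + 1) (by push_cast at hj; omega)
      omega
  funext j
  exact key (J - j + 1).toNat j (by omega)

variable {V : ℤ → Type v} [∀ j, AddCommGroup (V j)] [∀ j, Module F (V j)]
  {D : ∀ j, V j →ₗ[F] V (j + 1)} {N : ℤ → ℕ} (b : ∀ j, Basis (Fin (N j)) F (V j))

/-- Two choices of the lifted families differ by block triangular matrices whose diagonal blocks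
in adjacent degrees agree, so their contributions to the alternating product cancel. -/
theorem IsComplexDet.unique (hN : {j | N j ≠ 0}.Finite) (hD : ∀ j x, D (j + 1) (D j x) = 0)
    {x y : F} (hx : IsComplexDet D b x) (hy : IsComplexDet D b y) : x = y := by
  obtain ⟨r, w, h, hw, rfl⟩ := hx
  obtain ⟨r', w', h', hw', rfl⟩ := hy
  obtain rfl := ranks_unique hN h h'
  let bs : ∀ j, Basis (Fin (r j) ⊕ Fin (r (j + 1))) F (V (j + 1)) := fun j =>
    (b (j + 1)).reindex (finSumFinEquiv.trans (finCongr (h j))).symm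
  have hbs : ∀ (w : ∀ j, Fin (r j) → V j) j,
      (bs j).det (Sum.elim (fun i => D j (w j i)) (w (j + 1))) =
        (b (j + 1)).det (liftFamily D w h j) := by
    intro w j
    rw [Basis.det_reindex]
    congr 1
    funext m
    rw [liftFamily, ← sumElim_finSumFinEquiv_symm]
    rfl
  have hbas : ∀ j, IsUnit ((bs j).det (Sum.elim (fun i => D j (w' j i)) (w' (j + 1)))) := by
    intro j
    rw [hbs]
    exact (hw' j).isUnit
  -- the basis `D w'^j, w'^{j+1}`, in which the other lifted family has the matrix `T j`
  let β : ∀ j, Basis (Fin (r j) ⊕ Fin (r (j + 1))) F (V (j + 1)) := fun j =>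
    Basis.mk ((bs j).is_basis_iff_det.2 (hbas j)).1 ((bs j).is_basis_iff_det.2 (hbas j)).2.ge
  have hβl : ∀ j i, β j (Sum.inl i) = D j (w' j i) := fun j i => by simp [β]
  have hβr : ∀ j i, β j (Sum.inr i) = w' (j + 1) i := fun j i => by simp [β]
  have hβ : ∀ j, ⇑(β j) = Sum.elim (fun i => D j (w' j i)) (w' (j + 1)) := fun j => by
    simp [β]
  let T : ∀ j, Matrix (Fin (r j) ⊕ Fin (r (j + 1))) (Fin (r j) ⊕ Fin (r (j + 1))) F := fun j =>
    (β j).toMatrix (Sum.elim (fun i => D j (w j i)) (w (j + 1)))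
  have hT : ∀ j, (b (j + 1)).det (liftFamily D w h j) =
      (b (j + 1)).det (liftFamily D w' h j) * (T j).det := by
    intro j
    rw [← hbs w, ← hbs w', AlternatingMap.eq_smul_basis_det (β j) (bs j).det, ← hβ,
      AlternatingMap.smul_apply, smul_eq_mul, AlternatingMap.smul_apply, smul_eq_mul,
      Basis.det_self, mul_one, Basis.det_apply]
    rfl
  -- modulo the boundaries, the family `w` is expressed by `E` in terms of `w'`
  let E : ∀ j, Matrix (Fin (r (j + 1))) (Fin (r (j + 1))) F := fun j => (T j).toBlocks₂₂
  have hDw : ∀ j l, D (j + 1) (w (j + 1) l) = ∑ i, E j i l • β (j + 1) (Sum.inl i) := by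
    intro j l
    have e := (β j).sum_repr (w (j + 1) l)
    rw [Fintype.sum_sum_type] at e
    have := congrArg (D (j + 1)) e
    rw [map_add, map_sum, map_sum] at this
    simp only [map_smul, hβl, hβr, hD, smul_zero, Finset.sum_const_zero, zero_add] at this
    rw [← this]
    refine Finset.sum_congr rfl fun i _ => ?_
    rw [hβl]
    rfl
  have hT1 : ∀ j, T (j + 1) = Matrix.fromBlocks (E j) (T (j + 1)).toBlocks₁₂ 0 (E (j + 1)) := by
    intro j
    rw [← Matrix.fromBlocks_toBlocks (T (j + 1))]
    have hrep : ∀ l, (β (j + 1)).repr (D (j + 1) (w (j + 1) l)) =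
        ∑ i, E j i l • Finsupp.single (Sum.inl i) 1 := by
      intro l
      rw [hDw]
      simp [map_sum]
    congr 1
    · ext i l
      change (β (j + 1)).repr (D (j + 1) (w (j + 1) l)) (Sum.inl i) = _
      rw [hrep]
      simp [Finsupp.finsetSum_apply, Finsupp.single_apply]
    · ext i l
      change (β (j + 1)).repr (D (j + 1) (w (j + 1) l)) (Sum.inr i) = _
      rw [hrep]
      simp [Finsupp.finsetSum_apply]
  have hdet : ∀ j, (T (j + 1)).det = (E j).det * (E (j + 1)).det := by
    intro j
    rw [hT1, Matrix.det_fromBlocks_zero₂₁]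
  have hN1 : ∀ j, N (j + 1) = 0 → r j = 0 ∧ r (j + 1) = 0 := fun j hj => by
    have := h j
    omega
  have hTu : ∀ j, (T j).det ≠ 0 := fun j h0 => hw j (by rw [hT, h0, mul_zero])
  have hEu : ∀ j, (E j).det ≠ 0 := fun j h0 => hTu (j + 1) (by rw [hdet, h0, zero_mul])
  have e1 : ∀ j, (b (j + 1)).det (liftFamily D w h j) ^ ((j + 1).negOnePow : ℤ) =
      (b (j + 1)).det (liftFamily D w' h j) ^ ((j + 1).negOnePow : ℤ) *
        (T j).det ^ ((j + 1).negOnePow : ℤ) := fun j => by rw [hT, mul_zpow]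
  have hone : ∀ (n : ℕ) (M : Matrix (Fin n) (Fin n) F), n = 0 → M.det = 1 := by
    rintro n M rfl
    exact Matrix.det_fin_zero
  have hdet1 : ∀ (n : ℕ) (W : Type v) [AddCommGroup W] [Module F W] (c : Basis (Fin n) F W)
      (y : Fin n → W), n = 0 → c.det y = 1 := by
    rintro n W _ _ c y rfl
    rw [Basis.det_apply, Matrix.det_fin_zero]
  have hfT : ∀ j, N (j + 1) = 0 → (T j).det = 1 := by
    intro j hj
    have := hT j
    rwa [hdet1 _ _ _ _ hj, hdet1 _ _ _ _ hj, one_mul, eq_comm] at this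
  rw [finprod_congr e1, finprod_mul_distrib]
  · rw [mul_eq_left₀]
    · rw [← finprod_int_add_one]
      -- `det (T (j + 1)) = det (E j) * det (E (j + 1))`, so that the alternating product telescopes
      have e2 : ∀ j : ℤ, (T (j + 1)).det ^ ((j + 1 + 1).negOnePow : ℤ) =
          ((E j).det ^ ((j + 1).negOnePow : ℤ))⁻¹ * (E (j + 1)).det ^ ((j + 1 + 1).negOnePow : ℤ) :=
        fun j => by
          rw [hdet, mul_zpow]
          congr 1
          rw [← zpow_neg, Int.negOnePow_succ (j + 1)]
          simp
      rw [finprod_congr e2, finprod_mul_distrib, finprod_inv_distrib,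
        finprod_int_add_one (fun j => (E j).det ^ ((j + 1).negOnePow : ℤ)), inv_mul_cancel₀]
      · refine finprod_induction (p := fun z : F => z ≠ 0) one_ne_zero
          (fun _ _ => mul_ne_zero) fun j => zpow_ne_zero _ (hEu j)
      · refine hasFiniteMulSupport_of_succ hN fun j hj => ?_
        rw [hone _ _ (hN1 j hj).2, one_zpow, inv_one]
      · refine hasFiniteMulSupport_of_succ
          (hN.preimage (f := fun j : ℤ => j + 1) (fun _ _ _ _ h => by simpa using h)) fun j hj => ?_
        rw [hone _ _ (hN1 (j + 1) (by simpa using hj)).2, one_zpow]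
    · refine finprod_induction (p := fun z : F => z ≠ 0) one_ne_zero
        (fun _ _ => mul_ne_zero) fun j => zpow_ne_zero _ (hw' j)
  · refine hasFiniteMulSupport_of_succ hN fun j hj => ?_
    rw [hdet1 _ _ _ _ hj, one_zpow]
  · refine hasFiniteMulSupport_of_succ hN fun j hj => ?_
    rw [hfT j hj, one_zpow]

/-- If `D w^j, w^{j+1}` and `D w^{j+1}, w^{j+2}` are bases, then a cycle has no component along
`w^{j+1}`, hence is a boundary. -/
theorem exact_of_lift (hD : ∀ j x, D (j + 1) (D j x) = 0) {r : ℤ → ℕ} {w : ∀ j, Fin (r j) → V j}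
    {h : ∀ j, r j + r (j + 1) = N (j + 1)} {j : ℤ}
    (h1 : (b (j + 1)).det (liftFamily D w h j) ≠ 0)
    (h2 : (b (j + 1 + 1)).det (liftFamily D w h (j + 1)) ≠ 0) :
    Function.Exact (D j) (D (j + 1)) := by
  intro x
  refine ⟨fun hx => ?_, fun ⟨y, hy⟩ => hy ▸ hD j y⟩
  have hli : LinearIndependent F (fun i => D (j + 1) (w (j + 1) i)) := by
    have := (linearIndependent_of_det_ne_zero _ h2).comp
      (fun i => Fin.cast (h (j + 1)) (Fin.castAdd _ i))
      ((Fin.cast_injective _).comp (Fin.castAdd_injective _ _))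
    convert this using 2 with i
    simp [liftFamily]
  have hx' : x ∈ Submodule.span F (Set.range (liftFamily D w h j)) := by
    rw [span_of_det_ne_zero _ h1]
    trivial
  have hr : Set.range (liftFamily D w h j) =
      Set.range (Fin.append (fun i => D j (w j i)) (w (j + 1))) := by
    change Set.range (Fin.append (fun i => D j (w j i)) (w (j + 1)) ∘ Fin.cast (h j).symm) = _
    exact (finCongr (h j).symm).surjective.range_comp _
  rw [hr] at hx'
  obtain ⟨c, rfl⟩ := (Submodule.mem_span_range_iff_exists_fun F).1 hx'
  rw [Fin.sum_univ_add] at hx ⊢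
  simp only [Fin.append_left, Fin.append_right] at hx ⊢
  have hc : ∀ i, c (Fin.natAdd _ i) = 0 := by
    refine Fintype.linearIndependent_iff.1 hli _ ?_
    simpa [map_sum, hD] using hx
  refine ⟨∑ i, c (Fin.castAdd _ i) • w j i, ?_⟩
  simp [map_sum, hc]

theorem isExactComplex_of_lift (hD : ∀ j x, D (j + 1) (D j x) = 0) {r : ℤ → ℕ}
    {w : ∀ j, Fin (r j) → V j} {h : ∀ j, r j + r (j + 1) = N (j + 1)}
    (hw : ∀ j, (b (j + 1)).det (liftFamily D w h j) ≠ 0) : IsExactComplex D :=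
  fun j => exact_of_lift b hD (hw j) (hw (j + 1))

include b in
theorem finrank_range_add_of_exact {j : ℤ} (hex : Function.Exact (D j) (D (j + 1))) :
    finrank F (LinearMap.range (D j)) + finrank F (LinearMap.range (D (j + 1))) = N (j + 1) := by
  have := Module.Finite.of_basis (b (j + 1))
  have h1 := LinearMap.finrank_range_add_finrank_ker (D (j + 1))
  rw [hex.linearMap_ker_eq, finrank_eq_card_basis (b (j + 1)), Fintype.card_fin] at h1
  omega

/-- Families with linearly independent images under the differentials are lifted families, if their
sizes add up to the dimensions of the terms. -/
theorem det_liftFamily_ne_zero (hD : ∀ j x, D (j + 1) (D j x) = 0) {r : ℤ → ℕ}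
    {w : ∀ j, Fin (r j) → V j} (h : ∀ j, r j + r (j + 1) = N (j + 1)) {j : ℤ}
    (h1 : LinearIndependent F (fun i => D j (w j i)))
    (h2 : LinearIndependent F (fun i => D (j + 1) (w (j + 1) i))) :
    (b (j + 1)).det (liftFamily D w h j) ≠ 0 :=
  det_ne_zero_of_linearIndependent _ <|
    (linearIndependent_append (D (j + 1)) h1 (fun _ => hD j _) h2).comp _ (Fin.cast_injective _)

/-- In an exact complex with bases `b`, lifted families can be chosen inside the bases. -/
theorem exists_lift_of_exact (hD : ∀ j x, D (j + 1) (D j x) = 0) (hex : IsExactComplex D) :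
    ∃ (r : ℤ → ℕ) (I : ∀ j, Fin (r j) → Fin (N j)) (h : ∀ j, r j + r (j + 1) = N (j + 1)),
      ∀ j, (b (j + 1)).det (liftFamily D (fun j i => b j (I j i)) h j) ≠ 0 := by
  choose I hI using fun j => exists_linearIndependent_subfamily (b j) (D j)
  exact ⟨_, I, fun j => finrank_range_add_of_exact b (hex j),
    fun j => det_liftFamily_ne_zero b hD _ (hI j) (hI (j + 1))⟩

theorem Basis.det_of_fin_zero {W : Type*} [AddCommGroup W] [Module F W] {n : ℕ}
    (c : Basis (Fin n) F W) (y : Fin n → W) (hn : n = 0) : c.det y = 1 := by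
  subst hn
  rw [Basis.det_apply, Matrix.det_fin_zero]

/-- The effect of an isomorphism of complexes on the determinant. -/
theorem IsComplexDet.map_equiv {V' : ℤ → Type*} [∀ j, AddCommGroup (V' j)] [∀ j, Module F (V' j)]
    {D' : ∀ j, V' j →ₗ[F] V' (j + 1)} (b' : ∀ j, Basis (Fin (N j)) F (V' j))
    (hN : {j | N j ≠ 0}.Finite) (e : ∀ j, V j ≃ₗ[F] V' j)
    (he : ∀ j x, D' j (e j x) = e (j + 1) (D j x)) {x : F} (hx : IsComplexDet D b x) :
    IsComplexDet D' b' (x * ∏ᶠ j : ℤ,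
      (b' (j + 1)).det (fun i => e (j + 1) (b (j + 1) i)) ^ ((j + 1).negOnePow : ℤ)) := by
  obtain ⟨r, w, h, hw, rfl⟩ := hx
  have key : ∀ j, (b' (j + 1)).det (liftFamily D' (fun j i => e j (w j i)) h j) =
      (b (j + 1)).det (liftFamily D w h j) *
        (b' (j + 1)).det (fun i => e (j + 1) (b (j + 1) i)) := by
    intro j
    have e1 : liftFamily D' (fun j i => e j (w j i)) h j =
        fun m => e (j + 1) (liftFamily D w h j m) := by
      funext m
      unfold liftFamily
      refine Fin.addCases (fun i => ?_) (fun i => ?_) (Fin.cast (h j).symm m)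
      · simp [he]
      · simp
    have e2 := AlternatingMap.eq_smul_basis_det (b (j + 1))
      ((b' (j + 1)).det.compLinearMap (e (j + 1)).toLinearMap)
    have e3 := congrArg (fun f => f (liftFamily D w h j)) e2
    simp only [AlternatingMap.smul_apply, smul_eq_mul] at e3
    rw [e1, mul_comm]
    exact e3
  have hne : ∀ j, (b' (j + 1)).det (fun i => e (j + 1) (b (j + 1) i)) ≠ 0 := fun j => by
    refine det_ne_zero_of_linearIndependent _ ?_
    exact (b (j + 1)).linearIndependent.map' _ (e (j + 1)).ker
  refine ⟨r, fun j i => e j (w j i), h, fun j => ?_, ?_⟩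
  · rw [key]
    exact mul_ne_zero (hw j) (hne j)
  · rw [← finprod_mul_distrib]
    · refine finprod_congr fun j => ?_
      rw [key, mul_zpow]
    · refine hasFiniteMulSupport_of_succ hN fun j hj => ?_
      rw [Basis.det_of_fin_zero _ _ hj, one_zpow]
    · refine hasFiniteMulSupport_of_succ hN fun j hj => ?_
      rw [Basis.det_of_fin_zero _ _ hj, one_zpow]

end LinearAlgebra

/-! ### Complexes given by matrices, and their specializations -/

section Matrices

open Module

variable {A : Type u} [CommRing A] {N : ℤ → ℕ}
  (M : ∀ j : ℤ, Matrix (Fin (N (j + 1))) (Fin (N j)) A)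

/-- The determinant of the columns `I j` of `M j` followed by the unit vectors indexed by
`I (j + 1)`: the determinant of the lifted family chosen inside the bases. -/
def liftDet {r : ℤ → ℕ} (I : ∀ j, Fin (r j) → Fin (N j))
    (h : ∀ j, r j + r (j + 1) = N (j + 1)) (j : ℤ) : A :=
  (Matrix.of fun x m : Fin (N (j + 1)) => Fin.append (fun i => M j x (I j i))
    (fun i => if x = I (j + 1) i then 1 else 0) (Fin.cast (h j).symm m)).det

/-- The product of the values of `f` at the odd integers, which correspond to the terms of even
degree of a complex. -/
def evenProd (f : ℤ → A) : A := ∏ᶠ j : ℤ, if Even (j + 1) then f j else 1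

/-- The product of the values of `f` at the even integers, which correspond to the terms of odd
degree of a complex. -/
def oddProd (f : ℤ → A) : A := ∏ᶠ j : ℤ, if Even (j + 1) then 1 else f j

theorem liftDet_eq_one {r : ℤ → ℕ} (I : ∀ j, Fin (r j) → Fin (N j))
    (h : ∀ j, r j + r (j + 1) = N (j + 1)) {j : ℤ} (hj : N (j + 1) = 0) :
    liftDet M I h j = 1 := by
  have : IsEmpty (Fin (N (j + 1))) := by
    rw [hj]
    infer_instance
  exact Matrix.det_isEmpty

/-- The alternating product is the image of a fraction over the ring of coefficients. -/
theorem finprod_zpow_negOnePow {F : Type*} [Field F] (φ : A →+* F) (hN : {j | N j ≠ 0}.Finite)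
    {f : ℤ → A} (hf : ∀ j, N (j + 1) = 0 → f j = 1) :
    ∏ᶠ j : ℤ, φ (f j) ^ ((j + 1).negOnePow : ℤ) = φ (evenProd f) / φ (oddProd f) := by
  have h1 : Function.HasFiniteMulSupport fun j : ℤ => if Even (j + 1) then f j else 1 :=
    hasFiniteMulSupport_of_succ hN fun j hj => by simp [hf j hj]
  have h2 : Function.HasFiniteMulSupport fun j : ℤ => if Even (j + 1) then 1 else f j :=
    hasFiniteMulSupport_of_succ hN fun j hj => by simp [hf j hj]
  have e1 : φ (evenProd f) = ∏ᶠ j : ℤ, φ (if Even (j + 1) then f j else 1) :=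
    (φ : A →* F).map_finprod h1
  have e2 : φ (oddProd f) = ∏ᶠ j : ℤ, φ (if Even (j + 1) then 1 else f j) :=
    (φ : A →* F).map_finprod h2
  rw [e1, e2, ← finprod_div_distrib]
  · refine finprod_congr fun j => ?_
    by_cases hj : Even (j + 1)
    · simp [hj, Int.negOnePow_even _ hj]
    · simp [hj, Int.negOnePow_odd _ (Int.not_even_iff_odd.1 hj)]
  · exact hasFiniteMulSupport_of_succ hN fun j hj => by simp [hf j hj]
  · exact hasFiniteMulSupport_of_succ hN fun j hj => by simp [hf j hj]

theorem finprod_ne_zero' {F : Type*} [CommRing F] [IsDomain F] {f : ℤ → F} (hf : ∀ j, f j ≠ 0) :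
    ∏ᶠ j, f j ≠ 0 :=
  finprod_induction (p := fun z : F => z ≠ 0) one_ne_zero (fun _ _ => mul_ne_zero) hf

theorem map_evenProd_ne_zero {F : Type*} [Field F] (φ : A →+* F) (hN : {j | N j ≠ 0}.Finite)
    {f : ℤ → A} (hf : ∀ j, N (j + 1) = 0 → f j = 1) (h0 : ∀ j, φ (f j) ≠ 0) :
    φ (evenProd f) ≠ 0 := by
  have h1 : Function.HasFiniteMulSupport fun j : ℤ => if Even (j + 1) then f j else 1 :=
    hasFiniteMulSupport_of_succ hN fun j hj => by simp [hf j hj]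
  have e1 : φ (evenProd f) = ∏ᶠ j : ℤ, φ (if Even (j + 1) then f j else 1) :=
    (φ : A →* F).map_finprod h1
  rw [e1]
  refine finprod_ne_zero' fun j => ?_
  split_ifs
  · exact h0 j
  · simp

theorem map_oddProd_ne_zero {F : Type*} [Field F] (φ : A →+* F) (hN : {j | N j ≠ 0}.Finite)
    {f : ℤ → A} (hf : ∀ j, N (j + 1) = 0 → f j = 1) (h0 : ∀ j, φ (f j) ≠ 0) :
    φ (oddProd f) ≠ 0 := by
  have h1 : Function.HasFiniteMulSupport fun j : ℤ => if Even (j + 1) then 1 else f j :=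
    hasFiniteMulSupport_of_succ hN fun j hj => by simp [hf j hj]
  have e1 : φ (oddProd f) = ∏ᶠ j : ℤ, φ (if Even (j + 1) then 1 else f j) :=
    (φ : A →* F).map_finprod h1
  rw [e1]
  refine finprod_ne_zero' fun j => ?_
  split_ifs
  · simp
  · exact h0 j

/-- The complex `(V^•, D)` with the bases `b` has the matrices `M`, specialized along `φ`. -/
def Realizes {F : Type*} [Field F] (φ : A →+* F) {V : ℤ → Type*} [∀ j, AddCommGroup (V j)]
    [∀ j, Module F (V j)] (D : ∀ j, V j →ₗ[F] V (j + 1)) (b : ∀ j, Basis (Fin (N j)) F (V j)) :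
    Prop :=
  (∀ j, LinearMap.toMatrix (b j) (b (j + 1)) (D j) = (M j).map φ) ∧
    ∀ j x, D (j + 1) (D j x) = 0

section

variable {M} {F : Type*} [Field F] {φ : A →+* F} {V : ℤ → Type*} [∀ j, AddCommGroup (V j)]
  [∀ j, Module F (V j)] {D : ∀ j, V j →ₗ[F] V (j + 1)} {b : ∀ j, Basis (Fin (N j)) F (V j)}

/-- Lifted families inside the bases have determinants defined over the ring of coefficients, which
are compatible with specialization. -/
theorem Realizes.det_liftFamily (hR : Realizes M φ D b) {r : ℤ → ℕ}
    (I : ∀ j, Fin (r j) → Fin (N j)) (h : ∀ j, r j + r (j + 1) = N (j + 1)) (j : ℤ) :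
    (b (j + 1)).det (liftFamily D (fun j i => b j (I j i)) h j) = φ (liftDet M I h j) := by
  rw [Basis.det_apply, liftDet, RingHom.map_det]
  congr 1
  ext x m
  rw [Basis.toMatrix_apply, liftFamily, RingHom.mapMatrix_apply, Matrix.map_apply, Matrix.of_apply]
  refine Fin.addCases (fun i => ?_) (fun i => ?_) (Fin.cast (h j).symm m)
  · have := congrFun (congrFun (hR.1 j) x) (I j i)
    rw [LinearMap.toMatrix_apply] at this
    simpa using this
  · simp only [Fin.append_right, Basis.repr_self, Finsupp.single_apply, eq_comm]
    split_ifs <;> simp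

theorem Realizes.exists_liftDet (hR : Realizes M φ D b) (hex : IsExactComplex D) :
    ∃ (r : ℤ → ℕ) (I : ∀ j, Fin (r j) → Fin (N j)) (h : ∀ j, r j + r (j + 1) = N (j + 1)),
      ∀ j, φ (liftDet M I h j) ≠ 0 := by
  obtain ⟨r, I, h, hI⟩ := exists_lift_of_exact b hR.2 hex
  exact ⟨r, I, h, fun j => hR.det_liftFamily I h j ▸ hI j⟩

theorem Realizes.isExactComplex (hR : Realizes M φ D b) {r : ℤ → ℕ}
    {I : ∀ j, Fin (r j) → Fin (N j)} {h : ∀ j, r j + r (j + 1) = N (j + 1)}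
    (hI : ∀ j, φ (liftDet M I h j) ≠ 0) : IsExactComplex D :=
  isExactComplex_of_lift b hR.2 fun j => (hR.det_liftFamily I h j).trans_ne (hI j)

/-- The determinant of the specialization, as the specialization of a fraction. -/
theorem Realizes.isComplexDet (hR : Realizes M φ D b) (hN : {j | N j ≠ 0}.Finite) {r : ℤ → ℕ}
    {I : ∀ j, Fin (r j) → Fin (N j)} {h : ∀ j, r j + r (j + 1) = N (j + 1)}
    (hI : ∀ j, φ (liftDet M I h j) ≠ 0) :
    IsComplexDet D b (φ (evenProd (liftDet M I h)) / φ (oddProd (liftDet M I h))) := by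
  refine ⟨r, _, h, fun j => (hR.det_liftFamily I h j).trans_ne (hI j), ?_⟩
  rw [← finprod_zpow_negOnePow φ hN fun j hj => liftDet_eq_one M I h hj]
  exact finprod_congr fun j => by rw [hR.det_liftFamily I h j]

/-- If the specialization of a complex along `φ` is exact, then so is its specialization along any
injective map `ψ`, and the determinant of the latter is the image of a fraction which specializes
along `φ` to the determinant of the former, with non-zero numerator and denominator. -/
theorem Realizes.specialize (hR : Realizes M φ D b) (hN : {j | N j ≠ 0}.Finite)
    (hex : IsExactComplex D) {F' : Type*} [Field F'] {ψ : A →+* F'} (hψ : Function.Injective ψ)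
    {V' : ℤ → Type*} [∀ j, AddCommGroup (V' j)] [∀ j, Module F' (V' j)]
    {D' : ∀ j, V' j →ₗ[F'] V' (j + 1)} {b' : ∀ j, Basis (Fin (N j)) F' (V' j)}
    (hR' : Realizes M ψ D' b') :
    IsExactComplex D' ∧ ∃ x y : A, φ x ≠ 0 ∧ φ y ≠ 0 ∧ IsComplexDet D b (φ x / φ y) ∧
      IsComplexDet D' b' (ψ x / ψ y) := by
  obtain ⟨r, I, h, hI⟩ := hR.exists_liftDet hex
  have hI' : ∀ j, ψ (liftDet M I h j) ≠ 0 := fun j h0 => hI j <| by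
    rw [(map_eq_zero_iff ψ hψ).1 h0, map_zero]
  have h1 : ∀ j, N (j + 1) = 0 → liftDet M I h j = 1 := fun j hj => liftDet_eq_one M I h hj
  exact ⟨hR'.isExactComplex hI', _, _, map_evenProd_ne_zero φ hN h1 hI,
    map_oddProd_ne_zero φ hN h1 hI, hR.isComplexDet hN hI, hR'.isComplexDet hN hI'⟩

end

end Matrices

/-! ### Acyclicity of Koszul complexes -/

section KoszulAcyclic

variable {R : Type u} [CommRing R] {n : ℕ}

/-- Contraction with the `i`-th basis vector, on families indexed by subsets. -/
def contract (i : Fin n) (z : Finset (Fin n) → R) (J : Finset (Fin n)) : R :=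
  if i ∈ J then 0 else kSign i J • z (insert i J)

/-- Exterior multiplication by the `i`-th basis vector, on families indexed by subsets. -/
def wedge (i : Fin n) (z : Finset (Fin n) → R) (J : Finset (Fin n)) : R :=
  if i ∈ J then kSign i J • z (J.erase i) else 0

/-- The total Koszul differential of a sequence `f`, on families indexed by subsets. -/
def kosz (f : Fin n → R) (z : Finset (Fin n) → R) (J : Finset (Fin n)) : R :=
  ∑ i, f i * contract i z J

/-- Exterior multiplication by `∑ c_i e_i`, on families indexed by subsets. -/
def koszWedge (c : Fin n → R) (z : Finset (Fin n) → R) (J : Finset (Fin n)) : R :=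
  ∑ i, c i * wedge i z J

theorem kSign_mul_self (i : Fin n) (J : Finset (Fin n)) : kSign i J * kSign i J = 1 := by
  rw [kSign, ← pow_add, ← two_mul, pow_mul]
  simp

theorem kSign_insert_self (i : Fin n) (J : Finset (Fin n)) :
    kSign i (insert i J) = kSign i J := by
  rw [kSign, kSign, Finset.filter_insert, if_neg (lt_irrefl i)]

theorem kSign_erase_self (i : Fin n) (J : Finset (Fin n)) :
    kSign i (J.erase i) = kSign i J := by
  rw [← kSign_insert_self i (J.erase i)]
  by_cases h : i ∈ J
  · rw [Finset.insert_erase h]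
  · rw [Finset.erase_eq_of_notMem h, kSign_insert_self]

theorem contract_contract (i l : Fin n) (z : Finset (Fin n) → R) (J : Finset (Fin n)) :
    contract i (contract l z) J + contract l (contract i z) J = 0 := by
  by_cases hi : i ∈ J
  · simp [contract, hi]
  by_cases hl : l ∈ J
  · simp [contract, hl]
  by_cases hil : i = l
  · subst hil
    simp [contract]
  have hli : l ≠ i := fun h => hil h.symm
  simp only [contract, hi, hl, if_false, Finset.mem_insert, hil, hli, or_self]
  rw [Finset.insert_comm l i, smul_smul, smul_smul, ← add_smul, kSign_swap hi hl hil, zero_smul]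

/-- The anticommutation relation of contractions and exterior multiplications. -/
theorem contract_wedge (i l : Fin n) (z : Finset (Fin n) → R) (J : Finset (Fin n)) :
    contract i (wedge l z) J + wedge l (contract i z) J = if i = l then z J else 0 := by
  by_cases hil : i = l
  · subst hil
    by_cases hi : i ∈ J
    · simp only [contract, wedge, hi, if_true, Finset.mem_erase, ne_eq, not_true, false_and,
        if_false, zero_add]
      rw [Finset.insert_erase hi, smul_smul, kSign_erase_self, kSign_mul_self, one_smul]
    · simp only [contract, wedge, hi, if_true, if_false, Finset.mem_insert, true_or, add_zero]
      rw [Finset.erase_insert hi, smul_smul, kSign_insert_self, kSign_mul_self, one_smul]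
  · have hli : l ≠ i := fun h => hil h.symm
    by_cases hi : i ∈ J
    · simp [contract, wedge, hi, hil]
    · by_cases hl : l ∈ J
      · have hi' : i ∉ J.erase l := fun h => hi (Finset.mem_of_mem_erase h)
        simp only [contract, wedge, hi, hl, hil, if_true, if_false, Finset.mem_insert, or_true,
          Finset.mem_erase, and_false]
        rw [smul_smul, smul_smul, Finset.erase_insert_of_ne hil, ← add_smul]
        have h1 := kSign_swap hi' (Finset.notMem_erase l J) hil
        rw [Finset.insert_erase hl] at h1
        have h2 : kSign l (insert i J) = kSign l (insert i (J.erase l)) := by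
          rw [← kSign_erase_self l (insert i J), Finset.erase_insert_of_ne hil]
        rw [kSign_erase_self l J] at h1
        have h3 : kSign i J * kSign l (insert i J) + kSign l J * kSign i (J.erase l) = 0 := by
          rw [h2]
          linear_combination kSign i (J.erase l) * kSign i J * h1 -
            kSign i J * kSign l (insert i (J.erase l)) * kSign_mul_self i (J.erase l) -
            kSign l J * kSign i (J.erase l) * kSign_mul_self i J
        rw [h3, zero_smul]
      · simp [contract, wedge, hi, hl, hil, hli]

theorem contract_sum {ι : Type*} (s : Finset ι) (i : Fin n) (c : ι → R)
    (z : ι → Finset (Fin n) → R) (J : Finset (Fin n)) :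
    contract i (fun J => ∑ l ∈ s, c l * z l J) J = ∑ l ∈ s, c l * contract i (z l) J := by
  unfold contract
  split_ifs
  · simp
  · rw [Finset.smul_sum]
    exact Finset.sum_congr rfl fun l _ => (mul_smul_comm _ _ _).symm

theorem wedge_sum {ι : Type*} (s : Finset ι) (i : Fin n) (c : ι → R)
    (z : ι → Finset (Fin n) → R) (J : Finset (Fin n)) :
    wedge i (fun J => ∑ l ∈ s, c l * z l J) J = ∑ l ∈ s, c l * wedge i (z l) J := by
  unfold wedge
  split_ifs
  · rw [Finset.smul_sum]
    exact Finset.sum_congr rfl fun l _ => (mul_smul_comm _ _ _).symm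
  · simp

/-- The diagonal has to be treated separately, since `2` need not be regular. -/
theorem sum_eq_zero_of_alternating {a : Fin n → Fin n → R} (h : ∀ i l, a i l + a l i = 0)
    (h0 : ∀ i, a i i = 0) : ∑ i, ∑ l, a i l = 0 := by
  rw [← Finset.univ.sum_product' Finset.univ a]
  refine Finset.sum_involution (fun x _ => (x.2, x.1)) (fun x _ => h _ _) ?_ (by simp) (by simp)
  rintro ⟨i, l⟩ _ hne heq
  obtain rfl : l = i := (Prod.ext_iff.1 heq).1
  exact hne (h0 l)

theorem kosz_kosz (f : Fin n → R) (z : Finset (Fin n) → R) (J : Finset (Fin n)) :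
    kosz f (kosz f z) J = 0 := by
  have e : kosz f (kosz f z) J = ∑ i, ∑ l, f i * (f l * contract i (contract l z) J) := by
    refine Finset.sum_congr rfl fun i _ => ?_
    rw [← Finset.mul_sum]
    congr 1
    exact contract_sum _ _ _ _ _
  rw [e]
  refine sum_eq_zero_of_alternating (fun i l => ?_) fun i => ?_
  · linear_combination f i * f l * contract_contract i l z J
  · have : contract i (contract i z) J = 0 := by simp [contract]
    rw [this, mul_zero, mul_zero]

/-- Cartan homotopy formula: exterior multiplication by `c` is a homotopy between zero and the
multiplication by `∑ c_i f_i` on the Koszul complex of `f`. -/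
theorem kosz_koszWedge (f c : Fin n → R) (z : Finset (Fin n) → R) (J : Finset (Fin n)) :
    kosz f (koszWedge c z) J + koszWedge c (kosz f z) J = (∑ i, c i * f i) * z J := by
  have e1 : kosz f (koszWedge c z) J = ∑ i, ∑ l, f i * (c l * contract i (wedge l z) J) := by
    refine Finset.sum_congr rfl fun i _ => ?_
    rw [← Finset.mul_sum]
    congr 1
    exact contract_sum _ _ _ _ _
  have e2 : koszWedge c (kosz f z) J = ∑ i, ∑ l, f i * (c l * wedge l (contract i z) J) := by
    rw [Finset.sum_comm]
    refine Finset.sum_congr rfl fun l _ => ?_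
    have : wedge l (kosz f z) J = ∑ i, f i * wedge l (contract i z) J := wedge_sum _ _ _ _ _
    rw [this, Finset.mul_sum]
    exact Finset.sum_congr rfl fun i _ => by ring
  rw [e1, e2, ← Finset.sum_add_distrib, Finset.sum_mul]
  refine Finset.sum_congr rfl fun i _ => ?_
  rw [← Finset.sum_add_distrib]
  have e3 : ∀ l, f i * (c l * contract i (wedge l z) J) + f i * (c l * wedge l (contract i z) J) =
      if i = l then c l * f i * z J else 0 := by
    intro l
    have := contract_wedge i l z J
    split_ifs at this ⊢ with h
    · linear_combination f i * c l * this
    · linear_combination f i * c l * this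
  simp [e3]

theorem kosz_mem (f : Fin n → R) {I : Ideal R} {z : Finset (Fin n) → R} {J : Finset (Fin n)}
    (h : ∀ i ∉ J, z (insert i J) ∈ I) : kosz f z J ∈ I := by
  refine Ideal.sum_mem _ fun i _ => Ideal.mul_mem_left _ _ ?_
  unfold contract
  split_ifs with hi
  · exact I.zero_mem
  · exact zsmul_mem (h i hi) _

theorem koszWedge_mem (c : Fin n → R) {I : Ideal R} {z : Finset (Fin n) → R}
    {J : Finset (Fin n)} (h : ∀ i ∈ J, z (J.erase i) ∈ I) : koszWedge c z J ∈ I := by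
  refine Ideal.sum_mem _ fun i _ => Ideal.mul_mem_left _ _ ?_
  unfold wedge
  split_ifs with hi
  · exact zsmul_mem (h i hi) _
  · exact I.zero_mem

theorem kosz_add_mul (f : Fin n → R) (z y x : Finset (Fin n) → R) (g : R) (J : Finset (Fin n)) :
    kosz f (fun J => z J + x J + g * y J) J = kosz f z J + kosz f x J + g * kosz f y J := by
  simp only [kosz, Finset.mul_sum, ← Finset.sum_add_distrib]
  refine Finset.sum_congr rfl fun i _ => ?_
  unfold contract
  split_ifs
  · ring
  · simp only [zsmul_eq_mul]
    ring

theorem kosz_congr (f : Fin n → R) {z y : Finset (Fin n) → R} {J : Finset (Fin n)}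
    (h : ∀ i ∉ J, z (insert i J) = y (insert i J)) : kosz f z J = kosz f y J := by
  refine Finset.sum_congr rfl fun i _ => ?_
  unfold contract
  split_ifs with hi
  · rfl
  · rw [h i hi]

/-- The Koszul complex of `f` with coefficients in `R / I` is exact in homological degree `p`. -/
def KoszulExact (f : Fin n → R) (I : Ideal R) (p : ℕ) : Prop :=
  ∀ z : Finset (Fin n) → R, (∀ J, J.card + 1 = p → kosz f z J ∈ I) →
    ∃ y : Finset (Fin n) → R, ∀ J, J.card = p → z J - kosz f y J ∈ I

/-- Dimension shifting: an element of the ideal of `f` acts as zero on the Koszul homology of `f`,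
so if it is regular then the homology in degree `p` is a quotient of the homology in degree `p + 1`
of the complex modulo this element. -/
theorem KoszulExact.of_sup_span {f : Fin n → R} {I : Ideal R} {p : ℕ} {g : R}
    (hg : ∀ x, g * x ∈ I → x ∈ I) (hf : g ∈ Ideal.span (Set.range f))
    (h : KoszulExact f (I ⊔ Ideal.span {g}) (p + 1)) : KoszulExact f I p := by
  obtain ⟨c, hc⟩ := (Ideal.mem_span_range_iff_exists_fun).1 hf
  intro z hz
  have h1 : ∀ J : Finset (Fin n), J.card = p → kosz f (koszWedge c z) J - g * z J ∈ I := by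
    intro J hJ
    have h2 := kosz_koszWedge f c z J
    rw [hc] at h2
    rw [← h2, sub_add_cancel_left]
    refine I.neg_mem (koszWedge_mem c fun i hi => hz _ ?_)
    rw [Finset.card_erase_add_one hi, hJ]
  obtain ⟨v, hv⟩ := h (koszWedge c z) fun J hJ => by
    have := Ideal.mem_sup_left (T := Ideal.span {g}) (h1 J (by omega))
    have h3 : g * z J ∈ I ⊔ Ideal.span {g} :=
      Ideal.mem_sup_right (Ideal.mul_mem_right _ _ (Ideal.mem_span_singleton_self g))
    simpa using Ideal.add_mem _ this h3
  have h4 : ∀ J : Finset (Fin n), ∃ x y : R, x ∈ I ∧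
      (J.card = p + 1 → koszWedge c z J = kosz f v J + x + g * y) := by
    intro J
    by_cases hJ : J.card = p + 1
    · obtain ⟨x, hx, w, hw, e⟩ := Submodule.mem_sup.1 (hv J hJ)
      obtain ⟨y, rfl⟩ := Ideal.mem_span_singleton.1 hw
      exact ⟨x, y, hx, fun _ => by rw [add_assoc, e]; ring⟩
    · exact ⟨0, 0, I.zero_mem, fun h => absurd h hJ⟩
  choose x y hx hy using h4
  refine ⟨y, fun J hJ => hg _ ?_⟩
  have h5 : kosz f (koszWedge c z) J = kosz f (fun J => kosz f v J + x J + g * y J) J :=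
    kosz_congr f fun i hi => hy _ (by rw [Finset.card_insert_of_notMem hi, hJ])
  rw [kosz_add_mul, kosz_kosz, zero_add] at h5
  have h6 : g * (z J - kosz f y J) =
      kosz f x J - (kosz f (koszWedge c z) J - g * z J) := by
    rw [h5]
    ring
  rw [h6]
  exact I.sub_mem (kosz_mem f fun i _ => hx _) (h1 J hJ)

/-- Depth sensitivity of the Koszul complex: if the ideal of `f` contains a regular sequence of
length `m`, then the homology vanishes in degrees `p > n - m`. -/
theorem koszulExact_of_regular (f : Fin n → R) {m : ℕ} (g : ℕ → R) (I : ℕ → Ideal R)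
    (h0 : I 0 = ⊥) (hI : ∀ k < m, I (k + 1) = I k ⊔ Ideal.span {g k})
    (hg : ∀ k < m, ∀ x, g k * x ∈ I k → x ∈ I k)
    (hf : ∀ k < m, g k ∈ Ideal.span (Set.range f)) {p : ℕ} (hp : n < p + m) :
    KoszulExact f ⊥ p := by
  have key : ∀ l k, k + l = m → KoszulExact f (I k) (p + k) := by
    intro l
    induction l with
    | zero =>
      intro k hk z _
      refine ⟨0, fun J hJ => absurd (Finset.card_le_univ J) ?_⟩
      rw [Fintype.card_fin]
      omega
    | succ l ih =>
      intro k hk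
      have := ih (k + 1) (by omega)
      rw [hI k (by omega)] at this
      exact KoszulExact.of_sup_span (hg k (by omega)) (hf k (by omega)) this
  simpa [h0] using key m 0 (zero_add m)

/-- If the ideal of `f` contains powers of `m` of the variables, then the Koszul complex is exact
in degrees `p > n - m`. -/
theorem koszulExact_of_pow_mem (f : Fin n → MvPolynomial (Fin n) R) {m : ℕ} (hm : m ≤ n)
    (e : Fin n → ℕ) (hf : ∀ i : Fin n, (i : ℕ) < m → X i ^ e i ∈ Ideal.span (Set.range f))
    {p : ℕ} (hp : n < p + m) : KoszulExact f ⊥ p := by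
  classical
  let s : ℕ → Set (Fin n →₀ ℕ) := fun k =>
    {γ | ∃ i : Fin n, (i : ℕ) < k ∧ γ = Finsupp.single i (e i)}
  let I : ℕ → Ideal (MvPolynomial (Fin n) R) := fun k =>
    Ideal.span ((fun γ => monomial γ (1 : R)) '' s k)
  let g : ℕ → MvPolynomial (Fin n) R := fun k => if h : k < n then X ⟨k, h⟩ ^ e ⟨k, h⟩ else 0
  have hgk : ∀ k (h : k < n), g k = monomial (Finsupp.single ⟨k, h⟩ (e ⟨k, h⟩)) 1 := fun k h => by
    simp only [g, h, dif_pos, X_pow_eq_monomial]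
  refine koszulExact_of_regular f g I ?_ ?_ ?_ ?_ hp
  · have : s 0 = ∅ := by
      ext γ
      simp [s]
    simp [I, this]
  · intro k hk
    have : s (k + 1) = s k ∪ {Finsupp.single ⟨k, by omega⟩ (e ⟨k, by omega⟩)} := by
      ext γ
      simp only [s, Set.mem_ofPred_eq, Set.mem_union, Set.mem_singleton_iff]
      constructor
      · rintro ⟨i, hi, rfl⟩
        rcases Nat.lt_succ_iff_lt_or_eq.1 hi with h | h
        · exact Or.inl ⟨i, h, rfl⟩
        · right
          have : i = ⟨k, by omega⟩ := Fin.ext h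
          rw [this]
      · rintro (⟨i, hi, rfl⟩ | rfl)
        · exact ⟨i, by omega, rfl⟩
        · exact ⟨_, Nat.lt_succ_self k, rfl⟩
    simp only [I]
    rw [this, Set.image_union, Ideal.span_union, Set.image_singleton, hgk k (by omega)]
  · intro k hk x hx
    rw [mem_ideal_span_monomial_image] at hx ⊢
    intro γ hγ
    obtain ⟨_, ⟨i, hi, rfl⟩, hle⟩ := hx (Finsupp.single ⟨k, by omega⟩ (e ⟨k, by omega⟩) + γ) <| by
      rw [mem_support_iff, hgk k (by omega), coeff_monomial_mul, one_mul]
      exact mem_support_iff.1 hγ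
    refine ⟨_, ⟨i, hi, rfl⟩, ?_⟩
    rw [Finsupp.single_le_iff] at hle ⊢
    have hne : (⟨k, by omega⟩ : Fin n) ≠ i := fun h => by
      have := congrArg Fin.val h
      simp only at this
      omega
    simpa [Finsupp.single_apply, hne] using hle
  · intro k hk
    have := hf ⟨k, by omega⟩ hk
    simpa only [g, show k < n by omega, dif_pos] using this

end KoszulAcyclic

/-! ### Homogeneous components -/

section Components

variable {R : Type u} [CommRing R] {n : ℕ} {d : Fin n → ℕ}

/-- The homogeneous component of degree `u ∈ ℤ`, which is zero if `u < 0`. -/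
def comp (R : Type u) [CommRing R] (n : ℕ) (u : ℤ) :
    MvPolynomial (Fin n) R →ₗ[R] MvPolynomial (Fin n) R :=
  if 0 ≤ u then homogeneousComponent u.toNat else 0

theorem coeff_comp (u : ℤ) (p : MvPolynomial (Fin n) R) (γ : Fin n →₀ ℕ) :
    coeff γ (comp R n u p) = if (γ.degree : ℤ) = u then coeff γ p else 0 := by
  classical
  unfold comp
  split_ifs with h1 h2 h2
  · rw [coeff_homogeneousComponent, if_pos (by omega)]
  · rw [coeff_homogeneousComponent, if_neg (by omega)]
  · omega
  · simp

theorem comp_mem (u : ℤ) (p : MvPolynomial (Fin n) R) : comp R n u p ∈ S R n u := by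
  rw [mem_S]
  intro γ hγ
  rw [coeff_comp] at hγ
  by_contra h
  simp [h] at hγ

theorem comp_of_mem {u : ℤ} {p : MvPolynomial (Fin n) R} (hp : p ∈ S R n u) :
    comp R n u p = p := by
  ext γ
  rw [coeff_comp]
  split_ifs with h
  · rfl
  · by_contra h0
    exact h (mem_S.1 hp γ (Ne.symm h0))

theorem comp_mul {u v w : ℤ} (h : u + v = w) {p : MvPolynomial (Fin n) R} (hp : p ∈ S R n u)
    (q : MvPolynomial (Fin n) R) : comp R n w (p * q) = p * comp R n v q := by
  classical
  ext γ
  rw [coeff_comp, coeff_mul, coeff_mul]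
  have hd : ∀ x ∈ Finset.HasAntidiagonal.antidiagonal γ,
      (γ.degree : ℤ) = x.1.degree + x.2.degree := fun x hx => by
    rw [← (Finset.HasAntidiagonal.mem_antidiagonal.1 hx), map_add]
    push_cast
    ring
  split_ifs with h1
  · refine Finset.sum_congr rfl fun x hx => ?_
    by_cases h0 : coeff x.1 p = 0
    · simp [h0]
    · have := mem_S.1 hp _ h0
      have := hd x hx
      rw [coeff_comp, if_pos (by omega)]
  · refine (Finset.sum_eq_zero fun x hx => ?_).symm
    by_cases h0 : coeff x.1 p = 0
    · simp [h0]
    · have := mem_S.1 hp _ h0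
      have := hd x hx
      rw [coeff_comp, if_neg (by omega), mul_zero]

/-- The graded pieces of the Koszul complex sit inside the total Koszul complex. -/
theorem kosz_kExt {t p q : ℤ} (a : Coeffs d → R) (h : p = q + 1) (g : K R d t p) (J : Sub n q) :
    kosz (poly a) (kExt g) J.1 = (koszulD a t p q h g J : MvPolynomial (Fin n) R) := by
  rw [koszulD_coe, kosz, Finset.sum_filter]
  refine Finset.sum_congr rfl fun i _ => ?_
  unfold contract
  by_cases hi : i ∈ J.1
  · simp [hi]
  · simp only [hi, not_false_eq_true, if_true, if_false, mul_smul_comm]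

/-- Exactness of the total Koszul complex implies exactness of its graded pieces. -/
theorem koszulD_exact (a : Coeffs d → R) (t : ℤ) {p q r : ℤ} (h : p = q + 1) (h' : q = r + 1)
    (hex : KoszulExact (poly a) ⊥ q.toNat) :
    Function.Exact (koszulD a t p q h) (koszulD a t q r h') := by
  intro g
  refine ⟨fun hg => ?_, fun ⟨y, hy⟩ => hy ▸ koszulD_koszulD a t p q r h h' y⟩
  by_cases hq : 0 ≤ q
  · obtain ⟨y, hy⟩ := hex (kExt g) fun J hJ => by
      have : (J.card : ℤ) = r := by omega
      rw [kosz_kExt a h' g ⟨J, this⟩, hg]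
      exact Ideal.zero_mem _
    refine ⟨fun I => ⟨comp R n _ (y I.1), comp_mem _ _⟩, ?_⟩
    funext J
    apply Subtype.ext
    have hJ := J.2
    have h1 := hy J.1 (by omega)
    rw [Ideal.mem_bot, sub_eq_zero] at h1
    have h2 : kExt g J.1 = g J := dif_pos hJ
    rw [koszulD_coe, ← comp_of_mem (g J).2, ← h2, h1, kosz, map_sum, Finset.sum_filter]
    refine Finset.sum_congr rfl fun i _ => ?_
    split_ifs with hi
    · rw [contract, if_pos hi, mul_zero, map_zero]
    · rw [contract, if_neg hi, mul_smul_comm, map_zsmul, comp_mul (mulPoly_degree hi)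
        (poly_mem a i)]
      congr 2
      exact dif_pos (card_insert_eq h J hi)
  · refine ⟨0, ?_⟩
    funext J
    have := J.2
    omega

end Components

/-! ### Determinants of matrices with the same product with a regular sequence -/

section Syzygy

variable {R : Type u} [CommRing R] {n : ℕ}

/-- If all the rows of `N` except the `k`-th kill `x`, then replacing the `k`-th row by a
combination of Koszul syzygies of `x` gives the determinant zero. -/
theorem det_updateRow_syzygy (N : Matrix (Fin n) (Fin n) R) (x : Fin n → R) (k : Fin n)
    (hN : ∀ i, i ≠ k → ∑ j, N i j * x j = 0) (c : Fin n → Fin n → R)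
    (hc : ∀ i j, c i j + c j i = 0) (hc0 : ∀ i, c i i = 0) :
    (N.updateRow k fun j => ∑ i, c j i * x i).det = 0 := by
  have hadj : ∀ (s : Fin n → R) j, (N.updateRow k s).adjugate j k = N.adjugate j k := by
    intro s j
    rw [Matrix.adjugate_apply, Matrix.adjugate_apply, Matrix.updateRow_idem]
  have hdet : ∀ s : Fin n → R, (N.updateRow k s).det = ∑ j, s j * N.adjugate j k := by
    intro s
    rw [Matrix.det_eq_sum_mul_adjugate_row _ k]
    exact Finset.sum_congr rfl fun j _ => by rw [hadj, Matrix.updateRow_self]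
  -- the `k`-th column of the adjugate is proportional to `x`, since the other rows kill `x`
  have hsw : ∀ i j, x i * N.adjugate j k = x j * N.adjugate i k := by
    intro i j
    have h1 : (N.updateRow k (Pi.single i 1)).mulVec x = Pi.single k (x i) := by
      ext l
      by_cases hl : l = k
      · subst hl
        simp [Matrix.mulVec, dotProduct, Pi.single_apply]
      · simp [Matrix.mulVec, dotProduct, hl, hN]
    have h2 : ((N.updateRow k (Pi.single i 1)).adjugate.mulVec
        ((N.updateRow k (Pi.single i 1)).mulVec x)) j = N.adjugate j k * x i := by
      rw [h1]
      simp [Matrix.mulVec, dotProduct, Pi.single_apply, hadj]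
    rw [Matrix.mulVec_mulVec, Matrix.adjugate_mul, Matrix.smul_mulVec, Matrix.one_mulVec,
      Pi.smul_apply, smul_eq_mul, hdet] at h2
    simp only [Pi.single_apply, ite_mul, one_mul, zero_mul, Finset.sum_ite_eq',
      Finset.mem_univ, if_true] at h2
    linear_combination -h2
  rw [hdet]
  simp only [Finset.sum_mul]
  refine sum_eq_zero_of_alternating (fun j i => ?_) fun i => by simp [hc0]
  linear_combination c j i * hsw i j + x j * N.adjugate i k * hc j i

/-- If the syzygies of `x` are the Koszul ones, then the determinant of a matrix `M` is determined
by `M x` up to elements of the ideal generated by the entries of `M x`. -/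
theorem det_sub_det_mem (x : Fin n → R) (hx : KoszulExact x ⊥ 1) (M M' : Matrix (Fin n) (Fin n) R)
    (hM : M.mulVec x = M'.mulVec x) :
    M.det - M'.det ∈ Ideal.span (Set.range (M.mulVec x)) := by
  classical
  have hsyz : ∀ s : Fin n → R, ∑ j, s j * x j = 0 → ∃ c : Fin n → Fin n → R,
      (∀ i j, c i j + c j i = 0) ∧ (∀ i, c i i = 0) ∧ ∀ j, s j = ∑ i, c j i * x i := by
    intro s hs
    let z : Finset (Fin n) → R := fun J => ∑ j ∈ J, s j
    obtain ⟨y, hy⟩ := hx z fun J hJ => by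
      obtain rfl : J = ∅ := by
        rw [← Finset.card_eq_zero]
        omega
      rw [Ideal.mem_bot, ← hs]
      exact Finset.sum_congr rfl fun j _ => by simp [contract, kSign, z, mul_comm]
    refine ⟨fun j i => contract i y {j}, fun i j => ?_, fun i => by simp [contract], fun j => ?_⟩
    · by_cases hij : i = j
      · simp [contract, hij]
      · have h1 := kSign_swap (J := ∅) (Finset.notMem_empty i) (Finset.notMem_empty j) hij
        have h2 : ∀ i : Fin n, kSign i ∅ = 1 := fun i => by simp [kSign]
        rw [h2, h2, one_mul, one_mul] at h1
        have hji : j ≠ i := fun h => hij h.symm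
        simp only [contract, Finset.mem_singleton, hij, hji, if_false]
        rw [Finset.pair_comm j i, ← add_smul]
        change (kSign j {i} + kSign i {j} = 0) at h1
        rw [h1, zero_smul]
    · have := hy {j} (Finset.card_singleton j)
      rw [Ideal.mem_bot, sub_eq_zero] at this
      simp only [z, Finset.sum_singleton] at this
      rw [this, kosz]
      exact Finset.sum_congr rfl fun i _ => mul_comm _ _
  set I := Ideal.span (Set.range (M.mulVec x)) with hI
  let π := Ideal.Quotient.mk I
  have hker : ∀ i, ∑ j, π (M i j) * π (x j) = 0 := fun i => by
    have : π (M.mulVec x i) = 0 :=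
      Ideal.Quotient.eq_zero_iff_mem.2 (Ideal.subset_span ⟨i, rfl⟩)
    simpa [Matrix.mulVec, dotProduct] using this
  have hker' : ∀ i, ∑ j, π (M' i j) * π (x j) = 0 := fun i => by
    have : π (M'.mulVec x i) = 0 := by
      rw [← hM]
      exact Ideal.Quotient.eq_zero_iff_mem.2 (Ideal.subset_span ⟨i, rfl⟩)
    simpa [Matrix.mulVec, dotProduct] using this
  -- modulo `I`, the rows of `M` are replaced one by one by those of `M'`
  let H : Finset (Fin n) → Matrix (Fin n) (Fin n) (R ⧸ I) := fun s =>
    Matrix.of fun i j => if i ∈ s then π (M' i j) else π (M i j)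
  have hH : ∀ s i, ∑ j, H s i j * π (x j) = 0 := by
    intro s i
    simp only [H, Matrix.of_apply]
    split_ifs
    · exact hker' i
    · exact hker i
  have key : ∀ s, (H s).det = (H ∅).det := by
    intro s
    induction s using Finset.induction_on with
    | empty => rfl
    | insert k s hk ih =>
      rw [← ih]
      obtain ⟨c, hc, hc0, hs⟩ := hsyz (fun j => M' k j - M k j) <| by
        have := congrFun hM k
        simp only [Matrix.mulVec, dotProduct] at this
        simp only [sub_mul, Finset.sum_sub_distrib, this, sub_self]
      have e1 : H (insert k s) = (H s).updateRow k
          ((H s) k + fun j => ∑ i, π (c j i) * π (x i)) := by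
        ext i j
        by_cases hi : i = k
        · subst hi
          have := congrArg π (hs j)
          rw [map_sub, map_sum] at this
          simp only [map_mul] at this
          simp [H, hk, ← this]
        · simp [H, hi]
      rw [e1, Matrix.det_updateRow_add, Matrix.updateRow_eq_self,
        det_updateRow_syzygy (H s) (fun i => π (x i)) k (fun i _ => hH s i) (fun j i => π (c j i)),
        add_zero]
      · intro i j
        rw [← map_add, hc, map_zero]
      · intro i
        simp only [hc0, map_zero]
  have h1 : π M.det = (H ∅).det := by
    rw [RingHom.map_det]
    congr 1
  have h2 : π M'.det = (H Finset.univ).det := by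
    rw [RingHom.map_det]
    congr 1
    ext i j
    simp [H]
  rw [← Ideal.Quotient.eq_zero_iff_mem]
  change π _ = 0
  rw [map_sub, h1, h2, key Finset.univ, sub_self]

theorem koszulExact_X : KoszulExact (X : Fin n → MvPolynomial (Fin n) R) ⊥ 1 :=
  koszulExact_of_pow_mem X le_rfl (fun _ => 1)
    (fun i _ => (pow_one (X i : MvPolynomial (Fin n) R)).symm ▸
      Ideal.subset_span (Set.mem_range_self i)) (by omega)

/-- Cramer's rule, as a membership in an ideal. -/
theorem det_mul_mem (M : Matrix (Fin n) (Fin n) R) (x : Fin n → R) (j : Fin n) :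
    M.det * x j ∈ Ideal.span (Set.range (M.mulVec x)) := by
  have h : (M.adjugate.mulVec (M.mulVec x)) j = M.det * x j := by
    rw [Matrix.mulVec_mulVec, Matrix.adjugate_mul, Matrix.smul_mulVec, Matrix.one_mulVec,
      Pi.smul_apply, smul_eq_mul]
  rw [← h]
  change ∑ i, M.adjugate j i * M.mulVec x i ∈ _
  exact Ideal.sum_mem _ fun i _ => Ideal.mul_mem_left _ _
    (Ideal.subset_span (Set.mem_range_self i))

/-- If `f = E X` and the ideal of `f` contains powers of all the variables, then `det E` does not
lie in this ideal: otherwise `∏ X_l ^ e_l` would lie in the ideal of the `X_l ^ (e_l + 1)`. -/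
theorem det_notMem [Nontrivial R] (f : Fin n → MvPolynomial (Fin n) R)
    (E : Matrix (Fin n) (Fin n) (MvPolynomial (Fin n) R)) (hE : E.mulVec X = f) (e : Fin n → ℕ)
    (hf : ∀ i, X i ^ (e i + 1) ∈ Ideal.span (Set.range f)) :
    E.det ∉ Ideal.span (Set.range f) := by
  classical
  intro hdet
  choose C hC using fun i => (Ideal.mem_span_range_iff_exists_fun).1 (hf i)
  let g : Fin n → MvPolynomial (Fin n) R := fun i => X i ^ (e i + 1)
  have hCf : (Matrix.of C).mulVec f = g := funext hC
  have hCE : (Matrix.of C * E).mulVec X = g := by rw [← Matrix.mulVec_mulVec, hE, hCf]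
  have hdiag : (Matrix.diagonal fun i => (X i ^ e i : MvPolynomial (Fin n) R)).mulVec X = g := by
    ext1 i
    rw [Matrix.mulVec_diagonal]
    exact (pow_succ _ _).symm
  -- both `C E` and the diagonal matrix of the `X_l ^ e_l` map `X` to the vector of the
  -- `X_l ^ (e_l + 1)`
  have h1 := det_sub_det_mem X koszulExact_X _ _ (hCE.trans hdiag.symm)
  rw [hCE, Matrix.det_mul, Matrix.det_diagonal] at h1
  have h2 : (Matrix.of C).det * E.det ∈ Ideal.span (Set.range g) := by
    obtain ⟨c, hc⟩ := (Ideal.mem_span_range_iff_exists_fun).1 hdet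
    rw [← hc, Finset.mul_sum]
    refine Ideal.sum_mem _ fun i _ => ?_
    rw [mul_left_comm, ← hCf]
    exact Ideal.mul_mem_left _ _ (det_mul_mem _ _ _)
  have h3 : ∏ i, X i ^ e i ∈ Ideal.span (Set.range g) := by
    have := Ideal.sub_mem _ h2 h1
    rwa [sub_sub_cancel] at this
  have h4 : Set.range g = (fun γ => monomial γ (1 : R)) ''
      Set.range fun i => Finsupp.single i (e i + 1) := by
    rw [← Set.range_comp]
    congr 1
    ext1 i
    exact X_pow_eq_monomial
  have h5 : ∏ i, X i ^ e i = monomial (Finsupp.equivFunOnFinite.symm e) (1 : R) := by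
    rw [monomial_eq, map_one, one_mul, Finsupp.prod_fintype _ _ fun i => pow_zero _]
    rfl
  rw [h4, h5, mem_ideal_span_monomial_image] at h3
  obtain ⟨_, ⟨i, rfl⟩, hle⟩ := h3 (Finsupp.equivFunOnFinite.symm e) <| by
    rw [mem_support_iff, coeff_monomial, if_pos rfl]
    exact one_ne_zero
  rw [Finsupp.single_le_iff] at hle
  have : e i + 1 ≤ e i := hle
  omega

end Syzygy

/-! ### Properties of the Bezoutian -/

section BezoutianProperties

variable {R : Type u} [CommRing R] {n : ℕ}

/-- The polynomial `u(X)` in `R[X][Y]` is `C u`, and `u(Y)` is `inY u`. -/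
def inY : MvPolynomial (Fin n) R →+* MvPolynomial (Fin n) (MvPolynomial (Fin n) R) := map C

/-- The incremental quotients telescope along the points `(Y_1, …, Y_j, X_{j+1}, …, X_n)`. -/
theorem sum_incr_mul (f : MvPolynomial (Fin n) R) :
    ∑ j, incr f j * (xVar R j - yVar R j) = C f - inY f := by
  simp only [incr_mul]
  have h := Fin.sum_univ_eq_sum_range (n := n)
    (fun j => aeval (mixed R j) f - aeval (mixed R (j + 1)) f)
  rw [h, Finset.sum_range_sub']
  congr 1
  · have : (aeval (R := R) (mixed R (n := n) 0)).toRingHom = C := by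
      refine ringHom_ext (fun r => ?_) fun l => ?_
      · simp [algebraMap_eq, IsScalarTower.algebraMap_apply R (MvPolynomial (Fin n) R)
          (MvPolynomial (Fin n) (MvPolynomial (Fin n) R))]
      · simp [mixed, xVar]
    exact congrArg (fun φ => φ f) this
  · have : (aeval (R := R) (mixed R (n := n) n)).toRingHom = inY := by
      refine ringHom_ext (fun r => ?_) fun l => ?_
      · simp [algebraMap_eq, inY, IsScalarTower.algebraMap_apply R (MvPolynomial (Fin n) R)
          (MvPolynomial (Fin n) (MvPolynomial (Fin n) R))]
      · simp [mixed, yVar, inY]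
    exact congrArg (fun φ => φ f) this

/-- Since `(Δ_{ij})` maps the vector `X - Y` to `f(X) - f(Y)`, Cramer's rule shows that
`Δ ⋅ (X_j - Y_j)` lies in the ideal of the `f_i(X) - f_i(Y)`, and hence so does
`Δ ⋅ (u(X) - u(Y))` for any polynomial `u`. -/
theorem bezoutian_mul_sub_mem (f : Fin n → MvPolynomial (Fin n) R) (u : MvPolynomial (Fin n) R) :
    bezoutian f * (C u - inY u) ∈ Ideal.span (Set.range fun i => C (f i) - inY (f i)) := by
  have h : (Matrix.of fun i j => incr (f i) j).mulVec (fun j => xVar R j - yVar R j) =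
      fun i => C (f i) - inY (f i) := by
    ext1 i
    exact sum_incr_mul (f i)
  rw [← sum_incr_mul u, Finset.mul_sum]
  refine Ideal.sum_mem _ fun j _ => ?_
  rw [mul_left_comm, ← h]
  exact Ideal.mul_mem_left _ _ (det_mul_mem _ _ _)

/-- The `R[X]`-linear extension `∑_γ P_γ(X) Y^γ ↦ ∑_γ T(X^γ) P_γ(X)` of a functional `T` on
polynomials to polynomials in `X` and `Y`. -/
def applyY (T : MvPolynomial (Fin n) R →ₗ[R] R) :
    MvPolynomial (Fin n) (MvPolynomial (Fin n) R) →ₗ[MvPolynomial (Fin n) R]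
      MvPolynomial (Fin n) R :=
  (basisMonomials (Fin n) (MvPolynomial (Fin n) R)).constr (MvPolynomial (Fin n) R)
    fun γ => C (T (monomial γ 1))

theorem applyY_monomial (T : MvPolynomial (Fin n) R →ₗ[R] R) (γ : Fin n →₀ ℕ)
    (h : MvPolynomial (Fin n) R) :
    applyY T (monomial γ h) = h * C (T (monomial γ 1)) := by
  have : monomial γ h = h • basisMonomials (Fin n) (MvPolynomial (Fin n) R) γ := by
    rw [coe_basisMonomials, smul_monomial, smul_eq_mul, mul_one]
  rw [this, map_smul, applyY, Module.Basis.constr_basis, smul_eq_mul]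

theorem applyY_C_mul (T : MvPolynomial (Fin n) R →ₗ[R] R) (h : MvPolynomial (Fin n) R)
    (P : MvPolynomial (Fin n) (MvPolynomial (Fin n) R)) :
    applyY T (C h * P) = h * applyY T P := by
  rw [← smul_eq_C_mul, map_smul, smul_eq_mul]

theorem applyY_eq_sum (T : MvPolynomial (Fin n) R →ₗ[R] R) (s : Finset (Fin n →₀ ℕ))
    (P : MvPolynomial (Fin n) (MvPolynomial (Fin n) R))
    (hs : ∀ γ ∉ s, T (monomial γ 1) • coeff γ P = 0) :
    applyY T P = ∑ γ ∈ s, T (monomial γ 1) • coeff γ P := by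
  classical
  have h : applyY T P = ∑ γ ∈ P.support, T (monomial γ 1) • coeff γ P := by
    conv_lhs => rw [P.as_sum]
    rw [map_sum]
    refine Finset.sum_congr rfl fun γ _ => ?_
    rw [applyY_monomial, smul_eq_C_mul, mul_comm]
  rw [h, Finset.sum_subset (Finset.subset_union_left : P.support ⊆ P.support ∪ s),
    Finset.sum_subset (Finset.subset_union_right : s ⊆ P.support ∪ s)]
  · exact fun γ _ hγ => hs γ hγ
  · intro γ _ hγ
    rw [notMem_support_iff.1 hγ, smul_zero]

/-- Multiplying by `u(Y)` amounts to precomposing the functional with the multiplication by `u`. -/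
theorem applyY_mul_inY (T : MvPolynomial (Fin n) R →ₗ[R] R) (u : MvPolynomial (Fin n) R)
    (P : MvPolynomial (Fin n) (MvPolynomial (Fin n) R)) :
    applyY T (P * inY u) = applyY (T ∘ₗ LinearMap.mulLeft R u) P := by
  induction P using MvPolynomial.induction_on' with
  | monomial γ h =>
    rw [applyY_monomial, LinearMap.comp_apply, LinearMap.mulLeft_apply]
    induction u using MvPolynomial.induction_on' with
    | monomial δ c =>
      have h1 : inY (monomial δ c) = monomial δ (C c : MvPolynomial (Fin n) R) :=
        map_monomial _ _ _
      have h2 : monomial (γ + δ) c = c • monomial (γ + δ) (1 : R) := by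
        rw [smul_monomial, smul_eq_mul, mul_one]
      rw [h1, monomial_mul, applyY_monomial, monomial_mul, mul_one, add_comm δ γ, h2, map_smul,
        smul_eq_mul, C_mul, mul_assoc]
    | add u v hu hv =>
      rw [map_add, mul_add, map_add, hu, hv, add_mul, map_add, C_add, mul_add]
  | add P Q hP hQ => rw [add_mul, map_add, hP, hQ, map_add]

/-- Multiplication by `u` on functionals which kill the ideal of `f` corresponds to multiplication
by `u` modulo this ideal. -/
theorem applyY_bezoutian_sub_mem (f : Fin n → MvPolynomial (Fin n) R)
    (T : MvPolynomial (Fin n) R →ₗ[R] R) (hT : ∀ p ∈ Ideal.span (Set.range f), T p = 0)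
    (u : MvPolynomial (Fin n) R) :
    u * applyY T (bezoutian f) - applyY (T ∘ₗ LinearMap.mulLeft R u) (bezoutian f) ∈
      Ideal.span (Set.range f) := by
  obtain ⟨c, hc⟩ := (Ideal.mem_span_range_iff_exists_fun).1 (bezoutian_mul_sub_mem f u)
  have h1 : u * applyY T (bezoutian f) - applyY (T ∘ₗ LinearMap.mulLeft R u) (bezoutian f) =
      applyY T (bezoutian f * (C u - inY u)) := by
    rw [mul_sub, map_sub, applyY_mul_inY, mul_comm (bezoutian f) (C u), applyY_C_mul]
  rw [h1, ← hc, map_sum]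
  refine Ideal.sum_mem _ fun i _ => ?_
  have h2 : T ∘ₗ LinearMap.mulLeft R (f i) = 0 := by
    refine LinearMap.ext fun p => hT _ ?_
    exact Ideal.mul_mem_right _ _ (Ideal.subset_span ⟨i, rfl⟩)
  have h3 : applyY (0 : MvPolynomial (Fin n) R →ₗ[R] R) (c i) = 0 := by
    rw [applyY_eq_sum _ ∅ _ (by simp), Finset.sum_empty]
  rw [mul_sub, map_sub, applyY_mul_inY, h2, h3, sub_zero, mul_comm (c i), applyY_C_mul]
  exact Ideal.mul_mem_right _ _ (Ideal.subset_span ⟨i, rfl⟩)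

variable {d : Fin n → ℕ}

/-- The homogeneous components of a combination of the `f_i` are combinations of the `f_i` with
homogeneous coefficients. -/
theorem comp_mem_span (a : Coeffs d → R) (u : ℤ) {p : MvPolynomial (Fin n) R}
    (hp : p ∈ Ideal.span (Set.range (poly a))) :
    ∃ c : Fin n → MvPolynomial (Fin n) R, (∀ i, c i ∈ S R n (u - d i)) ∧
      comp R n u p = ∑ i, poly a i * c i := by
  obtain ⟨c, rfl⟩ := (Ideal.mem_span_range_iff_exists_fun).1 hp
  refine ⟨fun i => comp R n (u - d i) (c i), fun i => comp_mem _ _, ?_⟩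
  rw [map_sum]
  refine Finset.sum_congr rfl fun i _ => ?_
  rw [mul_comm, comp_mul (v := u - d i) (by ring) (poly_mem a i)]

theorem constantCoeff_of_mem_S {u : ℤ} (hu : u ≠ 0) {p : MvPolynomial (Fin n) R}
    (hp : p ∈ S R n u) : constantCoeff p = 0 := by
  by_contra h
  have := mem_S.1 hp 0 h
  simp at this
  omega

theorem eq_C_of_mem_S {p : MvPolynomial (Fin n) R} (hp : p ∈ S R n 0) :
    p = C (constantCoeff p) := by
  classical
  ext γ
  rw [coeff_C]
  split_ifs with h
  · rw [← h]
    rfl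
  · by_contra h0
    have := mem_S.1 hp γ h0
    rw [Nat.cast_eq_zero, Finsupp.degree_eq_zero_iff] at this
    exact h this.symm

/-- If `k[X] / (f_1, …, f_n)` has finite dimension, some functional of degree `t_n` which kills the
ideal of `f` is sent to `1` by the Bezoutian. -/
theorem exists_functional {k : Type u} [Field k] (hd : ∀ i, 1 ≤ d i) (a : Coeffs d → k)
    (e : Fin n → ℕ) (he : ∀ i, X i ^ (e i + 1) ∈ Ideal.span (Set.range (poly a))) :
    ∃ T : MvPolynomial (Fin n) k →ₗ[k] k, (∀ p ∈ Ideal.span (Set.range (poly a)), T p = 0) ∧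
      (∀ γ : Fin n →₀ ℕ, (γ.degree : ℤ) ≠ critDeg d → T (monomial γ 1) = 0) ∧
      applyY T (bezoutian (poly a)) = 1 := by
  classical
  -- setting `X = 0` in `∑_j Δ_{ij} (X_j - Y_j) = f_i(X) - f_i(Y)` gives
  -- `∑_j Δ_{ij}(0, Y) Y_j = f_i(Y)`, and `Δ(0, Y)` is the part of `Δ` of degree `t_n` in `Y`
  let E : Matrix (Fin n) (Fin n) (MvPolynomial (Fin n) k) := Matrix.of fun i j =>
    map (constantCoeff : MvPolynomial (Fin n) k →+* k) (incr (poly a i) j)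
  have hE : E.mulVec X = poly a := by
    ext1 i
    have h1 := congrArg (map (constantCoeff : MvPolynomial (Fin n) k →+* k))
      (sum_incr_mul (poly a i))
    rw [map_sum, map_sub, map_C, constantCoeff_of_mem_S (by have := hd i; omega) (poly_mem a i),
      inY, map_map] at h1
    have h2 : (constantCoeff : MvPolynomial (Fin n) k →+* k).comp C = RingHom.id k := by
      ext x
      simp
    rw [h2, map_id, C_0, zero_sub] at h1
    rw [← neg_inj, ← h1, Matrix.mulVec, dotProduct, ← Finset.sum_neg_distrib]
    refine Finset.sum_congr rfl fun j _ => ?_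
    rw [map_mul, map_sub, xVar, yVar, map_C, map_X, constantCoeff_X, C_0, zero_sub, mul_neg]
    rfl
  have hdet := det_notMem (poly a) E hE e he
  have hEdet : E.det = map (constantCoeff : MvPolynomial (Fin n) k →+* k) (bezoutian (poly a)) := by
    rw [bezoutian, RingHom.map_det]
    rfl
  have hcoeff : ∀ γ, coeff γ E.det = constantCoeff (bezoutCoeff (poly a) γ) := fun γ => by
    rw [hEdet, coeff_map]
    rfl
  have hdetS : E.det ∈ S k n (critDeg d) := by
    rw [mem_S]
    intro γ hγ
    by_contra hne
    rw [hcoeff] at hγ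
    exact hγ (constantCoeff_of_mem_S (by omega) (bezoutCoeff_mem a γ))
  obtain ⟨T, hT1, hT2⟩ := Submodule.exists_le_ker_of_notMem
    (p := (Ideal.span (Set.range (poly a))).restrictScalars k) (v := E.det) hdet
  refine ⟨(T E.det)⁻¹ • T ∘ₗ comp k n (critDeg d), fun p hp => ?_, fun γ hγ => ?_, ?_⟩
  · have : comp k n (critDeg d) p ∈ Ideal.span (Set.range (poly a)) := by
      obtain ⟨c, -, hc⟩ := comp_mem_span a (critDeg d) hp
      rw [hc]
      exact Ideal.sum_mem _ fun i _ => Ideal.mul_mem_right _ _ (Ideal.subset_span ⟨i, rfl⟩)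
    have h2 : T (comp k n (critDeg d) p) = 0 := hT2 this
    simp [h2]
  · have : comp k n (critDeg d) (monomial γ 1) = 0 := by
      ext δ
      rw [coeff_comp, coeff_monomial]
      split_ifs with h1 h2
      · exact absurd (h2 ▸ h1) hγ
      · simp
      · simp
    simp [this]
  · have hmon : ∀ γ : Fin n →₀ ℕ, (γ.degree : ℤ) = critDeg d →
        comp k n (critDeg d) (monomial γ 1) = monomial γ 1 := fun γ hγ =>
      comp_of_mem ((monomial_mem_restrictSupport k).2 (Or.inl hγ))
    have hs : ∀ γ ∉ E.det.support, T (comp k n (critDeg d) (monomial γ 1)) •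
        coeff γ (bezoutian (poly a)) = 0 := by
      intro γ hγ
      by_cases h : (γ.degree : ℤ) = critDeg d
      · have h1 := bezoutCoeff_mem a γ
        rw [h, sub_self] at h1
        have h2 := eq_C_of_mem_S h1
        rw [← hcoeff, notMem_support_iff.1 hγ, C_0] at h2
        have h3 : coeff γ (bezoutian (poly a)) = 0 := h2
        rw [h3, smul_zero]
      · have : comp k n (critDeg d) (monomial γ 1) = 0 := by
          ext δ
          rw [coeff_comp, coeff_monomial]
          split_ifs with h1 h2
          · exact absurd (h2 ▸ h1) h
          · simp
          · simp
        simp [this]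
    rw [applyY_eq_sum _ E.det.support _ fun γ hγ => by
      rw [LinearMap.smul_apply, LinearMap.comp_apply, smul_assoc, hs γ hγ, smul_zero]]
    have h4 : ∀ γ ∈ E.det.support, ((T E.det)⁻¹ • T ∘ₗ comp k n (critDeg d)) (monomial γ 1) •
        coeff γ (bezoutian (poly a)) =
        C ((T E.det)⁻¹ * (coeff γ E.det * T (monomial γ 1))) := by
      intro γ hγ
      have hγ' := mem_S.1 hdetS γ (mem_support_iff.1 hγ)
      have h1 := bezoutCoeff_mem a γ
      rw [hγ', sub_self] at h1
      have h2 := eq_C_of_mem_S h1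
      rw [← hcoeff] at h2
      have h3 : coeff γ (bezoutian (poly a)) = C (coeff γ E.det) := h2
      rw [LinearMap.smul_apply, LinearMap.comp_apply, hmon γ hγ', h3, smul_eq_C_mul, ← C_mul,
        smul_eq_mul]
      congr 1
      ring
    rw [Finset.sum_congr rfl h4, ← map_sum, ← Finset.mul_sum]
    have h5 : ∑ γ ∈ E.det.support, coeff γ E.det * T (monomial γ 1) = T E.det := by
      conv_rhs => rw [E.det.as_sum, map_sum]
      refine Finset.sum_congr rfl fun γ _ => ?_
      rw [← smul_eq_mul, ← map_smul, smul_monomial, smul_eq_mul, mul_one]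
    rw [h5, inv_mul_cancel₀ hT1, C_1]

/-- The Bezoutian maps the functionals on `k[X] / (f_1, …, f_n)` onto this ring. -/
theorem exists_functional_of_mem {k : Type u} [Field k] (hd : ∀ i, 1 ≤ d i) (a : Coeffs d → k)
    (e : Fin n → ℕ) (he : ∀ i, X i ^ (e i + 1) ∈ Ideal.span (Set.range (poly a))) {t : ℤ}
    {u : MvPolynomial (Fin n) k} (hu : u ∈ S k n t) :
    ∃ T : MvPolynomial (Fin n) k →ₗ[k] k, (∀ p ∈ Ideal.span (Set.range (poly a)), T p = 0) ∧
      u - ∑ γ : Mon n (critDeg d - t), T (monomial γ.1 1) • bezoutCoeff (poly a) γ.1 ∈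
        Ideal.span (Set.range (poly a)) := by
  classical
  obtain ⟨T, hT0, hT1, hT2⟩ := exists_functional hd a e he
  refine ⟨T ∘ₗ LinearMap.mulLeft k u, fun p hp => hT0 _ (Ideal.mul_mem_left _ _ hp), ?_⟩
  have h := applyY_bezoutian_sub_mem (poly a) T hT0 u
  rw [hT2, mul_one] at h
  have hzero : ∀ γ : Fin n →₀ ℕ, (γ.degree : ℤ) ≠ critDeg d - t → T (u * monomial γ 1) = 0 := by
    intro γ hγ
    rw [u.as_sum, Finset.sum_mul, map_sum]
    refine Finset.sum_eq_zero fun δ hδ => ?_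
    have h1 := mem_S.1 hu δ (mem_support_iff.1 hδ)
    have h2 : monomial (δ + γ) (coeff δ u) = coeff δ u • monomial (δ + γ) (1 : k) := by
      rw [smul_monomial, smul_eq_mul, mul_one]
    rw [monomial_mul, mul_one, h2, map_smul, hT1, smul_zero]
    rw [map_add]
    push_cast
    omega
  rw [applyY_eq_sum _ (Finset.univ.map (Function.Embedding.subtype (· ∈ monSet n (critDeg d - t)))),
    Finset.sum_map] at h
  · exact h
  · intro γ hγ
    rw [LinearMap.comp_apply, LinearMap.mulLeft_apply, hzero, zero_smul]
    intro hγ'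
    exact hγ (Finset.mem_map.2 ⟨⟨γ, hγ'⟩, Finset.mem_univ _, rfl⟩)

end BezoutianProperties

/-! ### The coupled complex in coordinates -/

section Coordinates

variable {R : Type u} [CommRing R] {n : ℕ} {d : Fin n → ℕ}

theorem bezoutMap_coe (a : Coeffs d → R) (t p q : ℤ) (hp : p = 0) (hq : q = 0)
    (T : Module.Dual R (K R d (critDeg d - t) p)) (I : Sub n q) :
    (bezoutMap a t p q hp hq T I : MvPolynomial (Fin n) R) =
      ∑ γ : Mon n (critDeg d - t - dSum d ∅),
        T (kBasis R d (critDeg d - t) p ⟨⟨∅, by simp [hp]⟩, γ⟩) • bezoutCoeff (poly a) γ.1 := by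
  rw [bezoutMap, LinearMap.pi_apply, LinearMap.sum_apply, AddSubmonoidClass.coe_finsetSum]
  rfl

theorem K_eq_zero {t p : ℤ} (hp : p < 0) (g : K R d t p) : g = 0 := by
  funext I
  have := I.2
  omega

theorem dual_K_eq_zero {t p : ℤ} (hp : p < 0) (T : Module.Dual R (K R d t p)) : T = 0 :=
  LinearMap.ext fun g => by rw [K_eq_zero hp g, map_zero, map_zero]

theorem coupledD_fst (a : Coeffs d → R) (t j : ℤ) (hj : j ≠ -1) (x : Coupled R d t j) :
    (coupledD a t j x).1 = koszulD a t (-j) (-(j + 1)) (by ring) x.1 := by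
  simp [coupledD, hj]

/-- The differential `∂_0` is the only one to which the Bezoutian contributes. -/
theorem coupledD_fst' (a : Coeffs d → R) (t j : ℤ) (hj : j = -1) (x : Coupled R d t j) :
    (coupledD a t j x).1 = koszulD a t (-j) (-(j + 1)) (by ring) x.1 +
      bezoutMap a t (j + 1) (-(j + 1)) (by omega) (by omega) x.2 := by
  simp [coupledD, hj]

theorem coupledD_snd (a : Coeffs d → R) (t j : ℤ) (x : Coupled R d t j) :
    (coupledD a t j x).2 = (koszulD a (critDeg d - t) (j + 1 + 1) (j + 1) rfl).dualMap x.2 := rfl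

end Coordinates

/-! ### Exactness of the coupled complex -/

section Exactness

variable {k : Type u} [Field k] {n : ℕ} {d : Fin n → ℕ}

theorem exact_dualMap {V W Z : Type*} [AddCommGroup V] [Module k V] [AddCommGroup W] [Module k W]
    [AddCommGroup Z] [Module k Z] {f : V →ₗ[k] W} {g : W →ₗ[k] Z} (h : Function.Exact f g) :
    Function.Exact g.dualMap f.dualMap := by
  rw [LinearMap.exact_iff, LinearMap.ker_dualMap_eq_dualAnnihilator_range,
    LinearMap.range_dualMap_eq_dualAnnihilator_ker, h.linearMap_ker_eq]

instance (u : ℤ) : Module.Finite k (S k n u) := Module.Finite.of_basis (sBasis k n u)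

theorem dSum_empty : dSum d ∅ = 0 := by simp [dSum]

theorem mem_S_congr {u v : ℤ} (h : u = v) {p : MvPolynomial (Fin n) k} (hp : p ∈ S k n u) :
    p ∈ S k n v := h ▸ hp

/-- The index `∅` of the only summand of `K(t)^0`. -/
def emptySub {n : ℕ} {p : ℤ} (hp : p = 0) : Sub n p := ⟨∅, by simp [hp]⟩

theorem eq_emptySub {p : ℤ} (hp : p = 0) (I : Sub n p) : I = emptySub hp := by
  apply Subtype.ext
  have := I.2
  change I.1 = ∅
  rw [← Finset.card_eq_zero]
  omega

/-- All the components of a Koszul boundary lie in the ideal of `f`. -/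
theorem koszulD_mem_span (a : Coeffs d → k) (t : ℤ) {p q : ℤ} (h : p = q + 1) (g : K k d t p)
    (J : Sub n q) : (koszulD a t p q h g J : MvPolynomial (Fin n) k) ∈
      Ideal.span (Set.range (poly a)) := by
  rw [koszulD_coe]
  exact Ideal.sum_mem _ fun i _ => zsmul_mem
    (Ideal.mul_mem_right _ _ (Ideal.subset_span (Set.mem_range_self i))) _

/-- The boundaries in `K(t)^0 = S_t` are the elements of degree `t` of the ideal of `f`. -/
theorem exists_koszulD_eq (a : Coeffs d → k) (t : ℤ) {p q : ℤ} (h : p = q + 1) (hq : q = 0)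
    {y : K k d t q} (hy : (y (emptySub hq) : MvPolynomial (Fin n) k) ∈
      Ideal.span (Set.range (poly a))) : ∃ g, koszulD a t p q h g = y := by
  classical
  obtain ⟨c, hc, e⟩ := comp_mem_span a t hy
  have hyt : (y (emptySub hq) : MvPolynomial (Fin n) k) ∈ S k n t := by
    refine mem_S_congr ?_ (y (emptySub hq)).2
    change t - dSum d ∅ = t
    rw [dSum_empty, sub_zero]
  rw [comp_of_mem hyt] at e
  let c' : Finset (Fin n) → MvPolynomial (Fin n) k := fun I => ∑ i ∈ I, c i
  have hc' : ∀ I : Sub n p, comp k n (t - dSum d I.1) (c' I.1) = c' I.1 := by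
    intro I
    have hI : I.1.card = 1 := by
      have := I.2
      omega
    obtain ⟨i, hi⟩ := Finset.card_eq_one.1 hI
    have h1 : c' I.1 = c i := by
      simp only [c', hi, Finset.sum_singleton]
    rw [h1, hi]
    refine comp_of_mem ?_
    simpa [dSum] using hc i
  refine ⟨fun I => ⟨comp k n _ (c' I.1), comp_mem _ _⟩, ?_⟩
  funext J
  obtain rfl := eq_emptySub hq J
  apply Subtype.ext
  rw [koszulD_coe, e, Finset.sum_filter]
  refine Finset.sum_congr rfl fun i _ => ?_
  have hi : i ∉ (emptySub (n := n) hq).1 := Finset.notMem_empty i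
  have h1 : kExt (d := d) (t := t) (p := p) (fun I => ⟨comp k n _ (c' I.1), comp_mem _ _⟩)
      (insert i (emptySub (n := n) hq).1) = c i := by
    rw [kExt, dif_pos (card_insert_eq h _ hi)]
    refine (hc' ⟨_, card_insert_eq h _ hi⟩).trans ?_
    simp [c', emptySub]
  rw [if_pos hi, h1]
  simp [kSign, emptySub]

theorem kBasis_emptySub (t : ℤ) {p : ℤ} (hp : p = 0) (γ : Mon n (t - dSum d ∅)) :
    (kBasis k d t p ⟨⟨∅, by simp [hp]⟩, γ⟩ (emptySub hp) : MvPolynomial (Fin n) k) =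
      monomial γ.1 1 := by
  classical
  rw [kBasis, Pi.basis_apply, ← sBasis_coe (R := k)]
  congr 1

/-- Modulo the ideal of `f`, the map `ψ_{1,t}` is onto on the functionals which kill this
ideal. -/
theorem exists_bezoutMap_add (hd : ∀ i, 1 ≤ d i) (a : Coeffs d → k)
    (e : Fin n → ℕ) (he : ∀ i, X i ^ (e i + 1) ∈ Ideal.span (Set.range (poly a)))
    (t : ℤ) {p q p' q' : ℤ} (hp : p = 0) (hq : q = 0) (hp' : p' = p + 1) (hq' : q' = q + 1)
    (y : K k d t q) : ∃ (T : Module.Dual k (K k d (critDeg d - t) p)) (g : K k d t q'),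
      (koszulD a (critDeg d - t) p' p hp').dualMap T = 0 ∧
        koszulD a t q' q hq' g + bezoutMap a t p q hp hq T = y := by
  have hy : (y (emptySub hq) : MvPolynomial (Fin n) k) ∈ S k n t := by
    refine mem_S_congr ?_ (y (emptySub hq)).2
    change t - dSum d ∅ = t
    rw [dSum_empty, sub_zero]
  obtain ⟨T, hT0, hT⟩ := exists_functional_of_mem hd a e he hy
  let T' : Module.Dual k (K k d (critDeg d - t) p) :=
    T ∘ₗ (S k n _).subtype ∘ₗ LinearMap.proj (emptySub hp)
  have hT' : ∀ g, T' g = T (g (emptySub hp) : MvPolynomial (Fin n) k) := fun g => rfl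
  have h1 : critDeg d - t - dSum d ∅ = critDeg d - t := by rw [dSum_empty, sub_zero]
  obtain ⟨g, hg⟩ := exists_koszulD_eq a t hq' hq (y := y - bezoutMap a t p q hp hq T') <| by
    have h2 : (bezoutMap a t p q hp hq T' (emptySub hq) : MvPolynomial (Fin n) k) =
        ∑ γ : Mon n (critDeg d - t), T (monomial γ.1 1) • bezoutCoeff (poly a) γ.1 := by
      rw [bezoutMap_coe]
      simp only [hT', kBasis_emptySub]
      rw [h1]
    rw [Pi.sub_apply, AddSubgroupClass.coe_sub, h2]
    exact hT
  refine ⟨T', g, LinearMap.ext fun z => ?_, by rw [hg, sub_add_cancel]⟩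
  rw [LinearMap.dualMap_apply, hT', LinearMap.zero_apply]
  exact hT0 _ (koszulD_mem_span a _ hp' z _)

/-- The Hilbert function of `k[X] / (f_1, …, f_n)`. -/
def hilb (a : Coeffs d → k) (t : ℤ) : ℕ :=
  Module.finrank k (K k d t 0 ⧸ LinearMap.range (koszulD a t 1 0 rfl))

/-- The Bezoutian induces a map from the dual of the part of degree `t_n - t` of
`k[X] / (f_1, …, f_n)` to the part of degree `t`. -/
def bezoutQuot (a : Coeffs d → k) (t : ℤ) :
    LinearMap.ker (koszulD a (critDeg d - t) 1 0 rfl).dualMap →ₗ[k]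
      (K k d t 0 ⧸ LinearMap.range (koszulD a t 1 0 rfl)) :=
  (LinearMap.range (koszulD a t 1 0 rfl)).mkQ ∘ₗ bezoutMap a t 0 0 rfl rfl ∘ₗ
    Submodule.subtype _

/-- The kernel of `δ_0^*` is the dual of the cokernel of `δ_0`. -/
theorem finrank_ker_dualMap (a : Coeffs d → k) (t : ℤ) :
    Module.finrank k (LinearMap.ker (koszulD a t 1 0 rfl).dualMap) = hilb a t := by
  have h1 := Subspace.finrank_add_finrank_dualAnnihilator_eq
    (LinearMap.range (koszulD a t 1 0 rfl))
  have h2 := Submodule.finrank_quotient_add_finrank (LinearMap.range (koszulD a t 1 0 rfl))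
  rw [LinearMap.ker_dualMap_eq_dualAnnihilator_range, hilb]
  omega

/-- Multiplying the functional of `exists_functional` by a polynomial `u` gives a functional which
the Bezoutian sends to the class of `u`. -/
theorem bezoutQuot_surjective (hd : ∀ i, 1 ≤ d i) (a : Coeffs d → k)
    (e : Fin n → ℕ) (he : ∀ i, X i ^ (e i + 1) ∈ Ideal.span (Set.range (poly a))) (t : ℤ) :
    Function.Surjective (bezoutQuot a t) := by
  intro y
  obtain ⟨y, rfl⟩ := Submodule.mkQ_surjective _ y
  obtain ⟨T, g, hT, hg⟩ := exists_bezoutMap_add hd a e he t (p := 0) (q := 0) rfl rfl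
    (p' := 1) (q' := 1) rfl rfl y
  refine ⟨⟨T, hT⟩, ?_⟩
  rw [← hg, map_add]
  have : (LinearMap.range (koszulD a t 1 0 rfl)).mkQ (koszulD a t 1 0 rfl g) = 0 := by
    rw [Submodule.mkQ_apply, Submodule.Quotient.mk_eq_zero]
    exact ⟨g, rfl⟩
  rw [this, zero_add]
  rfl

/-- Both `h(t) ≤ h(t_n - t)` and `h(t_n - t) ≤ h(t)` hold by surjectivity, so the Hilbert function
is symmetric and the Bezoutian duality is an isomorphism. -/
theorem bezoutQuot_injective (hd : ∀ i, 1 ≤ d i) (a : Coeffs d → k)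
    (e : Fin n → ℕ) (he : ∀ i, X i ^ (e i + 1) ∈ Ideal.span (Set.range (poly a))) (t : ℤ) :
    Function.Injective (bezoutQuot a t) := by
  have hle : ∀ t, hilb a t ≤ hilb a (critDeg d - t) := fun t => by
    rw [← finrank_ker_dualMap a (critDeg d - t)]
    exact LinearMap.finrank_le_finrank_of_surjective (bezoutQuot_surjective hd a e he t)
  have h2 := hle (critDeg d - t)
  rw [sub_sub_cancel] at h2
  have h3 : Module.finrank k (LinearMap.ker (koszulD a (critDeg d - t) 1 0 rfl).dualMap) =
      Module.finrank k (K k d t 0 ⧸ LinearMap.range (koszulD a t 1 0 rfl)) := by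
    rw [finrank_ker_dualMap]
    exact le_antisymm h2 (hle t)
  exact (LinearMap.injective_iff_surjective_of_finrank_eq_finrank (K := k)
    (V := LinearMap.ker (koszulD a (critDeg d - t) 1 0 rfl).dualMap)
    (V₂ := K k d t 0 ⧸ LinearMap.range (koszulD a t 1 0 rfl)) h3).2
      (bezoutQuot_surjective hd a e he t)

/-- The second component of a cycle of `C^{-1}` vanishes. -/
theorem eq_zero_of_bezoutMap (hd : ∀ i, 1 ≤ d i) (a : Coeffs d → k)
    (e : Fin n → ℕ) (he : ∀ i, X i ^ (e i + 1) ∈ Ideal.span (Set.range (poly a)))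
    (t : ℤ) {p q p' q' : ℤ} (hp : p = 0) (hq : q = 0) (hp' : p' = p + 1) (hq' : q' = q + 1)
    (T : Module.Dual k (K k d (critDeg d - t) p)) (g : K k d t q')
    (hT : (koszulD a (critDeg d - t) p' p hp').dualMap T = 0)
    (hg : koszulD a t q' q hq' g + bezoutMap a t p q hp hq T = 0) : T = 0 := by
  subst hp hq hp' hq'
  have h := bezoutQuot_injective hd a e he t
  have h1 : bezoutQuot a t ⟨T, hT⟩ = 0 := by
    change (LinearMap.range (koszulD a t 1 0 rfl)).mkQ (bezoutMap a t 0 0 rfl rfl T) = 0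
    rw [Submodule.mkQ_apply, Submodule.Quotient.mk_eq_zero]
    exact ⟨-g, by rw [map_neg]; exact neg_eq_of_add_eq_zero_right hg⟩
  have h2 := h (h1.trans (map_zero (bezoutQuot a t)).symm)
  exact congrArg Subtype.val h2

/-- In the degrees other than `-1` and `0`, the coupled complex is exact as soon as the Koszul
complex of `f` is exact in degrees `p ≥ 2`. -/
theorem coupledD_exact_of_ne (a : Coeffs d → k) (hK : ∀ p, 2 ≤ p → KoszulExact (poly a) ⊥ p)
    (t : ℤ) {j : ℤ} (h1 : j + 1 ≠ -1) (h2 : j + 1 ≠ 0) :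
    Function.Exact (coupledD a t j) (coupledD a t (j + 1)) := by
  intro x
  refine ⟨fun hx => ?_, fun ⟨y, hy⟩ => hy ▸ coupledD_coupledD a t j y⟩
  have hx1 := congrArg Prod.fst hx
  have hx2 := congrArg Prod.snd hx
  rw [coupledD_fst _ _ _ h1] at hx1
  rw [coupledD_snd] at hx2
  obtain ⟨g, hg⟩ : ∃ g, koszulD a t (-j) (-(j + 1)) (by ring) g = x.1 := by
    by_cases h0 : 0 ≤ -(j + 1)
    · exact (koszulD_exact a t (by ring) (by ring) (hK _ (by omega)) x.1).1 hx1
    · exact ⟨0, by rw [K_eq_zero (by omega) x.1, map_zero]⟩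
  obtain ⟨T, hT⟩ : ∃ T, (koszulD a (critDeg d - t) (j + 1 + 1) (j + 1) rfl).dualMap T = x.2 := by
    by_cases h0 : 0 ≤ j + 1
    · exact (exact_dualMap (koszulD_exact a (critDeg d - t) rfl rfl (hK _ (by omega))) x.2).1 hx2
    · exact ⟨0, by rw [dual_K_eq_zero (by omega) x.2, map_zero]⟩
  refine ⟨(g, T), Prod.ext ?_ hT⟩
  rw [coupledD_fst _ _ _ (by omega)]
  exact hg

/-- The coupled complex is exact if `k[X] / (f_1, …, f_n)` has finite dimension. -/
theorem coupledD_isExactComplex (hd : ∀ i, 1 ≤ d i) (a : Coeffs d → k) (e : Fin n → ℕ)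
    (he : ∀ i, X i ^ (e i + 1) ∈ Ideal.span (Set.range (poly a))) (t : ℤ) :
    IsExactComplex (coupledD a t) := by
  have hK : ∀ p, 1 ≤ p → KoszulExact (poly a) ⊥ p := fun p hp =>
    koszulExact_of_pow_mem _ le_rfl (fun i => e i + 1) (fun i _ => he i) (by omega)
  intro j
  by_cases h1 : j + 1 = -1
  · intro x
    refine ⟨fun hx => ?_, fun ⟨y, hy⟩ => hy ▸ coupledD_coupledD a t j y⟩
    have hx1 := congrArg Prod.fst hx
    have hx2 := congrArg Prod.snd hx
    rw [coupledD_fst' _ _ _ h1] at hx1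
    rw [coupledD_snd] at hx2
    have hT : x.2 = 0 :=
      eq_zero_of_bezoutMap hd a e he t _ _ rfl (by ring) x.2 x.1 hx2 hx1
    rw [hT, map_zero, add_zero] at hx1
    obtain ⟨g, hg⟩ := (koszulD_exact a t (p := -j) (by ring) (by ring) (hK _ (by omega)) x.1).1 hx1
    refine ⟨(g, 0), Prod.ext ?_ ?_⟩
    · rw [coupledD_fst _ _ _ (by omega)]
      exact hg
    · rw [coupledD_snd, map_zero, hT]
  by_cases h2 : j + 1 = 0
  · intro x
    refine ⟨fun hx => ?_, fun ⟨y, hy⟩ => hy ▸ coupledD_coupledD a t j y⟩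
    have hx2 := congrArg Prod.snd hx
    rw [coupledD_snd] at hx2
    obtain ⟨T₁, hT₁⟩ : ∃ T, (koszulD a (critDeg d - t) (j + 1 + 1) (j + 1) rfl).dualMap T = x.2 :=
      (exact_dualMap (koszulD_exact a (critDeg d - t) rfl rfl (hK _ (by omega))) x.2).1 hx2
    obtain ⟨T₂, g, hT₂, hg⟩ := exists_bezoutMap_add hd a e he t (p := j + 1) (q := -(j + 1))
      (p' := j + 1 + 1) (q' := -j) (by omega) (by omega) rfl (by ring)
      (x.1 - bezoutMap a t (j + 1) (-(j + 1)) (by omega) (by omega) T₁)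
    refine ⟨(g, T₁ + T₂), Prod.ext ?_ ?_⟩
    · rw [coupledD_fst' _ _ _ (by omega), map_add, add_left_comm, hg, add_sub_cancel]
    · rw [coupledD_snd, map_add, hT₁, hT₂, add_zero]
  · exact coupledD_exact_of_ne a (fun p hp => hK p (by omega)) t h1 h2

/-- By the Nullstellensatz, the ideal of polynomials without common root in projective space
contains powers of all the variables. -/
theorem exists_pow_mem_span [IsAlgClosed k] (a : Coeffs d → k)
    (ha : ¬ ∃ p : Fin n → k, p ≠ 0 ∧ ∀ i, eval p (poly a i) = 0) :
    ∃ e : Fin n → ℕ, ∀ i, X i ^ (e i + 1) ∈ Ideal.span (Set.range (poly a)) := by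
  have h : ∀ i, ∃ e : ℕ, X i ^ (e + 1) ∈ Ideal.span (Set.range (poly a)) := by
    intro i
    have h1 : X i ∈ vanishingIdeal k (zeroLocus k (Ideal.span (Set.range (poly a)))) := by
      rw [mem_vanishingIdeal_iff]
      intro p hp
      have hp0 : p = 0 := by
        by_contra hne
        refine ha ⟨p, hne, fun i => ?_⟩
        have := hp _ (Ideal.subset_span (Set.mem_range_self i))
        rwa [aeval_eq_eval] at this
      simp [hp0]
    rw [vanishingIdeal_zeroLocus_eq_radical] at h1
    obtain ⟨e, he⟩ := h1
    exact ⟨e, by rw [pow_succ]; exact Ideal.mul_mem_right _ _ he⟩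
  choose e he using h
  exact ⟨e, he⟩

/-- If `f_1, …, f_n` have a common root `p`, then all the homogeneous components of `Δ(p, Y)` lie in
the ideal of `f`, since `(p_j - Y_j) Δ(p, Y)` does. -/
theorem comp_bezoutian_mem (a : Coeffs d → k) {p : Fin n → k} (hp : p ≠ 0)
    (hz : ∀ i, eval p (poly a i) = 0) (m : ℕ) :
    comp k n m (map (eval p) (bezoutian (poly a))) ∈ Ideal.span (Set.range (poly a)) := by
  obtain ⟨j, hj⟩ := Function.ne_iff.1 hp
  rw [Pi.zero_apply] at hj
  set I := Ideal.span (Set.range (poly a)) with hI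
  set P := map (eval p) (bezoutian (poly a)) with hP
  have h1 : P * (C (p j) - X j) ∈ I := by
    have h := Ideal.mem_map_of_mem (map (eval p)) (bezoutian_mul_sub_mem (poly a) (X j))
    rw [Ideal.map_span] at h
    have e1 : map (eval p) (bezoutian (poly a) * (C (X j) - inY (X j))) = P * (C (p j) - X j) := by
      rw [map_mul, map_sub, map_C, eval_X, inY, map_X, map_X]
    rw [e1] at h
    refine Ideal.span_le.2 ?_ h
    rintro _ ⟨_, ⟨i, rfl⟩, rfl⟩
    have e2 : (eval p).comp C = RingHom.id k := by
      ext x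
      simp
    rw [map_sub, map_C, hz, inY, map_map, e2, map_id, C_0, zero_sub]
    exact I.neg_mem (Ideal.subset_span (Set.mem_range_self i))
  have hcomp : ∀ (u : ℤ) {q}, q ∈ I → comp k n u q ∈ I := by
    intro u q hq
    obtain ⟨c, -, e⟩ := comp_mem_span a u hq
    rw [e]
    exact Ideal.sum_mem _ fun i _ => Ideal.mul_mem_right _ _
      (Ideal.subset_span (Set.mem_range_self i))
  have hX : (X j : MvPolynomial (Fin n) k) ∈ S k n 1 := by
    refine (monomial_mem_restrictSupport k).2 (Or.inl ?_)
    simp [monSet]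
  -- the component of degree `u` of `(p_j - Y_j) Δ(p, Y)` relates those of `Δ(p, Y)` of degrees `u`
  -- and `u - 1`, and `p_j` is a unit
  have hstep : ∀ u : ℤ, C (p j) * comp k n u P - X j * comp k n (u - 1) P ∈ I := by
    intro u
    have := hcomp u h1
    rwa [mul_sub, map_sub, mul_comm P (X j), comp_mul (v := u - 1) (by ring) hX, mul_comm P,
      ← smul_eq_C_mul, map_smul, smul_eq_C_mul] at this
  have hunit : ∀ q, C (p j) * q ∈ I → q ∈ I := by
    intro q hq
    have := Ideal.mul_mem_left _ (C (p j)⁻¹) hq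
    rwa [← mul_assoc, ← C_mul, inv_mul_cancel₀ hj, C_1, one_mul] at this
  induction m with
  | zero =>
    have h2 := hstep 0
    have h3 : comp k n (0 - 1) P = 0 := by simp [comp]
    rw [h3, mul_zero, sub_zero] at h2
    exact hunit _ h2
  | succ m ih =>
    have h2 := hstep (m + 1 : ℕ)
    rw [show ((m + 1 : ℕ) : ℤ) - 1 = m by push_cast; ring] at h2
    have h3 := I.add_mem h2 (Ideal.mul_mem_left _ (X j) ih)
    rw [sub_add_cancel] at h3
    exact hunit _ h3

/-- If `f_1, …, f_n` have a common root `p` in projective space, then evaluation at `p` vanishes on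
the image of the cycles of `C^{-1}`, so the complex is not exact at `C^0`. -/
theorem not_isExactComplex (a : Coeffs d → k) {p : Fin n → k} (hp : p ≠ 0)
    (hz : ∀ i, eval p (poly a i) = 0) (t : ℕ) : ¬ IsExactComplex (coupledD a t) := by
  classical
  intro hex
  obtain ⟨l, hl⟩ := Function.ne_iff.1 hp
  rw [Pi.zero_apply] at hl
  have hspan : ∀ q ∈ Ideal.span (Set.range (poly a)), eval p q = 0 := by
    intro q hq
    have : Ideal.span (Set.range (poly a)) ≤ RingHom.ker (eval p) := by
      rw [Ideal.span_le]
      rintro _ ⟨i, rfl⟩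
      exact hz i
    exact this hq
  -- the element `X_l ^ t` of `S_t` is a cycle which does not vanish at `p`
  let y : K k d t (-(-1 + 1)) := fun I => ⟨comp k n _ (X l ^ t), comp_mem _ _⟩
  obtain ⟨⟨g, T⟩, hgT⟩ := (hex (-1) (y, 0)).1 <| by
    refine Prod.ext (K_eq_zero (by norm_num) _) ?_
    rw [coupledD_snd, map_zero]
    rfl
  have h1 := congrArg Prod.fst hgT
  have h2 := congrArg Prod.snd hgT
  rw [coupledD_fst' _ _ _ rfl] at h1
  rw [coupledD_snd] at h2
  let o : Sub n (-(-1 + 1)) := emptySub rfl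
  have h3 := congrArg (fun z => eval p (z o : MvPolynomial (Fin n) k)) h1
  have hy : (y o : MvPolynomial (Fin n) k) = X l ^ t := by
    refine comp_of_mem ?_
    rw [X_pow_eq_monomial]
    refine (monomial_mem_restrictSupport k).2 (Or.inl ?_)
    simp [monSet, o, emptySub, dSum]
  simp only [Pi.add_apply, Submodule.coe_add, map_add] at h3
  rw [hy, hspan _ (koszulD_mem_span a _ _ g _), zero_add, bezoutMap_coe, map_sum, map_pow,
    eval_X] at h3
  refine pow_ne_zero t hl (h3.symm.trans ?_)
  -- the sum is the value of `T` at the component of degree `t_n - t` of `Δ(p, Y)`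
  let z : K k d (critDeg d - t) (-1 + 1) := ∑ γ : Mon n (critDeg d - t - dSum d ∅),
    eval p (bezoutCoeff (poly a) γ.1) • kBasis k d (critDeg d - t) (-1 + 1)
      ⟨⟨∅, by simp⟩, γ⟩
  have hz0 : (z (emptySub rfl) : MvPolynomial (Fin n) k) =
      comp k n (critDeg d - t) (map (eval p) (bezoutian (poly a))) := by
    simp only [z, Finset.sum_apply, Pi.smul_apply, AddSubmonoidClass.coe_finsetSum,
      Submodule.coe_smul]
    simp only [kBasis_emptySub]
    ext δ
    rw [coeff_comp, coeff_map, coeff_sum]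
    simp only [coeff_smul, coeff_monomial, smul_eq_mul, mul_ite, mul_one, mul_zero]
    split_ifs with hδ
    · have hδ' : δ ∈ monSet n (critDeg d - t - dSum d ∅) := by
        rw [dSum_empty, sub_zero]
        exact hδ
      rw [Finset.sum_eq_single ⟨δ, hδ'⟩]
      · rw [if_pos rfl]
        rfl
      · intro γ _ hγ
        rw [if_neg fun h => hγ (Subtype.ext h)]
      · simp
    · refine Finset.sum_eq_zero fun γ _ => ?_
      rw [if_neg]
      rintro rfl
      have : (γ.1.degree : ℤ) = critDeg d - t - dSum d ∅ := γ.2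
      exact hδ (this.trans (by rw [dSum_empty, sub_zero]))
  have hzmem : (z (emptySub rfl) : MvPolynomial (Fin n) k) ∈ Ideal.span (Set.range (poly a)) := by
    rw [hz0]
    by_cases h0 : 0 ≤ critDeg d - t
    · have := comp_bezoutian_mem a hp hz (critDeg d - t).toNat
      rwa [Int.toNat_of_nonneg h0] at this
    · have : comp k n (critDeg d - t) (map (eval p) (bezoutian (poly a))) = 0 := by
        simp only [comp, h0, if_false, LinearMap.zero_apply]
      rw [this]
      exact Ideal.zero_mem _
  obtain ⟨g', hg'⟩ := exists_koszulD_eq a (critDeg d - t) (p := -1 + 1 + 1) rfl rfl hzmem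
  have hTz : T z = 0 := by
    rw [← hg', ← LinearMap.dualMap_apply, h2, LinearMap.zero_apply]
  rw [← hTz, map_sum]
  refine Finset.sum_congr rfl fun γ _ => ?_
  rw [smul_eval, map_smul, smul_eq_mul, mul_comm]

/-- Over an algebraically closed field, the coupled complex is exact exactly when the polynomials
have no common root in projective space. -/
theorem isExactComplex_iff [IsAlgClosed k] (hd : ∀ i, 1 ≤ d i) (a : Coeffs d → k) (t : ℕ) :
    IsExactComplex (coupledD a t) ↔ ¬ ∃ p : Fin n → k, p ≠ 0 ∧ ∀ i, eval p (poly a i) = 0 := by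
  constructor
  · rintro h ⟨p, hp, hz⟩
    exact not_isExactComplex a hp hz t h
  · intro h
    obtain ⟨e, he⟩ := exists_pow_mem_span a h
    exact coupledD_isExactComplex hd a e he t

end Exactness

/-! ### Matrices of the coupled complex and change of coefficients -/

section BaseChange

variable {R : Type u} [CommRing R] {R' : Type v} [CommRing R'] (φ : R →+* R') {n : ℕ}
  {d : Fin n → ℕ}

theorem map_poly (a : Coeffs d → R) (i : Fin n) : map φ (poly a i) = poly (φ ∘ a) i := by
  simp [poly, map_sum, map_monomial]

theorem map_incrMonomial (α : Fin n →₀ ℕ) (j : Fin n) :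
    map (map φ) (incrMonomial R α j) = incrMonomial R' α j := by
  simp [incrMonomial, xVar, yVar, map_prod, map_sum]

theorem map_incr (f : MvPolynomial (Fin n) R) (j : Fin n) :
    map (map φ) (incr f j) = incr (map φ f) j := by
  rw [incr, incr, map_sum, Finset.sum_subset (support_map_subset φ f)]
  · refine Finset.sum_congr rfl fun α _ => ?_
    rw [map_mul, map_C, map_C, map_incrMonomial, coeff_map]
  · intro α _ h
    rw [notMem_support_iff.1 h, C_0, C_0, zero_mul]

theorem map_bezoutCoeff (a : Coeffs d → R) (γ : Fin n →₀ ℕ) :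
    map φ (bezoutCoeff (poly a) γ) = bezoutCoeff (poly (φ ∘ a)) γ := by
  rw [bezoutCoeff, bezoutCoeff, ← coeff_map, bezoutian, bezoutian, RingHom.map_det]
  congr 2
  ext1 i j
  rw [RingHom.mapMatrix_apply, Matrix.map_apply, Matrix.of_apply, Matrix.of_apply, map_incr,
    map_poly]

open scoped Classical in
theorem kBasis_coe (t p : ℤ) (x : KIdx d t p) (I : Sub n p) :
    (kBasis R d t p x I : MvPolynomial (Fin n) R) = if I = x.1 then monomial x.2.1 1 else 0 := by
  obtain ⟨J, γ⟩ := x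
  rw [kBasis, Pi.basis_apply]
  split_ifs with h
  · subst h
    rw [← sBasis_coe (R := R)]
    congr 1
    exact Pi.single_eq_same _ _
  · have : (Pi.single J (sBasis R n (t - dSum d J.1) γ) : K R d t p) I = 0 :=
      Pi.single_eq_of_ne h _
    rw [this]
    rfl

theorem map_kExt_kBasis (t p : ℤ) (x : KIdx d t p) (I : Finset (Fin n)) :
    map φ (kExt (kBasis R d t p x) I) = kExt (kBasis R' d t p x) I := by
  classical
  unfold kExt
  split_ifs
  · rw [kBasis_coe, kBasis_coe, apply_ite (map φ), map_monomial, map_zero, map_one]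
  · exact map_zero _

theorem map_koszulD_kBasis (a : Coeffs d → R) (t p q : ℤ) (h : p = q + 1) (x : KIdx d t p)
    (J : Sub n q) :
    map φ (koszulD a t p q h (kBasis R d t p x) J : MvPolynomial (Fin n) R) =
      koszulD (φ ∘ a) t p q h (kBasis R' d t p x) J := by
  rw [koszulD_coe, koszulD_coe, map_sum]
  refine Finset.sum_congr rfl fun i _ => ?_
  rw [map_zsmul, map_mul, map_poly, map_kExt_kBasis]

theorem kBasis_repr (t p : ℤ) (g : K R d t p) (x : KIdx d t p) :
    (kBasis R d t p).repr g x = coeff x.2.1 (g x.1 : MvPolynomial (Fin n) R) := by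
  rw [kBasis, Pi.basis_repr]
  rfl

theorem kBasis_repr_koszulD (a : Coeffs d → R) (t p q : ℤ) (h : p = q + 1) (x : KIdx d t p)
    (y : KIdx d t q) :
    (kBasis R' d t q).repr (koszulD (φ ∘ a) t p q h (kBasis R' d t p x)) y =
      φ ((kBasis R d t q).repr (koszulD a t p q h (kBasis R d t p x)) y) := by
  rw [kBasis_repr, kBasis_repr, ← map_koszulD_kBasis, coeff_map]

open scoped Classical in
/-- The entries of `ψ_{1,t}` are the coefficients of the Bezoutian, hence compatible with changes of
the coefficients. -/
theorem kBasis_repr_bezoutMap (a : Coeffs d → R) (t p q : ℤ) (hp : p = 0) (hq : q = 0)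
    (x : KIdx d (critDeg d - t) p) (y : KIdx d t q) :
    (kBasis R' d t q).repr (bezoutMap (φ ∘ a) t p q hp hq
        ((kBasis R' d (critDeg d - t) p).dualBasis x)) y =
      φ ((kBasis R d t q).repr (bezoutMap a t p q hp hq
        ((kBasis R d (critDeg d - t) p).dualBasis x)) y) := by
  rw [kBasis_repr, kBasis_repr, bezoutMap_coe, bezoutMap_coe, coeff_sum, coeff_sum, map_sum]
  refine Finset.sum_congr rfl fun γ _ => ?_
  simp only [Module.Basis.dualBasis_apply_self, ite_smul, one_smul, zero_smul,
    ← map_bezoutCoeff φ a]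
  split_ifs
  · rw [coeff_map]
  · simp

open scoped Classical in
theorem coupledBasis_inl (t j : ℤ) (x : KIdx d t (-j)) :
    coupledBasis R d t j (Sum.inl x) = (kBasis R d t (-j) x, 0) :=
  Prod.ext (Module.Basis.prod_apply_inl_fst _ _ _) (Module.Basis.prod_apply_inl_snd _ _ _)

open scoped Classical in
theorem coupledBasis_inr (t j : ℤ) (x : KIdx d (critDeg d - t) (j + 1)) :
    coupledBasis R d t j (Sum.inr x) =
      (0, (kBasis R d (critDeg d - t) (j + 1)).dualBasis x) :=
  Prod.ext (Module.Basis.prod_apply_inr_fst _ _ _) (Module.Basis.prod_apply_inr_snd _ _ _)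

theorem coupledBasis_repr_inl (t j : ℤ) (z : Coupled R d t j) (y : KIdx d t (-j)) :
    (coupledBasis R d t j).repr z (Sum.inl y) = (kBasis R d t (-j)).repr z.1 y := rfl

theorem coupledBasis_repr_inr (t j : ℤ) (z : Coupled R d t j)
    (y : KIdx d (critDeg d - t) (j + 1)) :
    (coupledBasis R d t j).repr z (Sum.inr y) =
      z.2 (kBasis R d (critDeg d - t) (j + 1) y) := by
  classical
  rw [coupledBasis, Module.Basis.prod_repr_inr, Module.Basis.dualBasis_repr]

/-- The entries of the differentials of the coupled complex are compatible with changes of the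
coefficients. -/
theorem coupledBasis_repr_coupledD (a : Coeffs d → R) (t j : ℤ) (x : CoupledIdx d t j)
    (y : CoupledIdx d t (j + 1)) :
    (coupledBasis R' d t (j + 1)).repr (coupledD (φ ∘ a) t j (coupledBasis R' d t j x)) y =
      φ ((coupledBasis R d t (j + 1)).repr (coupledD a t j (coupledBasis R d t j x)) y) := by
  classical
  rcases x with x | x
  · rcases y with y | y
    · rw [coupledBasis_repr_inl, coupledBasis_repr_inl, coupledBasis_inl, coupledBasis_inl]
      by_cases h : j = -1
      · rw [coupledD_fst' _ _ _ h, coupledD_fst' _ _ _ h]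
        simp only [map_zero, add_zero]
        rw [kBasis_repr_koszulD]
      · rw [coupledD_fst _ _ _ h, coupledD_fst _ _ _ h, kBasis_repr_koszulD]
    · rw [coupledBasis_repr_inr, coupledBasis_repr_inr, coupledD_snd, coupledD_snd,
        coupledBasis_inl, coupledBasis_inl, map_zero, map_zero, LinearMap.zero_apply,
        LinearMap.zero_apply, map_zero]
  · rcases y with y | y
    · rw [coupledBasis_repr_inl, coupledBasis_repr_inl, coupledBasis_inr, coupledBasis_inr]
      by_cases h : j = -1
      · rw [coupledD_fst' _ _ _ h, coupledD_fst' _ _ _ h]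
        simp only [map_zero, zero_add]
        rw [kBasis_repr_bezoutMap]
      · rw [coupledD_fst _ _ _ h, coupledD_fst _ _ _ h, map_zero, map_zero, map_zero, map_zero]
        simp
    · rw [coupledBasis_repr_inr, coupledBasis_repr_inr, coupledD_snd, coupledD_snd,
        coupledBasis_inr, coupledBasis_inr, LinearMap.dualMap_apply, LinearMap.dualMap_apply,
        Module.Basis.dualBasis_apply, Module.Basis.dualBasis_apply, kBasis_repr_koszulD]

end BaseChange

section Order

variable {n : ℕ} (d : Fin n → ℕ) (t : ℤ)

/-- The ranks of the terms of the coupled complex. -/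
def coupledRank (j : ℤ) : ℕ := Fintype.card (CoupledIdx d t j)

theorem coupledRank_finite : {j | coupledRank d t j ≠ 0}.Finite := by
  refine (Set.finite_Icc (-(n : ℤ) - 1) n).subset fun j hj => ?_
  have hne : Nonempty (CoupledIdx d t j) := Fintype.card_pos_iff.1 (Nat.pos_of_ne_zero hj)
  obtain ⟨⟨I, -⟩ | ⟨I, -⟩⟩ := hne
  · have h1 := I.2
    have h2 := Finset.card_le_univ I.1
    rw [Fintype.card_fin] at h2
    rw [Set.mem_Icc]
    omega
  · have h1 := I.2
    have h2 := Finset.card_le_univ I.1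
    rw [Fintype.card_fin] at h2
    rw [Set.mem_Icc]
    omega

variable {d t}
variable (o : ∀ j : ℤ, CoupledIdx d t j ≃ Fin (coupledRank d t j))

/-- The monomial bases, ordered by `o`. -/
def ordBasis (R : Type u) [CommRing R] (j : ℤ) :
    Module.Basis (Fin (coupledRank d t j)) R (Coupled R d t j) :=
  (coupledBasis R d t j).reindex (o j)

/-- The matrices of the generic coupled complex in the ordered monomial bases. -/
def genericMatrix (j : ℤ) :
    Matrix (Fin (coupledRank d t (j + 1))) (Fin (coupledRank d t j)) (CoeffRing d) :=
  LinearMap.toMatrix (ordBasis o (CoeffRing d) j) (ordBasis o (CoeffRing d) (j + 1))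
    (coupledD (generic d) t j)

/-- The coupled complex of a specialization is the specialization of the generic coupled
complex. -/
theorem realizes_comp {F : Type*} [Field F] (φ : CoeffRing d →+* F) :
    Realizes (genericMatrix o) φ (coupledD (φ ∘ generic d) t) (ordBasis o F) := by
  refine ⟨fun j => ?_, fun j x => coupledD_coupledD _ t j x⟩
  ext1 x y
  rw [Matrix.map_apply, genericMatrix, LinearMap.toMatrix_apply, LinearMap.toMatrix_apply]
  simp only [ordBasis, Module.Basis.reindex_apply, Module.Basis.repr_reindex_apply]
  exact coupledBasis_repr_coupledD _ _ _ _ _ _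

/-- The generic complex over the field of fractions is the specialization along the inclusion. -/
theorem realizes_genericFrac :
    Realizes (genericMatrix o) (algebraMap (CoeffRing d) (FractionRing (CoeffRing d)))
      (coupledD (genericFrac d) t) (ordBasis o _) :=
  realizes_comp o _

end Order

/-! ### Counting monomials -/

section Counting

variable {n : ℕ}

/-- The exponent vector of `∏_{l ∈ I} X_l ^ (d_l)`. -/
def expVec (d : Fin n → ℕ) (I : Finset (Fin n)) : Fin n →₀ ℕ :=
  Finsupp.equivFunOnFinite.symm fun l => if l ∈ I then d l else 0

theorem expVec_apply (d : Fin n → ℕ) (I : Finset (Fin n)) (l : Fin n) :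
    expVec d I l = if l ∈ I then d l else 0 := rfl

theorem degree_expVec (d : Fin n → ℕ) (I : Finset (Fin n)) :
    ((expVec d I).degree : ℤ) = dSum d I := by
  rw [Finsupp.degree_eq_sum, dSum]
  push_cast
  simp only [expVec_apply, Nat.cast_ite, Nat.cast_zero]
  rw [Finset.sum_ite_mem, Finset.univ_inter]

/-- Multiplication by `∏_{l ∈ I} X_l ^ (d_l)` identifies the monomials of degree `u - d_I` with the
multiples of this monomial of degree `u`. -/
theorem card_mon_sub (d : Fin n → ℕ) (u : ℤ) (I : Finset (Fin n)) :
    Fintype.card (Mon n (u - dSum d I)) =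
      (Finset.univ.filter fun γ : Mon n u => ∀ l ∈ I, d l ≤ γ.1 l).card := by
  rw [← Finset.card_univ]
  refine Finset.card_bij (fun γ _ => ⟨γ.1 + expVec d I, ?_⟩) ?_ ?_ ?_
  · have h1 : (γ.1.degree : ℤ) = u - dSum d I := γ.2
    have h2 := degree_expVec d I
    change ((γ.1 + expVec d I).degree : ℤ) = u
    rw [map_add]
    push_cast
    omega
  · intro γ _
    simp only [Finset.mem_filter, Finset.mem_univ, true_and]
    intro l hl
    rw [Finsupp.add_apply, expVec_apply, if_pos hl]
    omega
  · intro γ _ δ _ h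
    exact Subtype.ext (add_right_cancel (Subtype.ext_iff.1 h))
  · intro γ hγ
    simp only [Finset.mem_filter, Finset.mem_univ, true_and] at hγ
    have hle : expVec d I ≤ γ.1 := by
      intro l
      rw [expVec_apply]
      split_ifs with h
      · exact hγ l h
      · exact Nat.zero_le _
    refine ⟨⟨γ.1 - expVec d I, ?_⟩, Finset.mem_univ _, Subtype.ext (tsub_add_cancel_of_le hle)⟩
    have h1 : (γ.1.degree : ℤ) = u := γ.2
    have h2 := degree_expVec d I
    have h3 := congrArg (fun δ : Fin n →₀ ℕ => (δ.degree : ℤ)) (tsub_add_cancel_of_le hle)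
    simp only [map_add] at h3
    push_cast at h3
    change ((γ.1 - expVec d I).degree : ℤ) = u - dSum d I
    omega

/-- Inclusion-exclusion: the alternating sum of the numbers of monomials counts the monomials which
are not divisible by `X_l ^ (d_l)` for `l ≠ i`. -/
theorem sum_card_mon (d : Fin n → ℕ) (i : Fin n) (u : ℤ) :
    ∑ I ∈ Finset.univ.filter (fun I : Finset (Fin n) => i ∉ I),
        (-1 : ℤ) ^ I.card * (Fintype.card (Mon n (u - dSum d I)) : ℤ) =
      (Finset.univ.filter fun γ : Mon n u => ∀ l, l ≠ i → γ.1 l < d l).card := by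
  classical
  have h1 : ∀ I : Finset (Fin n), (-1 : ℤ) ^ I.card * (Fintype.card (Mon n (u - dSum d I)) : ℤ) =
      ∑ γ : Mon n u, if ∀ l ∈ I, d l ≤ γ.1 l then (-1 : ℤ) ^ I.card else 0 := by
    intro I
    rw [card_mon_sub, Finset.card_filter]
    push_cast
    rw [Finset.mul_sum]
    exact Finset.sum_congr rfl fun γ _ => by rw [mul_ite, mul_one, mul_zero]
  rw [Finset.sum_congr rfl fun I _ => h1 I, Finset.sum_comm, Finset.card_filter]
  push_cast
  refine Finset.sum_congr rfl fun γ _ => ?_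
  let B : Finset (Fin n) := Finset.univ.filter fun l => l ≠ i ∧ d l ≤ γ.1 l
  have h2 : (Finset.univ.filter (fun I : Finset (Fin n) => i ∉ I)).filter
      (fun I => ∀ l ∈ I, d l ≤ γ.1 l) = B.powerset := by
    ext I
    simp only [B, Finset.mem_filter, Finset.mem_univ, true_and, Finset.mem_powerset]
    constructor
    · rintro ⟨hi, hI⟩ l hl
      simp only [Finset.mem_filter, Finset.mem_univ, true_and]
      exact ⟨fun h => hi (h ▸ hl), hI l hl⟩
    · intro h
      refine ⟨fun hi => ?_, fun l hl => ?_⟩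
      · have := h hi
        simp at this
      · have := h hl
        simp only [Finset.mem_filter, Finset.mem_univ, true_and] at this
        exact this.2
  rw [← Finset.sum_filter, h2, Finset.sum_powerset_neg_one_pow_card]
  congr 1
  rw [Finset.filter_eq_empty_iff, eq_iff_iff]
  refine forall_congr' fun l => ?_
  simp only [Finset.mem_univ, true_imp_iff, not_and, not_le]

/-- The box `∏_{l ≠ i} [0, d_l)`, with the coordinate `0` at `i`. -/
def box (d : Fin n → ℕ) (i : Fin n) : Finset (Fin n → ℕ) :=
  Fintype.piFinset fun l => if l = i then {0} else Finset.range (d l)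

theorem mem_box {d : Fin n → ℕ} {i : Fin n} {β : Fin n → ℕ} :
    β ∈ box d i ↔ β i = 0 ∧ ∀ l, l ≠ i → β l < d l := by
  rw [box, Fintype.mem_piFinset]
  constructor
  · intro h
    refine ⟨by simpa using h i, fun l hl => by simpa [hl] using h l⟩
  · rintro ⟨h1, h2⟩ l
    split_ifs with hl
    · simp [hl, h1]
    · simpa using h2 l hl

/-- The degree `∏_{l ≠ i} d_l` of the resultant in the coefficients of `f_i`. -/
def resDeg (d : Fin n → ℕ) (i : Fin n) : ℕ := ∏ l ∈ Finset.univ.erase i, d l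

theorem card_box (d : Fin n → ℕ) (i : Fin n) : (box d i).card = resDeg d i := by
  rw [box, Fintype.card_piFinset, ← Finset.mul_prod_erase _ _ (Finset.mem_univ i), resDeg]
  simp only [if_true, Finset.card_singleton, one_mul]
  refine Finset.prod_congr rfl fun l hl => ?_
  rw [if_neg (Finset.ne_of_mem_erase hl), Finset.card_range]

/-- A monomial of degree `u` is determined by its exponents at the variables other than `X_i`; the
exponent of `X_i` is only constrained to be non-negative. -/
theorem card_mon_filter (d : Fin n → ℕ) (i : Fin n) (u : ℤ) :
    (Finset.univ.filter fun γ : Mon n u => ∀ l, l ≠ i → γ.1 l < d l).card =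
      ((box d i).filter fun β => ∑ l, (β l : ℤ) ≤ u).card := by
  classical
  have hsum : ∀ γ : Fin n →₀ ℕ,
      (γ.degree : ℤ) = γ i + ∑ l, (Function.update γ i 0 l : ℤ) := by
    intro γ
    rw [Finsupp.degree_eq_sum]
    push_cast
    rw [← Finset.add_sum_erase _ _ (Finset.mem_univ i),
      ← Finset.add_sum_erase (Finset.univ) (fun l => ((Function.update γ i 0 l : ℕ) : ℤ))
        (Finset.mem_univ i)]
    simp only [Function.update_self, Nat.cast_zero, zero_add]
    congr 1
    refine Finset.sum_congr rfl fun l hl => ?_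
    rw [Function.update_of_ne (Finset.ne_of_mem_erase hl)]
  refine Finset.card_bij (fun γ _ => Function.update γ.1 i 0) ?_ ?_ ?_
  · intro γ hγ
    simp only [Finset.mem_filter, Finset.mem_univ, true_and] at hγ
    rw [Finset.mem_filter, mem_box]
    refine ⟨⟨Function.update_self _ _ _, fun l hl => ?_⟩, ?_⟩
    · rw [Function.update_of_ne hl]
      exact hγ l hl
    · have h1 : (γ.1.degree : ℤ) = u := γ.2
      have := hsum γ.1
      omega
  · intro γ _ δ _ h
    have h1 : (γ.1.degree : ℤ) = u := γ.2
    have h2 : (δ.1.degree : ℤ) = u := δ.2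
    have e1 := hsum γ.1
    have e2 := hsum δ.1
    rw [h] at e1
    refine Subtype.ext (Finsupp.ext fun l => ?_)
    by_cases hl : l = i
    · rw [hl]
      omega
    · have := congrFun h l
      rwa [Function.update_of_ne hl, Function.update_of_ne hl] at this
  · intro β hβ
    rw [Finset.mem_filter, mem_box] at hβ
    obtain ⟨⟨h0, h1⟩, h2⟩ := hβ
    let γ : Fin n →₀ ℕ := Finsupp.equivFunOnFinite.symm
      (Function.update β i (u - ∑ l, (β l : ℤ)).toNat)
    have hγ : Function.update γ i 0 = β := by
      change Function.update (Function.update β i _) i 0 = β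
      rw [Function.update_idem, ← h0, Function.update_eq_self]
    have hγi : γ i = (u - ∑ l, (β l : ℤ)).toNat := Function.update_self _ _ _
    refine ⟨⟨γ, ?_⟩, ?_, hγ⟩
    · have := hsum γ
      rw [hγ, hγi] at this
      change (γ.degree : ℤ) = u
      omega
    · simp only [Finset.mem_filter, Finset.mem_univ, true_and]
      intro l hl
      have := h1 l hl
      rwa [← hγ, Function.update_of_ne hl] at this

/-- The two alternating sums of ranks which measure the homogeneity of the determinant of the
coupled complex add up to the degree of the resultant, by the symmetry of the box. -/
theorem sum_card_mon_add (d : Fin n → ℕ) (hd : ∀ i, 1 ≤ d i) (i : Fin n) (t : ℤ) :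
    ∑ I ∈ Finset.univ.filter (fun I : Finset (Fin n) => i ∉ I),
        (-1 : ℤ) ^ I.card * (Fintype.card (Mon n (t - d i - dSum d I)) : ℤ) +
      ∑ I ∈ Finset.univ.filter (fun I : Finset (Fin n) => i ∉ I),
        (-1 : ℤ) ^ I.card * (Fintype.card (Mon n (critDeg d - t - dSum d I)) : ℤ) =
      resDeg d i := by
  classical
  rw [sum_card_mon, sum_card_mon, card_mon_filter, card_mon_filter, ← card_box,
    ← Finset.card_filter_add_card_filter_not (s := box d i)
      (fun β => ∑ l, (β l : ℤ) ≤ t - d i)]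
  push_cast
  congr 2
  -- the symmetry `β_l ↦ d_l - 1 - β_l` of the box takes the sum `s` of the coordinates to
  -- `t_n - (d_i - 1) - s`, hence exchanges `s ≤ t_n - t` and `s > t - d_i`
  let σ : (Fin n → ℕ) → Fin n → ℕ := fun β l => if l = i then 0 else d l - 1 - β l
  have hσ : ∀ β ∈ box d i, σ β ∈ box d i ∧ σ (σ β) = β ∧
      ∑ l, (σ β l : ℤ) = critDeg d - (d i - 1) - ∑ l, (β l : ℤ) := by
    intro β hβ
    rw [mem_box] at hβ
    refine ⟨?_, ?_, ?_⟩
    · rw [mem_box]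
      refine ⟨if_pos rfl, fun l hl => ?_⟩
      have := hd l
      simp only [σ, hl, if_false]
      omega
    · ext1 l
      by_cases hl : l = i
      · simp [σ, hl, hβ.1]
      · have := hβ.2 l hl
        simp only [σ, hl, if_false]
        omega
    · have e1 := Finset.add_sum_erase Finset.univ (fun l => ((σ β l : ℕ) : ℤ)) (Finset.mem_univ i)
      have e2 := Finset.add_sum_erase Finset.univ (fun l => ((β l : ℕ) : ℤ)) (Finset.mem_univ i)
      have e3 := Finset.add_sum_erase Finset.univ (fun l => ((d l : ℤ) - 1)) (Finset.mem_univ i)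
      have e4 : ∑ l ∈ Finset.univ.erase i, ((σ β l : ℕ) : ℤ) =
          ∑ l ∈ Finset.univ.erase i, ((d l : ℤ) - 1) - ∑ l ∈ Finset.univ.erase i, (β l : ℤ) := by
        rw [← Finset.sum_sub_distrib]
        refine Finset.sum_congr rfl fun l hl => ?_
        have hl' := Finset.ne_of_mem_erase hl
        have := hβ.2 l hl'
        simp only [σ, hl', if_false]
        omega
      have e5 : σ β i = 0 := if_pos rfl
      have e6 := hβ.1
      rw [critDeg]
      simp only [e5, e6] at e1 e2
      push_cast at e1 e2
      linarith
  refine Finset.card_bij' (fun β _ => σ β) (fun β _ => σ β) ?_ ?_ ?_ ?_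
  · intro β hβ
    rw [Finset.mem_filter] at hβ ⊢
    have := hσ β hβ.1
    refine ⟨this.1, ?_⟩
    rw [this.2.2]
    omega
  · intro β hβ
    rw [Finset.mem_filter] at hβ ⊢
    have := hσ β hβ.1
    refine ⟨this.1, ?_⟩
    rw [this.2.2]
    omega
  · intro β hβ
    exact (hσ β (Finset.mem_filter.1 hβ).1).2.1
  · intro β hβ
    exact (hσ β (Finset.mem_filter.1 hβ).1).2.1

end Counting

/-! ### Homogeneity of the determinant -/

section Scaling

variable {R : Type u} [CommRing R] {n : ℕ} {d : Fin n → ℕ}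

/-- The coefficients of `f_1, …, c f_i, …, f_n`. -/
def scaleAt (i : Fin n) (c : R) (a : Coeffs d → R) : Coeffs d → R :=
  fun x => (if x.1 = i then c else 1) * a x

theorem poly_scaleAt (i : Fin n) (c : R) (a : Coeffs d → R) (l : Fin n) :
    poly (scaleAt i c a) l = C (if l = i then c else 1) * poly a l := by
  rw [poly, poly, Finset.mul_sum]
  exact Finset.sum_congr rfl fun α _ => by rw [C_mul_monomial]; rfl

theorem incr_C_mul (c : R) (f : MvPolynomial (Fin n) R) (j : Fin n) :
    incr (C c * f) j = C (C c) * incr f j := by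
  have hs : (C c * f).support ⊆ f.support := by
    intro α hα
    rw [mem_support_iff, coeff_C_mul] at hα
    exact mem_support_iff.2 (right_ne_zero_of_mul hα)
  rw [incr, incr, Finset.sum_subset hs, Finset.mul_sum]
  · refine Finset.sum_congr rfl fun α _ => ?_
    rw [coeff_C_mul, C_mul, C_mul, mul_assoc]
  · intro α _ h
    rw [notMem_support_iff.1 h, C_0, C_0, zero_mul]

/-- The Bezoutian is linear in each of the polynomials `f_i`. -/
theorem bezoutCoeff_scaleAt (i : Fin n) (c : R) (a : Coeffs d → R) (γ : Fin n →₀ ℕ) :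
    bezoutCoeff (poly (scaleAt i c a)) γ = c • bezoutCoeff (poly a) γ := by
  classical
  have h : bezoutian (poly (scaleAt i c a)) = C (C c) * bezoutian (poly a) := by
    have e : (Matrix.of fun l j => incr (poly (scaleAt i c a) l) j) =
        Matrix.diagonal (fun l => if l = i then C (C c) else 1) *
          Matrix.of fun l j => incr (poly a l) j := by
      ext1 l j
      rw [Matrix.diagonal_mul, Matrix.of_apply, Matrix.of_apply, poly_scaleAt, incr_C_mul]
      split_ifs <;> simp
    rw [bezoutian, e, Matrix.det_mul, Matrix.det_diagonal, bezoutian]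
    congr 1
    simp
  rw [bezoutCoeff, h, coeff_C_mul, bezoutCoeff, smul_eq_C_mul]

variable {F : Type u} [Field F]

/-- The factor `c⁻¹` or `1`, according to a condition. -/
def scaleUnit (c : Fˣ) (p : Prop) [Decidable p] : Fˣ := if p then c⁻¹ else 1

/-- The automorphism of `K(t)^{-p}` which multiplies the component at `I` by a unit. -/
def kScale (t p : ℤ) (w : Finset (Fin n) → Fˣ) : K F d t p ≃ₗ[F] K F d t p :=
  LinearEquiv.piCongrRight fun I => LinearEquiv.smulOfUnit (w I.1)

theorem kScale_apply (t p : ℤ) (w : Finset (Fin n) → Fˣ) (g : K F d t p) (I : Sub n p) :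
    kScale t p w g I = (w I.1 : F) • g I := rfl

theorem kExt_kScale (t p : ℤ) (w : Finset (Fin n) → Fˣ) (g : K F d t p) (I : Finset (Fin n)) :
    kExt (kScale t p w g) I = (w I : F) • kExt g I := by
  unfold kExt
  split_ifs
  · rfl
  · rw [smul_zero]

/-- A family of weights of the components intertwines the Koszul differentials of `f` and of
`f_1, …, c f_i, …, f_n` if the weights at `J ∪ l` and at `J` have the ratio `c⁻¹` or `1`, according
to whether `l = i` or not. -/
theorem koszulD_scaleAt (i : Fin n) (c : Fˣ) (a : Coeffs d → F) (t p q : ℤ) (h : p = q + 1)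
    (w w' : Finset (Fin n) → Fˣ)
    (hw : ∀ (J : Finset (Fin n)), ∀ l ∉ J, (if l = i then (c : F) else 1) * w (insert l J) = w' J)
    (g : K F d t p) :
    koszulD (scaleAt i (c : F) a) t p q h (kScale t p w g) =
      kScale t q w' (koszulD a t p q h g) := by
  funext J
  apply Subtype.ext
  rw [kScale_apply, Submodule.coe_smul, koszulD_coe, koszulD_coe, Finset.smul_sum]
  refine Finset.sum_congr rfl fun l hl => ?_
  rw [poly_scaleAt, kExt_kScale, ← hw J.1 l (Finset.mem_filter.1 hl).2]
  simp only [smul_eq_C_mul, C_mul, zsmul_eq_mul]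
  ring

/-- The isomorphism from the coupled complex of `f` to the one of `f_1, …, c f_i, …, f_n`. -/
def coupledScale (d : Fin n → ℕ) (i : Fin n) (c : Fˣ) (t j : ℤ) :
    Coupled F d t j ≃ₗ[F] Coupled F d t j :=
  (kScale t (-j) fun I => scaleUnit c (i ∈ I)).prodCongr
    (kScale (critDeg d - t) (j + 1) fun I => scaleUnit c (i ∉ I)).dualMap

/-- The components at the `I` containing `i` of the Koszul part, and those at the `I` not containing
`i` of the dual part, are divided by `c`. This is compatible with `ψ_{1,t}`, which is multiplied by
`c` when `f_i` is. -/
theorem coupledD_coupledScale (i : Fin n) (c : Fˣ) (a : Coeffs d → F) (t j : ℤ)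
    (x : Coupled F d t j) :
    coupledD (scaleAt i (c : F) a) t j (coupledScale d i c t j x) =
      coupledScale d i c t (j + 1) (coupledD a t j x) := by
  have hk : koszulD (scaleAt i (c : F) a) t (-j) (-(j + 1)) (by ring)
      (kScale t (-j) (fun I => scaleUnit c (i ∈ I)) x.1) =
        kScale t (-(j + 1)) (fun I => scaleUnit c (i ∈ I))
          (koszulD a t (-j) (-(j + 1)) (by ring) x.1) := by
    refine koszulD_scaleAt i c a _ _ _ _ _ _ (fun J l hl => ?_) _
    by_cases hli : l = i
    · subst hli
      simp [scaleUnit, hl]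
    · have : ¬ i = l := fun h => hli h.symm
      simp [scaleUnit, hli, this]
  refine Prod.ext ?_ ?_
  · by_cases h : j = -1
    · rw [coupledD_fst' _ _ _ h]
      change koszulD _ _ _ _ _ (kScale t (-j) (fun I => scaleUnit c (i ∈ I)) x.1) + _ =
        kScale t (-(j + 1)) (fun I => scaleUnit c (i ∈ I)) (coupledD a t j x).1
      rw [hk, coupledD_fst' _ _ _ h, map_add]
      congr 1
      funext I
      apply Subtype.ext
      rw [kScale_apply, Submodule.coe_smul, bezoutMap_coe, bezoutMap_coe, Finset.smul_sum]
      refine Finset.sum_congr rfl fun γ _ => ?_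
      have hI : I.1 = ∅ := by
        have := I.2
        rw [← Finset.card_eq_zero]
        omega
      have hT : (coupledScale d i c t j x).2 (kBasis F d (critDeg d - t) (j + 1)
            ⟨⟨∅, by simp [h]⟩, γ⟩) =
          (c : F)⁻¹ * x.2 (kBasis F d (critDeg d - t) (j + 1) ⟨⟨∅, by simp [h]⟩, γ⟩) := by
        change x.2 (kScale _ _ (fun I => scaleUnit c (i ∉ I)) _) = _
        have : kScale (critDeg d - t) (j + 1) (fun I => scaleUnit c (i ∉ I))
            (kBasis F d (critDeg d - t) (j + 1) ⟨⟨∅, by simp [h]⟩, γ⟩) =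
            (c : F)⁻¹ • kBasis F d (critDeg d - t) (j + 1) ⟨⟨∅, by simp [h]⟩, γ⟩ := by
          funext J
          have hJ := eq_emptySub (show j + 1 = 0 by omega) J
          rw [kScale_apply, hJ, Pi.smul_apply]
          congr 1
          simp [scaleUnit, emptySub]
        rw [this, map_smul, smul_eq_mul]
      rw [hT, bezoutCoeff_scaleAt, hI]
      simp only [scaleUnit, Finset.notMem_empty, if_false, Units.val_one, smul_smul]
      congr 1
      rw [mul_right_comm, inv_mul_cancel₀ c.ne_zero, one_mul]
    · rw [coupledD_fst _ _ _ h]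
      change koszulD _ _ _ _ _ (kScale t (-j) (fun I => scaleUnit c (i ∈ I)) x.1) =
        kScale t (-(j + 1)) (fun I => scaleUnit c (i ∈ I)) (coupledD a t j x).1
      rw [hk, coupledD_fst _ _ _ h]
  · refine LinearMap.ext fun g => ?_
    change x.2 (kScale (critDeg d - t) (j + 1) (fun I => scaleUnit c (i ∉ I))
      (koszulD (scaleAt i (c : F) a) _ _ _ _ g)) = x.2 (koszulD a _ _ _ _
        (kScale (critDeg d - t) (j + 1 + 1) (fun I => scaleUnit c (i ∉ I)) g))
    congr 1
    have h1 : kScale (critDeg d - t) (j + 1 + 1) (fun I => scaleUnit c⁻¹ (i ∉ I))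
        (kScale (critDeg d - t) (j + 1 + 1) (fun I => scaleUnit c (i ∉ I)) g) = g := by
      funext J
      rw [kScale_apply, kScale_apply, smul_smul, ← Units.val_mul]
      have : scaleUnit c⁻¹ (i ∉ J.1) * scaleUnit c (i ∉ J.1) = 1 := by
        unfold scaleUnit
        split_ifs <;> simp
      rw [this, Units.val_one, one_smul]
    conv_lhs => rw [← h1]
    rw [koszulD_scaleAt i c a _ _ _ _ _ (fun I => scaleUnit c⁻¹ (i ∉ I)) (fun J l hl => ?_)]
    · funext J
      rw [kScale_apply, kScale_apply, smul_smul, ← Units.val_mul]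
      have : scaleUnit c (i ∉ J.1) * scaleUnit c⁻¹ (i ∉ J.1) = 1 := by
        unfold scaleUnit
        split_ifs <;> simp
      rw [this, Units.val_one, one_smul]
    · by_cases hli : l = i
      · subst hli
        simp [scaleUnit, hl]
      · have : ¬ i = l := fun h => hli h.symm
        simp [scaleUnit, hli, this]

/-- The factor by which `coupledScale` multiplies a basis element. -/
def scaleFactor (i : Fin n) (c : Fˣ) (t j : ℤ) : CoupledIdx d t j → Fˣ
  | Sum.inl x => scaleUnit c (i ∈ x.1.1)
  | Sum.inr x => scaleUnit c (i ∉ x.1.1)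

open scoped Classical in
theorem kScale_kBasis (t p : ℤ) (w : Finset (Fin n) → Fˣ) (x : KIdx d t p) :
    kScale t p w (kBasis F d t p x) = (w x.1.1 : F) • kBasis F d t p x := by
  obtain ⟨I, γ⟩ := x
  funext J
  rw [kScale_apply, Pi.smul_apply, kBasis, Pi.basis_apply]
  by_cases h : J = I
  · subst h
    rfl
  · rw [Pi.single_eq_of_ne h, smul_zero, smul_zero]

theorem coupledScale_basis (i : Fin n) (c : Fˣ) (t j : ℤ) (x : CoupledIdx d t j) :
    coupledScale d i c t j (coupledBasis F d t j x) =
      (scaleFactor i c t j x : F) • coupledBasis F d t j x := by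
  classical
  rcases x with x | x
  · rw [coupledBasis_inl]
    refine Prod.ext ?_ ?_
    · exact kScale_kBasis t (-j) (fun I => scaleUnit c (i ∈ I)) x
    · rw [Prod.smul_snd, smul_zero]
      exact map_zero (kScale (critDeg d - t) (j + 1) fun I => scaleUnit c (i ∉ I)).dualMap
  · rw [coupledBasis_inr]
    refine Prod.ext ?_ ?_
    · rw [Prod.smul_fst, smul_zero]
      exact map_zero (kScale t (-j) fun I => scaleUnit c (i ∈ I))
    · refine (kBasis F d (critDeg d - t) (j + 1)).ext fun y => ?_
      change (kBasis F d (critDeg d - t) (j + 1)).dualBasis x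
        (kScale _ _ (fun I => scaleUnit c (i ∉ I)) _) = _
      rw [kScale_kBasis, map_smul, Prod.smul_snd, LinearMap.smul_apply,
        Module.Basis.dualBasis_apply_self]
      split_ifs with h
      · rw [h]
        rfl
      · rw [smul_zero, smul_zero]

/-- The number of the basis elements of `C^j` which `coupledScale` divides by `c`. -/
def scaleCount (d : Fin n → ℕ) (i : Fin n) (t j : ℤ) : ℤ :=
  ∑ I : Finset (Fin n), (if (I.card : ℤ) = -j then
      (if i ∈ I then (Fintype.card (Mon n (t - dSum d I)) : ℤ) else 0) else 0) +
    ∑ I : Finset (Fin n), (if (I.card : ℤ) = j + 1 then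
      (if i ∉ I then (Fintype.card (Mon n (critDeg d - t - dSum d I)) : ℤ) else 0) else 0)

theorem sum_sub {M : Type*} [AddCommMonoid M] (p : ℤ) (g : Finset (Fin n) → M) :
    ∑ I : Sub n p, g I.1 = ∑ I : Finset (Fin n), if (I.card : ℤ) = p then g I else 0 := by
  rw [← Finset.sum_filter]
  exact (Finset.sum_subtype _ (by simp) g).symm

theorem prod_zpow_eq_zpow_sum {G ι : Type*} [CommGroup G] (s : Finset ι) (z : ι → ℤ) (c : G) :
    ∏ i ∈ s, c ^ z i = c ^ ∑ i ∈ s, z i := by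
  classical
  induction s using Finset.induction_on with
  | empty => simp
  | insert i s hi ih => rw [Finset.prod_insert hi, Finset.sum_insert hi, ih, zpow_add]

/-- The determinant of `coupledScale` in degree `j`. -/
theorem prod_scaleFactor (i : Fin n) (c : Fˣ) (t j : ℤ) :
    ∏ x : CoupledIdx d t j, scaleFactor i c t j x = c ^ (-scaleCount d i t j) := by
  have hu : ∀ (p : Prop) [Decidable p], scaleUnit c p = c ^ (-if p then 1 else 0 : ℤ) := by
    intro p _
    unfold scaleUnit
    split_ifs <;> simp
  rw [Fintype.prod_sum_type]
  simp only [scaleFactor, hu]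
  rw [prod_zpow_eq_zpow_sum, prod_zpow_eq_zpow_sum, ← zpow_add, Finset.sum_neg_distrib,
    Finset.sum_neg_distrib, ← neg_add]
  congr 2
  rw [scaleCount, ← sum_sub (-j) fun I => if i ∈ I then _ else _,
    ← sum_sub (j + 1) fun I => if i ∉ I then _ else _, Fintype.sum_sigma, Fintype.sum_sigma]
  congr 1
  all_goals
    refine Finset.sum_congr rfl fun I _ => ?_
    by_cases hi : i ∈ I.1 <;>
      simp only [hi, if_true, if_false, not_true, not_false_eq_true, Finset.sum_const,
        Finset.card_univ, nsmul_eq_mul, mul_one, mul_zero]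

/-- The alternating sum of the numbers of the basis elements divided by `c`: the subsets containing
`i` are `I ∪ i` with `i ∉ I`, so that the two sums of `sum_card_mon_add` appear. -/
theorem sum_scaleCount (d : Fin n → ℕ) (hd : ∀ i, 1 ≤ d i) (i : Fin n) (t : ℤ) {s : Finset ℤ}
    (hs : Finset.Icc (-(n : ℤ) - 1) n ⊆ s) :
    ∑ j ∈ s, scaleCount d i t j * (j.negOnePow : ℤ) = - resDeg d i := by
  have hc : ∀ I : Finset (Fin n), (I.card : ℤ) ≤ n := fun I => by
    have := Finset.card_le_univ I
    rw [Fintype.card_fin] at this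
    exact_mod_cast this
  have hpow : ∀ m : ℕ, ((m : ℤ).negOnePow : ℤ) = (-1) ^ m := fun m => by
    simp [Int.negOnePow_def]
  have h1 : ∀ I : Finset (Fin n), -(I.card : ℤ) ∈ s := fun I => hs (by
    have := hc I
    rw [Finset.mem_Icc]
    omega)
  have h2 : ∀ I : Finset (Fin n), (I.card : ℤ) - 1 ∈ s := fun I => hs (by
    have := hc I
    rw [Finset.mem_Icc]
    omega)
  simp only [scaleCount, add_mul, Finset.sum_mul, Finset.sum_add_distrib]
  rw [Finset.sum_comm, Finset.sum_comm (s := s)]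
  have e1 : ∀ I : Finset (Fin n), ∑ j ∈ s, (if (I.card : ℤ) = -j then
      (if i ∈ I then (Fintype.card (Mon n (t - dSum d I)) : ℤ) else 0) else 0) *
        (j.negOnePow : ℤ) =
      (if i ∈ I then (-1) ^ I.card * (Fintype.card (Mon n (t - dSum d I)) : ℤ) else 0) := by
    intro I
    rw [Finset.sum_eq_single_of_mem _ (h1 I) fun j _ hj => by
      rw [if_neg (by omega), zero_mul]]
    rw [neg_neg, if_pos rfl, Int.negOnePow_neg, hpow, mul_comm]
    split_ifs <;> simp
  have e2 : ∀ I : Finset (Fin n), ∑ j ∈ s, (if (I.card : ℤ) = j + 1 then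
      (if i ∉ I then (Fintype.card (Mon n (critDeg d - t - dSum d I)) : ℤ) else 0) else 0) *
        (j.negOnePow : ℤ) =
      (if i ∉ I then - ((-1) ^ I.card *
        (Fintype.card (Mon n (critDeg d - t - dSum d I)) : ℤ)) else 0) := by
    intro I
    rw [Finset.sum_eq_single_of_mem _ (h2 I) fun j _ hj => by
      rw [if_neg (by omega), zero_mul]]
    rw [sub_add_cancel, if_pos rfl, Int.negOnePow_sub, Int.negOnePow_one]
    push_cast
    rw [hpow]
    split_ifs <;> simp [mul_comm]
  rw [Finset.sum_congr rfl fun I _ => e1 I, Finset.sum_congr rfl fun I _ => e2 I,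
    ← Finset.sum_filter, ← Finset.sum_filter, Finset.sum_neg_distrib, ← sum_card_mon_add d hd i t,
    neg_add]
  congr 1
  rw [← Finset.sum_neg_distrib]
  refine Finset.sum_bij' (fun I _ => I.erase i) (fun I _ => insert i I) ?_ ?_ ?_ ?_ ?_
  · simp
  · simp
  · intro I hI
    exact Finset.insert_erase (Finset.mem_filter.1 hI).2
  · intro I hI
    exact Finset.erase_insert (Finset.mem_filter.1 hI).2
  · intro I hI
    have hI' := (Finset.mem_filter.1 hI).2
    have h3 : I.card = (I.erase i).card + 1 := (Finset.card_erase_add_one hI').symm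
    have h4 : t - dSum d I = t - d i - dSum d (I.erase i) := by
      conv_lhs => rw [← Finset.insert_erase hI', dSum_insert (Finset.notMem_erase i I)]
      ring
    rw [h4, h3, pow_succ]
    ring

/-- The determinant of the coupled complex is homogeneous of degree `∏_{l ≠ i} d_l` in the
coefficients of `f_i`. -/
theorem IsComplexDet.scaleAt (hd : ∀ i, 1 ≤ d i) {t : ℤ}
    (o : ∀ j : ℤ, CoupledIdx d t j ≃ Fin (coupledRank d t j)) (i : Fin n) (c : Fˣ)
    (a : Coeffs d → F) {x : F} (hx : IsComplexDet (coupledD a t) (ordBasis o F) x) :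
    IsComplexDet (coupledD (scaleAt i (c : F) a) t) (ordBasis o F)
      (x * (c : F) ^ resDeg d i) := by
  have hN := coupledRank_finite d t
  have h := IsComplexDet.map_equiv (ordBasis o F) (ordBasis o F) hN
    (fun j => coupledScale d i c t j) (fun j y => coupledD_coupledScale i c a t j y) hx
  have hdet : ∀ j, (ordBasis o F j).det (fun m => coupledScale d i c t j (ordBasis o F j m)) =
      ((c ^ (-scaleCount d i t j) : Fˣ) : F) := by
    intro j
    have : (fun m => coupledScale d i c t j (ordBasis o F j m)) = fun m =>
        ((scaleFactor i c t j ((o j).symm m) : Fˣ) : F) • ordBasis o F j m := by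
      funext m
      rw [ordBasis, Module.Basis.reindex_apply, coupledScale_basis]
    rw [this, AlternatingMap.map_smul_univ, Module.Basis.det_self,
      smul_eq_mul, mul_one, ← prod_scaleFactor, Units.coe_prod]
    exact Equiv.prod_comp (o j).symm (fun x => ((scaleFactor i c t j x : Fˣ) : F))
  have hfin : ∏ᶠ j : ℤ, (ordBasis o F (j + 1)).det
      (fun m => coupledScale d i c t (j + 1) (ordBasis o F (j + 1) m)) ^
        ((j + 1).negOnePow : ℤ) = (c : F) ^ resDeg d i := by
    simp only [hdet]
    rw [finprod_int_add_one (fun j => (((c ^ (-scaleCount d i t j) : Fˣ) : F)) ^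
      (j.negOnePow : ℤ))]
    have hsub : (Function.mulSupport fun j : ℤ => (((c ^ (-scaleCount d i t j) : Fˣ) : F)) ^
        (j.negOnePow : ℤ)) ⊆ (Finset.Icc (-(n : ℤ) - 1) n ∪ hN.toFinset : Finset ℤ) := by
      intro j hj
      rw [Finset.coe_union]
      refine Or.inr ?_
      rw [Finset.mem_coe, Set.Finite.mem_toFinset, Set.mem_ofPred_eq]
      intro h0
      refine hj ?_
      have : IsEmpty (CoupledIdx d t j) := Fintype.card_eq_zero_iff.1 h0
      beta_reduce
      rw [← prod_scaleFactor, Finset.univ_eq_empty, Finset.prod_empty]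
      simp
    rw [finprod_eq_prod_of_mulSupport_subset _ hsub]
    have e : ∀ j : ℤ, (((c ^ (-scaleCount d i t j) : Fˣ) : F)) ^ (j.negOnePow : ℤ) =
        ((c ^ (-scaleCount d i t j * (j.negOnePow : ℤ)) : Fˣ) : F) := by
      intro j
      rw [zpow_mul]
      push_cast
      rfl
    simp only [e]
    rw [← Units.coe_prod, prod_zpow_eq_zpow_sum]
    simp only [neg_mul]
    rw [Finset.sum_neg_distrib, sum_scaleCount d hd i t Finset.subset_union_left, neg_neg,
      zpow_natCast, Units.val_pow_eq_pow_val]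
  rwa [hfin] at h

end Scaling

/-! ### The ideal of the coefficients of systems with a common zero -/

section Evaluation

variable {R : Type*} [CommRing R] {R' : Type*} [CommRing R'] {n : ℕ} {d : Fin n → ℕ}

/-- The specialization of the generic coefficients to `a`. -/
def evalAt (a : Coeffs d → R) : CoeffRing d →+* R := eval₂Hom (Int.castRingHom R) a

@[simp]
theorem evalAt_X (a : Coeffs d → R) (c : Coeffs d) : evalAt a (X c) = a c := eval₂Hom_X' _ _ _

theorem evalAt_comp_generic (a : Coeffs d → R) : evalAt a ∘ generic d = a :=
  funext fun c => evalAt_X a c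

theorem eq_evalAt (φ : CoeffRing d →+* R) : φ = evalAt (φ ∘ generic d) :=
  MvPolynomial.ringHom_ext (fun r => by simp) fun c => by simp [generic]

theorem map_evalAt (ρ : R →+* R') (a : Coeffs d → R) (x : CoeffRing d) :
    ρ (evalAt a x) = evalAt (ρ ∘ a) x := by
  have h := eq_evalAt (ρ.comp (evalAt a))
  have h' : (ρ.comp (evalAt a)) ∘ generic d = ρ ∘ a := by
    funext c
    simp [generic]
  rw [h'] at h
  exact RingHom.congr_fun h x

/-- `evalAt` is used in place of `aeval`, so that no `ℤ`-algebra structure has to be carried along.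
-/
theorem aeval_eq_evalAt [Algebra ℤ R] (a : Coeffs d → R) (x : CoeffRing d) :
    aeval a x = evalAt a x := by
  rw [aeval_def, evalAt, coe_eval₂Hom]
  congr 1
  exact RingHom.ext_int _ _

theorem eval_poly (a : Coeffs d → R) (p : Fin n → R) (i : Fin n) :
    eval p (poly a i) = ∑ α : Mon n (d i), a ⟨i, α⟩ * ∏ l, p l ^ α.1 l := by
  rw [poly, map_sum]
  refine Finset.sum_congr rfl fun α _ => ?_
  rw [eval_monomial, Finsupp.prod_fintype _ _ fun l => pow_zero _]

theorem map_eval_poly (ρ : R →+* R') (a : Coeffs d → R) (p : Fin n → R) (i : Fin n) :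
    eval (ρ ∘ p) (poly (ρ ∘ a) i) = ρ (eval p (poly a i)) := by
  simp [eval_poly]

theorem eval_smul_poly (a : Coeffs d → R) (c : R) (p : Fin n → R) (i : Fin n) :
    eval (c • p) (poly a i) = c ^ d i * eval p (poly a i) := by
  rw [eval_poly, eval_poly, Finset.mul_sum]
  refine Finset.sum_congr rfl fun α _ => ?_
  have h : ∑ l, α.1 l = d i := by
    have : (α.1.degree : ℤ) = d i := α.2
    rw [← Finsupp.degree_eq_sum]
    exact_mod_cast this
  simp only [Pi.smul_apply, smul_eq_mul, mul_pow]
  rw [Finset.prod_mul_distrib, Finset.prod_pow_eq_pow_sum, h]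
  ring

/-- The coefficients `a` have the common zero `p ≠ 0`. -/
def HasZero (a : Coeffs d → R) : Prop := ∃ p : Fin n → R, p ≠ 0 ∧ ∀ i, eval p (poly a i) = 0

/-- Every system of homogeneous polynomials of degrees `d_i` comes from coefficients. -/
theorem exists_poly_eq {f : Fin n → MvPolynomial (Fin n) R} (hf : ∀ i, f i ∈ S R n (d i)) :
    poly (fun c : Coeffs d => coeff c.2.1 (f c.1)) = f := by
  classical
  funext i
  ext γ
  rw [poly, coeff_sum]
  simp only [coeff_monomial]
  by_cases h : (γ.degree : ℤ) = d i
  · rw [Finset.sum_eq_single (⟨γ, h⟩ : Mon n (d i))]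
    · simp
    · intro α _ hα
      rw [if_neg fun h' => hα (Subtype.ext h')]
    · simp
  · rw [Finset.sum_eq_zero fun α _ => if_neg fun h' => h (by rw [← h']; exact α.2)]
    by_contra hne
    exact h (mem_S.1 (hf i) γ (Ne.symm hne))

end Evaluation

section Chart

variable {n : ℕ} (d : Fin n → ℕ) (l : Fin n)

/-- The general point of the chart `p_l = 1` of projective space. -/
def chart : Fin n → MvPolynomial (Fin n) (CoeffRing d) := fun m => if m = l then 1 else X m

/-- The general coefficients with a common zero at the general point of a chart: the coefficients
of the powers `X_l^{d_i}` of the generic coefficients are changed. -/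
def chartCoeffs : Coeffs d → MvPolynomial (Fin n) (CoeffRing d) := fun c =>
  C (X c) - if c.2.1 = Finsupp.single l (d c.1) then
    eval (chart d l) (poly (fun c : Coeffs d => C (X c)) c.1) else 0

/-- The chart point is a common zero: the coefficient of `X_l^{d_i}`, a monomial with the value `1`
at this point, is corrected by the value of the generic polynomial. -/
theorem eval_chart (i : Fin n) : eval (chart d l) (poly (chartCoeffs d l) i) = 0 := by
  classical
  have hdeg : (Finsupp.single l (d i)) ∈ monSet n (d i) := by
    change ((Finsupp.single l (d i)).degree : ℤ) = d i
    simp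
  rw [eval_poly]
  simp only [chartCoeffs, sub_mul, ite_mul, zero_mul, Finset.sum_sub_distrib]
  rw [← eval_poly (fun c : Coeffs d => (C (X c) : MvPolynomial (Fin n) (CoeffRing d))),
    Finset.sum_eq_single (⟨Finsupp.single l (d i), hdeg⟩ : Mon n (d i))]
  · rw [if_pos rfl, Finset.prod_eq_one, mul_one, sub_self]
    intro m _
    by_cases h : m = l
    · simp [chart, h]
    · simp [Ne.symm h]
  · intro α _ hα
    rw [if_neg fun h => hα (Subtype.ext h)]
  · simp

/-- The ideal of the polynomials in the coefficients which vanish if there is a common zero in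
a chart; it does not depend on the chart (see `resIdeal_le`). -/
def resIdeal : Ideal (CoeffRing d) := RingHom.ker (evalAt (chartCoeffs d l))

instance : (resIdeal d l).IsPrime := RingHom.ker_isPrime _

variable {d l}

/-- Every system with a common zero `p` such that `p_l ≠ 0` is a specialization of the general one,
after scaling `p` to `p_l = 1`. -/
theorem evalAt_eq_zero_of_apply_ne {F : Type*} [Field F] {a : Coeffs d → F} {p : Fin n → F}
    (hp : p l ≠ 0) (h : ∀ i, eval p (poly a i) = 0) {x : CoeffRing d} (hx : x ∈ resIdeal d l) :
    evalAt a x = 0 := by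
  let q : Fin n → F := (p l)⁻¹ • p
  have hq : ∀ i, eval q (poly a i) = 0 := fun i => by rw [eval_smul_poly, h, mul_zero]
  have hql : q l = 1 := inv_mul_cancel₀ hp
  let ρ : MvPolynomial (Fin n) (CoeffRing d) →+* F := eval₂Hom (evalAt a) q
  have hρ : ρ ∘ chart d l = q := by
    funext m
    by_cases hm : m = l
    · simp [chart, hm, hql]
    · simp [chart, hm, ρ]
  have hρa : (ρ ∘ fun c : Coeffs d => C (X c)) = a := by
    funext c
    simp [ρ]
  have hρc : ρ ∘ chartCoeffs d l = a := by
    funext c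
    have h1 : ρ (eval (chart d l) (poly (fun c : Coeffs d => C (X c)) c.1)) = 0 := by
      rw [← map_eval_poly, hρ, hρa, hq]
    have h2 : ρ (C (X c)) = a c := congrFun hρa c
    rw [Function.comp_apply, chartCoeffs, map_sub, h2]
    split_ifs
    · rw [h1, sub_zero]
    · rw [map_zero, sub_zero]
  rw [← hρc, ← map_evalAt, (RingHom.mem_ker).1 hx, map_zero]

/-- The general point of one chart lies in all the other charts. -/
theorem resIdeal_le (l m : Fin n) : resIdeal d l ≤ resIdeal d m := by
  intro x hx
  let ρ := algebraMap (MvPolynomial (Fin n) (CoeffRing d))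
    (FractionRing (MvPolynomial (Fin n) (CoeffRing d)))
  have hρ : Function.Injective ρ := IsFractionRing.injective _ _
  have h := evalAt_eq_zero_of_apply_ne (a := ρ ∘ chartCoeffs d m) (p := ρ ∘ chart d m) (l := l)
    (by
      rw [Function.comp_apply, Ne, map_eq_zero_iff ρ hρ, chart]
      split_ifs
      · exact one_ne_zero
      · exact X_ne_zero l)
    (fun i => by rw [map_eval_poly, eval_chart, map_zero]) hx
  rw [← map_evalAt, map_eq_zero_iff ρ hρ] at h
  exact h

/-- The elements of `resIdeal` vanish at the coefficients of systems with a common zero. -/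
theorem evalAt_eq_zero {F : Type*} [Field F] {a : Coeffs d → F} (h : HasZero a)
    {x : CoeffRing d} (hx : x ∈ resIdeal d l) : evalAt a x = 0 := by
  obtain ⟨p, hp, h⟩ := h
  obtain ⟨m, hm⟩ := Function.ne_iff.1 hp
  exact evalAt_eq_zero_of_apply_ne hm h (resIdeal_le l m hx)

variable (d l)

/-- Over the algebraic closure of a field of fractions there are coefficients with a common zero
which annihilate nothing but `resIdeal`. -/
theorem exists_hasZero : ∃ (K : Type) (_ : Field K) (_ : IsAlgClosed K) (a : Coeffs d → K),
    HasZero a ∧ ∀ x, evalAt a x = 0 → x ∈ resIdeal d l := by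
  let B := MvPolynomial (Fin n) (CoeffRing d)
  let ρ : B →+* AlgebraicClosure (FractionRing B) :=
    (algebraMap (FractionRing B) (AlgebraicClosure (FractionRing B))).comp
      (algebraMap B (FractionRing B))
  have hρ : Function.Injective ρ :=
    (RingHom.injective (algebraMap (FractionRing B) _)).comp
      (IsFractionRing.injective B (FractionRing B))
  refine ⟨AlgebraicClosure (FractionRing B), inferInstance, inferInstance, ρ ∘ chartCoeffs d l,
    ⟨ρ ∘ chart d l, fun h => ?_, fun i => ?_⟩, fun x hx => ?_⟩
  · have := congrFun h l
    simp [chart] at this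
  · rw [map_eval_poly, eval_chart, map_zero]
  · rw [← map_evalAt, map_eq_zero_iff ρ hρ] at hx
    exact hx

variable {d}

/-- Every prime ideal of the ring of coefficients is the kernel of a specialization to an
algebraically closed field. -/
theorem exists_evalAt_eq_zero_iff (P : Ideal (CoeffRing d)) [P.IsPrime] :
    ∃ (K : Type) (_ : Field K) (_ : IsAlgClosed K) (a : Coeffs d → K),
      ∀ x, evalAt a x = 0 ↔ x ∈ P := by
  let B := CoeffRing d ⧸ P
  let ρ : B →+* AlgebraicClosure (FractionRing B) :=
    (algebraMap (FractionRing B) (AlgebraicClosure (FractionRing B))).comp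
      (algebraMap B (FractionRing B))
  have hρ : Function.Injective ρ :=
    (RingHom.injective (algebraMap (FractionRing B) _)).comp
      (IsFractionRing.injective B (FractionRing B))
  refine ⟨AlgebraicClosure (FractionRing B), inferInstance, inferInstance,
    (ρ.comp (Ideal.Quotient.mk P)) ∘ generic d, fun x => ?_⟩
  rw [← eq_evalAt, RingHom.comp_apply, map_eq_zero_iff ρ hρ, Ideal.Quotient.eq_zero_iff_mem]

end Chart

/-! ### The determinant as a power of a prime element -/

section Power

variable {n : ℕ} {d : Fin n → ℕ}

theorem realizes_evalAt {t : ℤ} (o : ∀ j : ℤ, CoupledIdx d t j ≃ Fin (coupledRank d t j))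
    {F : Type*} [Field F] (a : Coeffs d → F) :
    Realizes (genericMatrix o) (evalAt a) (coupledD a t) (ordBasis o F) := by
  have h := realizes_comp o (evalAt a)
  rwa [evalAt_comp_generic] at h

/-- The coefficients of `X_1^{d_1}, …, X_n^{d_n}` have no common zero. -/
theorem not_hasZero_powerCoeffs (hd : ∀ i, 1 ≤ d i) (F : Type*) [Field F] :
    ¬ HasZero (fun c : Coeffs d => (powerCoeffs d c : F)) := by
  classical
  rintro ⟨p, hp, h⟩
  refine hp (funext fun i => ?_)
  have hi := h i
  have hdeg : (Finsupp.single i (d i)) ∈ monSet n (d i) := by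
    change ((Finsupp.single i (d i)).degree : ℤ) = d i
    simp
  rw [eval_poly, Finset.sum_eq_single (⟨Finsupp.single i (d i), hdeg⟩ : Mon n (d i))] at hi
  · rw [Finset.prod_eq_single i] at hi
    · simp only [powerCoeffs, if_true, Int.cast_one, one_mul, Finsupp.single_eq_same] at hi
      exact pow_eq_zero_iff (by have := hd i; omega) |>.1 hi
    · intro m _ hm
      simp [Ne.symm hm]
    · simp
  · intro α _ hα
    rw [powerCoeffs, if_neg fun h => hα (Subtype.ext h), Int.cast_zero, zero_mul]
  · simp

variable (hd : ∀ i, 1 ≤ d i) {t : ℕ}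
  (o : ∀ j : ℤ, CoupledIdx d t j ≃ Fin (coupledRank d t j))

/-- If the complex of a specialization is exact, then the determinant of the generic complex is
a fraction which specializes to the determinant of the specialization. -/
theorem exists_fraction {F : Type*} [Field F] {a : Coeffs d → F}
    (ha : IsExactComplex (coupledD a t)) :
    IsExactComplex (coupledD (genericFrac d) t) ∧
    ∃ x y : CoeffRing d, evalAt a x ≠ 0 ∧ evalAt a y ≠ 0 ∧
      IsComplexDet (coupledD a t) (ordBasis o F) (evalAt a x / evalAt a y) ∧
      IsComplexDet (coupledD (genericFrac d) t) (ordBasis o _)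
        (algebraMap _ (FractionRing (CoeffRing d)) x / algebraMap _ _ y) :=
  (realizes_evalAt o a).specialize (coupledRank_finite d t) ha
    (IsFractionRing.injective (CoeffRing d) _) (realizes_genericFrac o)

include hd in
/-- The determinant of the generic complex exists since the complex of `X_1^{d_1}, …, X_n^{d_n}` is
exact. -/
theorem exists_isComplexDet : ∃ x : FractionRing (CoeffRing d), x ≠ 0 ∧
    IsComplexDet (coupledD (genericFrac d) t) (ordBasis o _) x := by
  have h := (isExactComplex_iff hd (fun c : Coeffs d => (powerCoeffs d c : AlgebraicClosure ℚ))
    t).2 (not_hasZero_powerCoeffs hd _)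
  obtain ⟨-, x, y, hx, hy, -, h⟩ := exists_fraction o h
  have hi := IsFractionRing.injective (CoeffRing d) (FractionRing (CoeffRing d))
  refine ⟨_, div_ne_zero ?_ ?_, h⟩
  · rw [Ne, map_eq_zero_iff _ hi]
    rintro rfl
    exact hx (map_zero _)
  · rw [Ne, map_eq_zero_iff _ hi]
    rintro rfl
    exact hy (map_zero _)

theorem genericDet_unique {x y : FractionRing (CoeffRing d)}
    (hx : IsComplexDet (coupledD (genericFrac d) t) (ordBasis o _) x)
    (hy : IsComplexDet (coupledD (genericFrac d) t) (ordBasis o _) y) : x = y :=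
  hx.unique _ (coupledRank_finite d t) (fun j x => coupledD_coupledD _ _ j x) hy

include hd in
/-- The ideal `resIdeal` is not zero: the complex is exact at `X_1^{d_1}, …, X_n^{d_n}`, so it would
be exact at the general coefficients with a common zero if these satisfied no relation. -/
theorem exists_prime_mem (l : Fin n) : ∃ q ∈ resIdeal d l, Prime q := by
  refine Ideal.IsPrime.exists_mem_prime_of_ne_bot inferInstance fun hbot => ?_
  obtain ⟨K, _, _, a, hz, ha⟩ := exists_hasZero d l
  have hinj : Function.Injective (evalAt a) := (injective_iff_map_eq_zero _).2 fun x hx => by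
    have := ha x hx
    rwa [hbot] at this
  have hex := (isExactComplex_iff hd (fun c : Coeffs d => (powerCoeffs d c : AlgebraicClosure ℚ))
    0).2 (not_hasZero_powerCoeffs hd _)
  have h := (realizes_evalAt (fun j => Fintype.equivFin _) _).specialize (coupledRank_finite d 0)
    hex hinj (realizes_evalAt (fun j => Fintype.equivFin _) a)
  exact (isExactComplex_iff hd a 0).1 h.1 hz

theorem eq_one_or_neg_one_of_isUnit {u : CoeffRing d} (hu : IsUnit u) :
    ∃ z : ℤˣ, u = ((z : ℤ) : CoeffRing d) := by
  obtain ⟨r, ⟨z, rfl⟩, rfl⟩ := isUnit_iff_eq_C_of_isReduced.1 hu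
  exact ⟨z, by simp⟩

theorem exists_eq_unit_mul_pow {B : Type*} [CommRing B] [IsDomain B] [UniqueFactorizationMonoid B]
    {q u : B} (hq : Prime q) (hu : u ≠ 0) (h : ∀ p, Prime p → p ∣ u → Associated p q) :
    ∃ (e : ℕ) (ε : Bˣ), u = ε * q ^ e := by
  obtain ⟨e, c, hc, rfl⟩ := WfDvdMonoid.max_power_factor hu hq.irreducible
  have hc0 : c ≠ 0 := right_ne_zero_of_mul hu
  have : IsUnit c := by
    by_contra hcu
    obtain ⟨p, hp, hpc⟩ := WfDvdMonoid.exists_irreducible_factor hcu hc0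
    exact hc ((h p hp.prime (hpc.mul_left _)).symm.dvd.trans hpc)
  obtain ⟨ε, rfl⟩ := this
  exact ⟨e, ε, mul_comm _ _⟩

include hd in
/-- The determinant of the generic complex is a power of a prime element, up to sign: along every
other prime divisor the complex is exact, because the prime ideal of the coefficients of systems
with a common zero is not contained in the corresponding ideal. -/
theorem exists_eq_zpow {l : Fin n} {q : CoeffRing d} (hq : Prime q) (hql : q ∈ resIdeal d l) :
    ∃ (z : ℤˣ) (m : ℤ), IsComplexDet (coupledD (genericFrac d) t) (ordBasis o _)
      (((z : ℤ) : FractionRing (CoeffRing d)) *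
        algebraMap _ (FractionRing (CoeffRing d)) q ^ m) := by
  obtain ⟨D, hD0, hD⟩ := exists_isComplexDet hd o
  obtain ⟨u, v, hrel, hD'⟩ := IsFractionRing.exists_reduced_fraction (A := CoeffRing d) D
  have hi := IsFractionRing.injective (CoeffRing d) (FractionRing (CoeffRing d))
  have hv0 : (v : CoeffRing d) ≠ 0 := nonZeroDivisors.coe_ne_zero v
  rw [IsFractionRing.mk'_eq_div] at hD'
  have hu0 : u ≠ 0 := by
    rintro rfl
    exact hD0 (by rw [← hD', map_zero, zero_div])
  have key : ∀ p : CoeffRing d, Prime p → p ∣ u ∨ p ∣ v → Associated p q := by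
    intro p hp hpuv
    have hprime : (Ideal.span {p}).IsPrime := (Ideal.span_singleton_prime hp.ne_zero).2 hp
    obtain ⟨K, _, _, a, ha⟩ := exists_evalAt_eq_zero_iff (Ideal.span {p})
    simp only [Ideal.mem_span_singleton] at ha
    by_cases hz : HasZero a
    · exact hp.associated_of_dvd hq ((ha q).1 (evalAt_eq_zero hz hql))
    · exfalso
      obtain ⟨-, x, y, hx, hy, -, h⟩ := exists_fraction o ((isExactComplex_iff hd a t).2 hz)
      have h1 := genericDet_unique o h hD
      have hy0 : y ≠ 0 := by
        rintro rfl
        exact hy (map_zero _)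
      rw [← hD', div_eq_div_iff (by rwa [Ne, map_eq_zero_iff _ hi])
        (by rwa [Ne, map_eq_zero_iff _ hi]), ← map_mul, ← map_mul] at h1
      have h2 := hi h1
      have hux : ¬ p ∣ x := fun h => hx ((ha x).2 h)
      have huy : ¬ p ∣ y := fun h => hy ((ha y).2 h)
      -- the fraction `u / v = x / y` is a unit at `p`
      have hboth : p ∣ u ∧ p ∣ v := by
        rcases hpuv with h | h
        · exact ⟨h, (hp.dvd_or_dvd (h2 ▸ h.mul_right y : p ∣ x * v)).resolve_left hux⟩
        · exact ⟨(hp.dvd_or_dvd (h2 ▸ h.mul_left x : p ∣ u * y)).resolve_right huy, h⟩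
      exact hp.not_isUnit (hrel hboth.1 hboth.2)
  obtain ⟨e, ε, he⟩ := exists_eq_unit_mul_pow hq hu0 fun p hp h => key p hp (Or.inl h)
  obtain ⟨e', ε', he'⟩ := exists_eq_unit_mul_pow hq hv0 fun p hp h => key p hp (Or.inr h)
  obtain ⟨z, hz⟩ := eq_one_or_neg_one_of_isUnit (d := d) (ε * ε'⁻¹).isUnit
  refine ⟨z, (e : ℤ) - e', ?_⟩
  convert hD using 1
  have hq0 : algebraMap _ (FractionRing (CoeffRing d)) q ≠ 0 := by
    rw [Ne, map_eq_zero_iff _ hi]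
    exact hq.ne_zero
  have hz' : ((z : ℤ) : FractionRing (CoeffRing d)) =
      algebraMap _ _ (ε : CoeffRing d) / algebraMap _ _ (ε' : CoeffRing d) := by
    have hε' : algebraMap _ (FractionRing (CoeffRing d)) (ε' : CoeffRing d) ≠ 0 := by
      rw [Ne, map_eq_zero_iff _ hi]
      exact ε'.ne_zero
    rw [eq_div_iff hε', ← map_intCast (algebraMap (CoeffRing d) (FractionRing (CoeffRing d))),
      ← hz, ← map_mul]
    congr 1
    rw [Units.val_mul, mul_assoc, Units.inv_mul, mul_one]
  rw [← hD', he, he', hz', zpow_sub₀ hq0, zpow_natCast, zpow_natCast, map_mul, map_mul, map_pow,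
    map_pow, mul_div_mul_comm]

variable {o}

/-- The determinants of the exact specializations. -/
theorem isComplexDet_evalAt {q : CoeffRing d} (hq : q ≠ 0) {z : ℤˣ} {m : ℤ}
    (hD : IsComplexDet (coupledD (genericFrac d) t) (ordBasis o _)
      (((z : ℤ) : FractionRing (CoeffRing d)) * algebraMap _ (FractionRing (CoeffRing d)) q ^ m))
    {F : Type*} [Field F] {a : Coeffs d → F} (ha : IsExactComplex (coupledD a t)) :
    IsComplexDet (coupledD a t) (ordBasis o F) (((z : ℤ) : F) * evalAt a q ^ m) ∧
      (m ≠ 0 → evalAt a q ≠ 0) := by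
  have hi := IsFractionRing.injective (CoeffRing d) (FractionRing (CoeffRing d))
  obtain ⟨-, x, y, hx, hy, h, h'⟩ := exists_fraction o ha
  have h1 := genericDet_unique o h' hD
  have hy0 : algebraMap _ (FractionRing (CoeffRing d)) y ≠ 0 := by
    rw [Ne, map_eq_zero_iff _ hi]
    rintro rfl
    exact hy (map_zero _)
  have hq0 : algebraMap _ (FractionRing (CoeffRing d)) q ≠ 0 := by
    rwa [Ne, map_eq_zero_iff _ hi]
  rw [div_eq_iff hy0] at h1
  obtain ⟨e, rfl | rfl⟩ := m.eq_nat_or_neg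
  · rw [zpow_natCast, ← map_intCast (algebraMap (CoeffRing d) (FractionRing (CoeffRing d))),
      ← map_pow, ← map_mul, ← map_mul] at h1
    have h2 := hi h1
    have h3 := congrArg (evalAt a) h2
    rw [map_mul, map_mul, map_pow, map_intCast] at h3
    rw [h3, mul_div_cancel_right₀ _ hy] at h
    refine ⟨by rwa [zpow_natCast], fun hm h0 => hx ?_⟩
    rw [h3, h0, zero_pow (by exact_mod_cast hm), mul_zero, zero_mul]
  · have h2 : algebraMap _ (FractionRing (CoeffRing d)) (x * q ^ e) =
        algebraMap _ (FractionRing (CoeffRing d)) (((z : ℤ) : CoeffRing d) * y) := by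
      rw [map_mul, h1, map_pow, map_mul, map_intCast, zpow_neg, zpow_natCast]
      field_simp
    have h3 := congrArg (evalAt a) (hi h2)
    rw [map_mul, map_mul, map_pow, map_intCast] at h3
    have hz : ((z : ℤ) : F) ≠ 0 := by
      rcases Int.units_eq_one_or z with rfl | rfl <;> simp
    have hne : evalAt a q ^ e ≠ 0 := fun h0 => by
      rw [h0, mul_zero] at h3
      exact mul_ne_zero hz hy h3.symm
    refine ⟨?_, fun hm => ?_⟩
    · convert h using 1
      rw [zpow_neg, zpow_natCast, eq_div_iff hy, mul_right_comm, ← h3, mul_inv_cancel_right₀ hne]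
    · have he : e ≠ 0 := by
        rintro rfl
        simp at hm
      exact (pow_ne_zero_iff he).1 hne

end Power

/-! ### The exponent is one -/

section Polynomials

variable {F : Type*} [Field F] [Infinite F]

theorem polynomial_eq_of_eval_ne_zero {p q : Polynomial F}
    (h : ∀ c ≠ 0, p.eval c = q.eval c) : p = q := by
  refine mul_left_cancel₀ (Polynomial.X_ne_zero (R := F)) (Polynomial.funext fun c => ?_)
  by_cases hc : c = 0
  · simp [hc]
  · simp [h c hc]

/-- If `G(τ)^m = H(1/τ)^m τ^e`, then the degree of `H^m` is at most `e`. -/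
theorem mul_natDegree_le {G H : Polynomial F} (hH : H ≠ 0) {m e : ℕ}
    (h : ∀ τ ≠ 0, G.eval τ ^ m = H.eval τ⁻¹ ^ m * τ ^ e) : m * H.natDegree ≤ e := by
  by_contra! hlt
  -- otherwise the reverse of `H`, whose value at `0` is the leading coefficient of `H`, would be
  -- divisible by the variable
  have key : Polynomial.X ^ (m * H.natDegree - e) * G ^ m = H.reverse ^ m := by
    refine polynomial_eq_of_eval_ne_zero fun τ hτ => ?_
    have : Invertible τ⁻¹ := invertibleOfNonzero (inv_ne_zero hτ)
    have h1 := Polynomial.eval₂_reverse_mul_pow (RingHom.id F) τ⁻¹ H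
    rw [invOf_eq_inv, inv_inv] at h1
    change H.reverse.eval τ * _ = H.eval τ⁻¹ at h1
    simp only [Polynomial.eval_mul, Polynomial.eval_pow, Polynomial.eval_X]
    rw [h τ hτ, ← h1, mul_pow, ← pow_mul, mul_comm H.natDegree m, mul_comm, mul_assoc, mul_assoc,
      ← pow_add, Nat.add_sub_cancel' hlt.le, inv_pow, inv_mul_cancel₀ (pow_ne_zero _ hτ), mul_one]
  have h0 := congrArg (Polynomial.eval 0) key
  simp only [Polynomial.eval_mul, Polynomial.eval_pow, Polynomial.eval_X] at h0
  rw [zero_pow (by omega), zero_mul, ← Polynomial.coeff_zero_eq_eval_zero,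
    Polynomial.coeff_zero_reverse] at h0
  exact pow_ne_zero m (Polynomial.leadingCoeff_ne_zero.2 hH) h0.symm

end Polynomials

section Exponent

variable {n : ℕ} {d : Fin n → ℕ}

theorem hasZero_scaleAt {F : Type*} [Field F] {i : Fin n} {c : F} (hc : c ≠ 0)
    {a : Coeffs d → F} : HasZero (scaleAt i c a) ↔ HasZero a := by
  refine exists_congr fun p => and_congr_right fun _ => forall_congr' fun l => ?_
  rw [poly_scaleAt, map_mul, eval_C]
  split_ifs <;> simp [hc]

variable (hd : ∀ i, 1 ≤ d i) {t : ℕ}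
  {o : ∀ j : ℤ, CoupledIdx d t j ≃ Fin (coupledRank d t j)} {q : CoeffRing d} {z : ℤˣ} {m : ℤ}

include hd in
/-- The `m`-th power of `q` is homogeneous of degree `∏_{l ≠ i} d_l` in the coefficients of `f_i`,
as the determinant is. -/
theorem evalAt_scaleAt_zpow (hq : q ≠ 0)
    (hD : IsComplexDet (coupledD (genericFrac d) t) (ordBasis o _)
      (((z : ℤ) : FractionRing (CoeffRing d)) * algebraMap _ (FractionRing (CoeffRing d)) q ^ m))
    {F : Type*} [Field F] [IsAlgClosed F] {a : Coeffs d → F} (ha : ¬ HasZero a) (i : Fin n)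
    {c : F} (hc : c ≠ 0) :
    evalAt (scaleAt i c a) q ^ m = evalAt a q ^ m * c ^ resDeg d i := by
  have h1 := (isComplexDet_evalAt hq hD ((isExactComplex_iff hd a t).2 ha)).1
  have h2 := (isComplexDet_evalAt hq hD ((isExactComplex_iff hd (scaleAt i c a) t).2
    ((hasZero_scaleAt hc).not.2 ha))).1
  have h3 := h2.unique _ (coupledRank_finite d t) (fun j x => coupledD_coupledD _ _ j x)
    (IsComplexDet.scaleAt hd o i (Units.mk0 c hc) a h1)
  have hz : ((z : ℤ) : F) ≠ 0 := by
    rcases Int.units_eq_one_or z with rfl | rfl <;> simp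
  rw [mul_assoc] at h3
  exact mul_left_cancel₀ hz h3

theorem resDeg_pos (hd : ∀ i, 1 ≤ d i) (i : Fin n) : 0 < resDeg d i :=
  Finset.prod_pos fun l _ => hd l

include hd in
/-- If `m ≤ 0`, then the polynomial `c ↦ q(f_1, …, c f_i, …, f_n)^{-m} c^e`, where
`e = ∏_{l ≠ i} d_l`, is a non-zero constant for `f = (X_1^{d_1}, …, X_n^{d_n})`, although it
vanishes at `c = 0`. -/
theorem exponent_pos (i : Fin n) (hq : q ≠ 0)
    (hD : IsComplexDet (coupledD (genericFrac d) t) (ordBasis o _)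
      (((z : ℤ) : FractionRing (CoeffRing d)) * algebraMap _ (FractionRing (CoeffRing d)) q ^ m)) :
    0 < m := by
  by_contra! hm
  obtain ⟨μ, rfl⟩ : ∃ μ : ℕ, m = -μ := ⟨(-m).toNat, by omega⟩
  let a : Coeffs d → ℂ := fun c => (powerCoeffs d c : ℂ)
  have ha : ¬ HasZero a := not_hasZero_powerCoeffs hd ℂ
  have hqa := (isComplexDet_evalAt hq hD ((isExactComplex_iff hd a t).2 ha)).2
  let h : Polynomial ℂ := evalAt (scaleAt i Polynomial.X (Polynomial.C ∘ a)) q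
  have hh : ∀ c, h.eval c = evalAt (scaleAt i c a) q := by
    intro c
    have e : (Polynomial.evalRingHom c) ∘ scaleAt i Polynomial.X (Polynomial.C ∘ a) =
        scaleAt i c a := by
      funext x
      simp only [Function.comp_apply, scaleAt]
      split_ifs <;> simp only [Polynomial.coe_evalRingHom, Polynomial.eval_mul,
        Polynomial.eval_X, Polynomial.eval_C, one_mul]
    rw [← e, ← map_evalAt]
    rfl
  have key : Polynomial.C (evalAt a q ^ μ) = h ^ μ * Polynomial.X ^ resDeg d i := by
    refine polynomial_eq_of_eval_ne_zero fun c hc => ?_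
    have h1 := evalAt_scaleAt_zpow hd hq hD ha i hc
    simp only [Polynomial.eval_mul, Polynomial.eval_pow, Polynomial.eval_X, Polynomial.eval_C, hh]
    rw [zpow_neg, zpow_neg, zpow_natCast, zpow_natCast] at h1
    rcases Nat.eq_zero_or_pos μ with rfl | hμ
    · simpa using h1
    · have hqa' := hqa (by omega)
      have hqs := (isComplexDet_evalAt hq hD ((isExactComplex_iff hd (scaleAt i c a) t).2
        ((hasZero_scaleAt hc).not.2 ha))).2 (by omega)
      field_simp at h1
      exact h1
  have h0 := congrArg (Polynomial.eval 0) key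
  simp only [Polynomial.eval_mul, Polynomial.eval_pow, Polynomial.eval_X, Polynomial.eval_C] at h0
  rw [zero_pow (resDeg_pos hd i).ne', mul_zero] at h0
  rcases Nat.eq_zero_or_pos μ with rfl | hμ
  · simp at h0
  · exact pow_ne_zero _ (hqa (by omega)) h0

theorem mem_S_of_isHomogeneous {R : Type*} [CommRing R] {p : MvPolynomial (Fin n) R} {m : ℕ}
    (hp : p.IsHomogeneous m) : p ∈ S R n m := by
  rw [mem_S]
  intro γ hγ
  have := hp hγ
  rw [Finsupp.degree_eq_weight_one]
  exact congrArg Nat.cast this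

include hd in
/-- There is a line in the space of coefficients, which varies `f_i` only, on which there are
`∏_{l ≠ i} d_l` coefficients with a common zero, but not only those: if
`f_l = ∏_{c < d_l} (X_l - c X_i)`, `l ≠ i`, and `f_i = X_i^{d_i - 1} (∑ θ_l X_l - s X_i)`, then
there is a common zero if and only if `s = ∑ θ_l c_l` for some digits `c_l < d_l`. -/
theorem exists_line (i : Fin n) : ∃ a₀ a₁ : Coeffs d → ℂ, (∀ c, c.1 ≠ i → a₁ c = 0) ∧
    (∀ k < resDeg d i, HasZero (fun c => a₀ c + (k : ℂ) * a₁ c)) ∧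
    ¬ HasZero (fun c => a₀ c + (-1) * a₁ c) := by
  classical
  let d' : Fin n → ℕ := fun l => if l = i then 1 else d l
  have hd' : ∏ l, d' l = resDeg d i := by
    rw [resDeg, ← Finset.mul_prod_erase Finset.univ d' (Finset.mem_univ i)]
    simp only [d', if_true, one_mul]
    exact Finset.prod_congr rfl fun l hl => if_neg (Finset.ne_of_mem_erase hl)
  -- the place values of the mixed radix system with the digits `c_l < d_l`, `l ≠ i`; the digit at
  -- `i` is `0`
  let θ : Fin n → ℕ := fun l => ∏ j : Fin l, d' (Fin.castLE l.is_lt.le j)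
  let f₀ : Fin n → MvPolynomial (Fin n) ℂ := fun l => if l = i then
      X i ^ (d i - 1) * ∑ m ∈ Finset.univ.erase i, C (θ m : ℂ) * X m
    else ∏ c ∈ Finset.range (d l), (X l - C (c : ℂ) * X i)
  let f₁ : Fin n → MvPolynomial (Fin n) ℂ := fun l => if l = i then C (-1) * X i ^ d i else 0
  have hf₀ : ∀ l, f₀ l ∈ S ℂ n (d l) := by
    intro l
    refine mem_S_of_isHomogeneous ?_
    by_cases hl : l = i
    · subst hl
      simp only [f₀, if_true]
      have h := ((isHomogeneous_X ℂ l).pow (d l - 1)).mul (IsHomogeneous.sum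
        (Finset.univ.erase l) (fun m => C (θ m : ℂ) * X m) 1
        fun m _ => (isHomogeneous_X ℂ m).C_mul _)
      have e : 1 * (d l - 1) + 1 = d l := by
        have := hd l
        omega
      rwa [e] at h
    · simp only [f₀, hl, if_false]
      have h := IsHomogeneous.prod (Finset.range (d l))
        (fun c : ℕ => (X l - C (c : ℂ) * X i : MvPolynomial (Fin n) ℂ)) (fun _ => 1)
        fun c _ => (isHomogeneous_X ℂ l).sub ((isHomogeneous_X ℂ i).C_mul _)
      simpa using h
  have hf₁ : ∀ l, f₁ l ∈ S ℂ n (d l) := by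
    intro l
    refine mem_S_of_isHomogeneous ?_
    by_cases hl : l = i
    · subst hl
      simp only [f₁, if_true]
      have h := ((isHomogeneous_X ℂ l).pow (d l)).C_mul (-1)
      rwa [one_mul] at h
    · simp only [f₁, hl, if_false]
      exact isHomogeneous_zero _ _ _
  have heval : ∀ (s : ℂ) (p : Fin n → ℂ) (l : Fin n),
      eval p (poly (fun c : Coeffs d => coeff c.2.1 (f₀ c.1) + s * coeff c.2.1 (f₁ c.1)) l) =
        eval p (f₀ l) + s * eval p (f₁ l) := by
    intro s p l
    conv_rhs => rw [← exists_poly_eq hf₀, ← exists_poly_eq hf₁]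
    simp only [eval_poly, add_mul, Finset.sum_add_distrib, Finset.mul_sum, mul_assoc]
  have heval_i : ∀ (s : ℂ) (p : Fin n → ℂ), eval p (f₀ i) + s * eval p (f₁ i) =
      p i ^ (d i - 1) * (∑ m ∈ Finset.univ.erase i, (θ m : ℂ) * p m - s * p i) := by
    intro s p
    have e : p i ^ d i = p i ^ (d i - 1) * p i := by
      rw [← pow_succ, Nat.sub_add_cancel (hd i)]
    simp only [f₀, f₁, if_true, map_mul, map_pow, eval_X, map_sum, eval_C]
    rw [e]
    ring
  have heval_l : ∀ (s : ℂ) (p : Fin n → ℂ) (l : Fin n), l ≠ i →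
      eval p (f₀ l) + s * eval p (f₁ l) = ∏ c ∈ Finset.range (d l), (p l - (c : ℂ) * p i) := by
    intro s p l hl
    simp only [f₀, f₁, hl, if_false, map_prod, map_sub, map_mul, eval_X, eval_C, map_zero,
      mul_zero, add_zero]
  refine ⟨fun c => coeff c.2.1 (f₀ c.1), fun c => coeff c.2.1 (f₁ c.1), fun c hc => ?_,
    fun k hk => ?_, ?_⟩
  · simp [f₁, hc]
  · let f := finPiFinEquiv.symm (⟨k, by rwa [hd']⟩ : Fin (∏ l, d' l))
    have hf : k = ∑ l, (f l : ℕ) * θ l := by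
      have := congrArg Fin.val
        (finPiFinEquiv.apply_symm_apply (⟨k, by rwa [hd']⟩ : Fin (∏ l, d' l)))
      rw [finPiFinEquiv_apply] at this
      exact this.symm
    have hfi : (f i : ℕ) = 0 := by
      have h := (f i).2
      simp only [d', if_true] at h
      omega
    refine ⟨fun l => if l = i then 1 else ((f l : ℕ) : ℂ), fun h => ?_, fun l => ?_⟩
    · have := congrFun h i
      simp at this
    · rw [heval]
      by_cases hl : l = i
      · subst hl
        rw [heval_i, if_pos rfl, hf, ← Finset.add_sum_erase _ _ (Finset.mem_univ l), hfi]
        push_cast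
        rw [zero_mul, zero_add, mul_one, sub_eq_zero.2, mul_zero]
        refine Finset.sum_congr rfl fun m hm => ?_
        rw [if_neg (Finset.ne_of_mem_erase hm), mul_comm]
      · rw [heval_l _ _ _ hl]
        have hlt : (f l : ℕ) < d l := by
          have h := (f l).2
          simp only [d', hl, if_false] at h
          exact h
        exact Finset.prod_eq_zero (Finset.mem_range.2 hlt) (by simp [hl])
  · rintro ⟨p, hp, h⟩
    have hl : ∀ l, l ≠ i → ∃ c : ℕ, p l = c * p i := by
      intro l hl
      have h1 := h l
      rw [heval, heval_l _ _ _ hl] at h1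
      obtain ⟨c, -, hc⟩ := Finset.prod_eq_zero_iff.1 h1
      exact ⟨c, sub_eq_zero.1 hc⟩
    have hpi : p i ≠ 0 := by
      intro h0
      refine hp (funext fun l => ?_)
      by_cases hli : l = i
      · rw [hli, h0, Pi.zero_apply]
      · obtain ⟨c, hc⟩ := hl l hli
        rw [hc, h0, mul_zero, Pi.zero_apply]
    choose! c hc using hl
    have h1 := h i
    rw [heval, heval_i] at h1
    have h2 := (mul_eq_zero.1 h1).resolve_left (pow_ne_zero _ hpi)
    -- at the parameter `s = -1` the equation `f_i = 0` reads `∑ θ_l c_l + 1 = 0`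
    have h3 : (((∑ m ∈ Finset.univ.erase i, θ m * c m + 1 : ℕ) : ℕ) : ℂ) * p i = 0 := by
      rw [← h2]
      push_cast
      rw [add_mul, Finset.sum_mul]
      have : ∑ m ∈ Finset.univ.erase i, (θ m : ℂ) * c m * p i =
          ∑ m ∈ Finset.univ.erase i, (θ m : ℂ) * p m :=
        Finset.sum_congr rfl fun m hm => by rw [hc m (Finset.ne_of_mem_erase hm), mul_assoc]
      rw [this]
      ring
    rcases mul_eq_zero.1 h3 with h4 | h4
    · exact absurd (Nat.cast_eq_zero.1 h4) (by omega)
    · exact hpi h4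

include hd in
/-- On the line of `exists_line`, the polynomial `q` has degree at most `e / m`, where
`e = ∏_{l ≠ i} d_l`, because `q^m` is homogeneous of degree `e` in the coefficients of `f_i`. It
has `e` different zeros there and does not vanish identically, so `m = 1`. -/
theorem exponent_eq_one {i : Fin n} (hq : q ≠ 0) (hqi : q ∈ resIdeal d i)
    (hD : IsComplexDet (coupledD (genericFrac d) t) (ordBasis o _)
      (((z : ℤ) : FractionRing (CoeffRing d)) * algebraMap _ (FractionRing (CoeffRing d)) q ^ m)) :
    m = 1 := by
  have hm := exponent_pos hd i hq hD
  obtain ⟨m, rfl⟩ := Int.eq_ofNat_of_zero_le hm.le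
  have hm' : m ≠ 0 := by
    rintro rfl
    exact lt_irrefl _ hm
  have hscale : ∀ (a : Coeffs d → ℂ) (c : ℂ), c ≠ 0 →
      evalAt (scaleAt i c a) q ^ m = evalAt a q ^ m * c ^ resDeg d i := by
    intro a c hc
    by_cases ha : HasZero a
    · rw [evalAt_eq_zero ha hqi, evalAt_eq_zero ((hasZero_scaleAt hc).2 ha) hqi,
        zero_pow hm', zero_mul]
    · have := evalAt_scaleAt_zpow hd hq hD ha i hc
      rwa [zpow_natCast, zpow_natCast] at this
  obtain ⟨a₀, a₁, h₁, hzero, hne⟩ := exists_line hd i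
  -- `H(s)` is the value of `q` at the point `s` of the line, and `G(τ)` its value after scaling
  -- `f_i` at the point `1 / τ` by `τ`, which is a polynomial in `τ`
  let H : Polynomial ℂ :=
    evalAt (fun c => Polynomial.C (a₀ c) + Polynomial.X * Polynomial.C (a₁ c)) q
  let G : Polynomial ℂ := evalAt (fun c => if c.1 = i then
    Polynomial.X * Polynomial.C (a₀ c) + Polynomial.C (a₁ c) else Polynomial.C (a₀ c)) q
  have hH : ∀ s, H.eval s = evalAt (fun c => a₀ c + s * a₁ c) q := by
    intro s
    change Polynomial.evalRingHom s H = _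
    rw [map_evalAt]
    congr 2
    funext c
    simp only [Function.comp_apply, Polynomial.coe_evalRingHom, Polynomial.eval_add,
      Polynomial.eval_mul, Polynomial.eval_X, Polynomial.eval_C]
  have hG : ∀ τ ≠ 0, G.eval τ = evalAt (scaleAt i τ (fun c => a₀ c + τ⁻¹ * a₁ c)) q := by
    intro τ hτ
    change Polynomial.evalRingHom τ G = _
    rw [map_evalAt]
    congr 2
    funext c
    simp only [Function.comp_apply, scaleAt]
    split_ifs with hc
    · simp only [Polynomial.coe_evalRingHom, Polynomial.eval_add, Polynomial.eval_mul,
        Polynomial.eval_X, Polynomial.eval_C]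
      field_simp
    · rw [h₁ c hc]
      simp
  have hH0 : H ≠ 0 := by
    intro h0
    have h2 := hH (-1)
    rw [h0, Polynomial.eval_zero] at h2
    exact (isComplexDet_evalAt hq hD ((isExactComplex_iff hd _ t).2 hne)).2 hm.ne' h2.symm
  have hle := mul_natDegree_le hH0 (m := m) (e := resDeg d i) (G := G) fun τ hτ => by
    rw [hG τ hτ, hH, hscale _ _ hτ]
  have hcard : resDeg d i ≤ H.natDegree := by
    have hinj : Function.Injective (fun k : ℕ => (k : ℂ)) := Nat.cast_injective
    have := Polynomial.card_le_degree_of_subset_roots (p := H)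
      (Z := (Finset.range (resDeg d i)).image fun k : ℕ => (k : ℂ)) fun s hs => by
        obtain ⟨k, hk, rfl⟩ := Finset.mem_image.1 (Finset.mem_def.2 hs)
        rw [Polynomial.mem_roots hH0, Polynomial.IsRoot.def, hH]
        exact evalAt_eq_zero (hzero k (Finset.mem_range.1 hk)) hqi
    rwa [Finset.card_image_of_injective _ hinj, Finset.card_range] at this
  have hpos := resDeg_pos hd i
  have : m * resDeg d i ≤ 1 * resDeg d i := by
    rw [one_mul]
    exact (Nat.mul_le_mul_left m hcard).trans hle
  have := Nat.le_of_mul_le_mul_right this hpos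
  have : m = 1 := by omega
  rw [this]
  rfl

end Exponent

/-! ### The resultant -/

section Resultant

variable {n : ℕ} {d : Fin n → ℕ} (hd : ∀ i, 1 ≤ d i) {i : Fin n}

include hd in
/-- The determinant of the generic complex is `± q` for any prime element `q` of `resIdeal`. -/
theorem exists_isComplexDet_eq {q : CoeffRing d} (hq : Prime q) (hqi : q ∈ resIdeal d i) {t : ℕ}
    (o : ∀ j : ℤ, CoupledIdx d t j ≃ Fin (coupledRank d t j)) :
    ∃ z : ℤˣ, IsComplexDet (coupledD (genericFrac d) t) (ordBasis o _)
      (((z : ℤ) : FractionRing (CoeffRing d)) *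
        algebraMap _ (FractionRing (CoeffRing d)) q ^ (1 : ℤ)) := by
  obtain ⟨z, m, h⟩ := exists_eq_zpow hd o hq hqi
  obtain rfl := exponent_eq_one hd hq.ne_zero hqi h
  exact ⟨z, h⟩

include hd in
/-- A prime element of `resIdeal` vanishes exactly at the systems with a common zero, since
elsewhere it is the determinant of an exact complex, up to sign. -/
theorem evalAt_eq_zero_iff {q : CoeffRing d} (hq : Prime q) (hqi : q ∈ resIdeal d i)
    {F : Type*} [Field F] [IsAlgClosed F] (a : Coeffs d → F) : evalAt a q = 0 ↔ HasZero a := by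
  refine ⟨fun h => ?_, fun h => evalAt_eq_zero h hqi⟩
  by_contra hz
  obtain ⟨z, hD⟩ := exists_isComplexDet_eq hd hq hqi (t := 0) fun j => Fintype.equivFin _
  exact (isComplexDet_evalAt hq.ne_zero hD ((isExactComplex_iff hd a 0).2 hz)).2 one_ne_zero h

include hd in
/-- The value of the resultant at `X_1^{d_1}, …, X_n^{d_n}` does not vanish modulo any prime
number. -/
theorem isUnit_evalAt_powerCoeffs {q : CoeffRing d} (hq : Prime q) (hqi : q ∈ resIdeal d i) :
    IsUnit (evalAt (powerCoeffs d) q) := by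
  rw [Int.isUnit_iff_natAbs_eq]
  by_contra h1
  obtain ⟨p, hp, hdvd⟩ := Nat.exists_prime_and_dvd h1
  have : Fact p.Prime := ⟨hp⟩
  have h2 : ((evalAt (powerCoeffs d) q : ℤ) : AlgebraicClosure (ZMod p)) = 0 :=
    (CharP.intCast_eq_zero_iff _ p _).2 (Int.natCast_dvd.2 hdvd)
  have h3 := map_evalAt (Int.castRingHom (AlgebraicClosure (ZMod p))) (powerCoeffs d) q
  rw [eq_intCast, h2] at h3
  exact not_hasZero_powerCoeffs hd _ ((evalAt_eq_zero_iff hd hq hqi _).1 h3.symm)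

include hd in
/-- A prime element of `resIdeal`, normalized by a sign, is the resultant. -/
theorem exists_isResultant (i : Fin n) : ∃ r, IsResultant d r := by
  obtain ⟨q, hqi, hq⟩ := exists_prime_mem hd i
  obtain ⟨z, hz⟩ := isUnit_evalAt_powerCoeffs hd hq hqi
  have hzu : IsUnit (((z : ℤ) : CoeffRing d)) := (z.isUnit).map (Int.castRingHom (CoeffRing d))
  have hr : Prime (((z : ℤ) : CoeffRing d) * q) :=
    (associated_unit_mul_left q _ hzu).symm.prime hq
  refine ⟨((z : ℤ) : CoeffRing d) * q, hr.irreducible, fun k _ _ a => ?_, ?_⟩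
  · rw [aeval_eq_evalAt]
    exact evalAt_eq_zero_iff hd hr (Ideal.mul_mem_left _ _ hqi) a
  · rw [aeval_eq_evalAt, map_mul, map_intCast, ← hz, Int.cast_id]
    rcases Int.units_eq_one_or z with rfl | rfl <;> simp

include hd in
theorem isResultant_resultant (i : Fin n) : IsResultant d (resultant d) := by
  rw [resultant, dif_pos (exists_isResultant hd i)]
  exact (exists_isResultant hd i).choose_spec

include hd in
theorem prime_resultant (i : Fin n) : Prime (resultant d) :=
  (isResultant_resultant hd i).irreducible.prime

include hd in
theorem resultant_mem (i : Fin n) : resultant d ∈ resIdeal d i := by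
  obtain ⟨K, _, _, a, hz, ha⟩ := exists_hasZero d i
  refine ha _ ?_
  rw [← aeval_eq_evalAt, (isResultant_resultant hd i).vanishes_iff]
  exact hz

end Resultant

/-! ### Complexes which are exact except at two consecutive terms -/

section AlmostExact

open Module

variable {F : Type u} [Field F] {V : ℤ → Type*} [∀ j, AddCommGroup (V j)] [∀ j, Module F (V j)]
  {D : ∀ j, V j →ₗ[F] V (j + 1)} {N : ℤ → ℕ} (b : ∀ j, Basis (Fin (N j)) F (V j))

theorem linearIndependent_of_det_liftFamily {r : ℤ → ℕ} {w : ∀ j, Fin (r j) → V j}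
    {h : ∀ j, r j + r (j + 1) = N (j + 1)} {j : ℤ}
    (hj : (b (j + 1)).det (liftFamily D w h j) ≠ 0) :
    LinearIndependent F (fun i => D j (w j i)) := by
  have := (linearIndependent_of_det_ne_zero _ hj).comp
    (fun i => Fin.cast (h j) (Fin.castAdd _ i))
    ((Fin.cast_injective _).comp (Fin.castAdd_injective _ _))
  convert this using 2 with i
  simp [liftFamily]

include b in
/-- A complex is exact if the ranks of its differentials are at least as large as the dimensions of
its terms require. -/
theorem isExactComplex_of_linearIndependent (hD : ∀ j x, D (j + 1) (D j x) = 0) {r : ℤ → ℕ}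
    (h : ∀ j, r j + r (j + 1) = N (j + 1))
    (hw : ∀ j, ∃ w : Fin (r j) → V j, LinearIndependent F (fun i => D j (w i))) :
    IsExactComplex D := by
  choose w hw using hw
  exact isExactComplex_of_lift b hD (h := h) fun j =>
    det_liftFamily_ne_zero b hD h (hw j) (hw (j + 1))

include b in
/-- If a complex is exact except at the terms `V^{k+1}` and `V^{k+2}`, then all its differentials
but the one between these two have the ranks `r` required by exactness: those below are determined
from the left end of the complex, those above from the right end. -/
theorem finrank_range_eq (hN : {j | N j ≠ 0}.Finite) {r : ℤ → ℕ}
    (h : ∀ j, r j + r (j + 1) = N (j + 1)) {k : ℤ}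
    (hex : ∀ j, j ≠ k → j ≠ k + 1 → Function.Exact (D j) (D (j + 1))) {j : ℤ} (hj : j ≠ k + 1) :
    finrank F (LinearMap.range (D j)) = r j := by
  have hzero : ∀ j, N j = 0 → finrank F (LinearMap.range (D j)) = r j := by
    intro j hj
    have h1 := h (j - 1)
    rw [sub_add_cancel, hj] at h1
    have : Subsingleton (V j) := by
      have : IsEmpty (Fin (N j)) := by
        rw [hj]
        infer_instance
      exact (b j).repr.toEquiv.subsingleton
    have h2 : D j = 0 := LinearMap.ext fun x => by rw [Subsingleton.elim x 0, map_zero, map_zero]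
    rw [h2, LinearMap.range_zero, finrank_bot]
    omega
  obtain ⟨J, hJ⟩ := hN.bddAbove
  obtain ⟨J', hJ'⟩ := hN.bddBelow
  have hup : ∀ j, J < j → N j = 0 := fun j hj => by
    by_contra hne
    exact absurd (hJ hne) (not_le.2 hj)
  have hdown : ∀ j, j < J' → N j = 0 := fun j hj => by
    by_contra hne
    exact absurd (hJ' hne) (not_le.2 hj)
  rcases lt_or_gt_of_ne hj with hj | hj
  · have key : ∀ m : ℕ, ∀ j : ℤ, j < k + 1 → j < J' + m →
        finrank F (LinearMap.range (D j)) = r j := by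
      intro m
      induction m with
      | zero => exact fun j _ hj => hzero j (hdown j (by simpa using hj))
      | succ m ih =>
        intro j hj hm
        obtain ⟨i, rfl⟩ : ∃ i, j = i + 1 := ⟨j - 1, by omega⟩
        have h1 := ih i (by omega) (by push_cast at hm; omega)
        have h2 := h i
        have h3 := finrank_range_add_of_exact b (hex i (by omega) (by omega))
        omega
    exact key (j - J' + 1).toNat j hj (by omega)
  · have key : ∀ m : ℕ, ∀ j : ℤ, k + 1 < j → J < j + m →
        finrank F (LinearMap.range (D j)) = r j := by
      intro m
      induction m with
      | zero => exact fun j _ hj => hzero j (hup j (by simpa using hj))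
      | succ m ih =>
        intro j hj hm
        have h1 := ih (j + 1) (by omega) (by push_cast at hm; omega)
        have h2 := h j
        have h3 := finrank_range_add_of_exact b (hex j (by omega) (by omega))
        omega
    exact key (J - j + 1).toNat j hj (by omega)

variable {A : Type*} [CommRing A] {M : ∀ j, Matrix (Fin (N (j + 1))) (Fin (N j)) A}
  {φ : A →+* F} {b}

/-- For a complex which is exact except at two consecutive terms, one can choose subfamilies of
the bases for which all but one of the determinants which make up the determinant of the complex do
not vanish. -/
theorem Realizes.exists_liftDet_of_ne (hR : Realizes M φ D b) (hN : {j | N j ≠ 0}.Finite)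
    {r : ℤ → ℕ} (h : ∀ j, r j + r (j + 1) = N (j + 1)) {k : ℤ}
    (hex : ∀ j, j ≠ k → j ≠ k + 1 → Function.Exact (D j) (D (j + 1))) :
    ∃ I : ∀ j, Fin (r j) → Fin (N j), ∀ j, j ≠ k + 1 → φ (liftDet M I h j) ≠ 0 := by
  have h0 : ∀ j, ∃ I : Fin (r j) → Fin (N j),
      j ≠ k + 1 → LinearIndependent F (fun i => D j (b j (I i))) := by
    intro j
    by_cases hj : j = k + 1
    · have hle : r j ≤ N j := by
        have := h (j - 1)
        rw [sub_add_cancel] at this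
        omega
      exact ⟨Fin.castLE hle, fun h => absurd hj h⟩
    · obtain ⟨I, hI⟩ := exists_linearIndependent_subfamily (b j) (D j)
      have hr := finrank_range_eq b hN h hex hj
      exact ⟨I ∘ Fin.cast hr.symm, fun _ => hI.comp _ (Fin.cast_injective _)⟩
  choose I₀ hI₀ using h0
  -- the rank of `D (k + 1)` may be too small, so in `V^{k+1}` the subfamily is chosen to be a basis
  -- modulo the boundaries
  have h1 : ∃ I : Fin (r (k + 1)) → Fin (N (k + 1)),
      LinearIndependent F (fun i => (LinearMap.range (D k)).mkQ (b (k + 1) (I i))) := by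
    obtain ⟨I, hI⟩ := exists_linearIndependent_subfamily (b (k + 1)) (LinearMap.range (D k)).mkQ
    have hr : finrank F (LinearMap.range (LinearMap.range (D k)).mkQ) = r (k + 1) := by
      have := Module.Finite.of_basis (b (k + 1))
      have h2 := Submodule.finrank_quotient_add_finrank (LinearMap.range (D k))
      rw [finrank_range_eq b hN h hex (by omega : k ≠ k + 1), finrank_eq_card_basis (b (k + 1)),
        Fintype.card_fin] at h2
      have h3 := h k
      rw [Submodule.range_mkQ, finrank_top]
      omega
    exact ⟨I ∘ Fin.cast hr.symm, hI.comp _ (Fin.cast_injective _)⟩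
  obtain ⟨I₁, hI₁⟩ := h1
  let I : ∀ j, Fin (r j) → Fin (N j) := Function.update I₀ (k + 1) I₁
  have hI : ∀ j, j ≠ k + 1 → LinearIndependent F (fun i => D j (b j (I j i))) := by
    intro j hj
    have : I j = I₀ j := Function.update_of_ne hj _ _
    rw [this]
    exact hI₀ j hj
  refine ⟨I, fun j hj => ?_⟩
  rw [← hR.det_liftFamily I h j]
  by_cases hjk : j = k
  · subst hjk
    refine det_ne_zero_of_linearIndependent _ ?_
    have hI1 : I (j + 1) = I₁ := Function.update_self _ _ _
    refine (linearIndependent_append (LinearMap.range (D j)).mkQ (hI j hj)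
      (fun i => ?_) (y := fun i => b (j + 1) (I (j + 1) i)) ?_).comp _ (Fin.cast_injective _)
    · exact (Submodule.Quotient.mk_eq_zero _).2 ⟨_, rfl⟩
    · rw [hI1]
      exact hI₁
  · exact det_liftFamily_ne_zero b hR.2 h (hI j hj) (hI (j + 1) (by omega))

/-- In an exact complex, all the determinants which make up the determinant of the complex are
different from zero if all but one are. -/
theorem Realizes.liftDet_ne_zero (hR : Realizes M φ D b) (hN : {j | N j ≠ 0}.Finite)
    (hex : IsExactComplex D) {r : ℤ → ℕ} {I : ∀ j, Fin (r j) → Fin (N j)}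
    {h : ∀ j, r j + r (j + 1) = N (j + 1)} {k : ℤ}
    (hI : ∀ j, j ≠ k + 1 → φ (liftDet M I h j) ≠ 0) (j : ℤ) : φ (liftDet M I h j) ≠ 0 := by
  by_cases hj : j = k + 1
  swap
  · exact hI j hj
  subst hj
  rw [← hR.det_liftFamily]
  have h1 := hI k (by omega)
  have h2 := hI (k + 1 + 1) (by omega)
  rw [← hR.det_liftFamily] at h1 h2
  refine det_liftFamily_ne_zero b hR.2 h ?_ (linearIndependent_of_det_liftFamily b h2)
  rw [linearIndependent_iff_card_eq_finrank_span, Fintype.card_fin, Set.finrank]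
  have hspan : Submodule.span F (Set.range fun i => D (k + 1) (b (k + 1) (I (k + 1) i))) =
      LinearMap.range (D (k + 1)) := by
    refine le_antisymm (Submodule.span_le.2 ?_) ?_
    · rintro _ ⟨i, rfl⟩
      exact ⟨_, rfl⟩
    · rw [← Submodule.map_top, ← span_of_det_ne_zero _ h1, Submodule.map_span, Submodule.span_le]
      rintro _ ⟨_, ⟨m, rfl⟩, rfl⟩
      change D (k + 1) (Fin.append _ _ (Fin.cast (h k).symm m)) ∈ _
      refine Fin.addCases (fun i => ?_) (fun i => ?_) (Fin.cast (h k).symm m)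
      · rw [Fin.append_left, hR.2]
        exact Submodule.zero_mem _
      · rw [Fin.append_right]
        exact Submodule.subset_span ⟨i, rfl⟩
  rw [hspan, finrank_range_eq b hN h (k := k + 1) (fun j _ _ => hex j) (by omega)]

/-- The columns of a non-vanishing minor give independent images. -/
theorem Realizes.linearIndependent_of_minor (hR : Realizes M φ D b) {j : ℤ} {s : ℕ}
    {row : Fin s → Fin (N (j + 1))} {col : Fin s → Fin (N j)}
    (hm : φ ((M j).submatrix row col).det ≠ 0) :
    LinearIndependent F (fun i => D j (b j (col i))) := by
  rw [Fintype.linearIndependent_iff]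
  intro c hc
  rw [RingHom.map_det] at hm
  refine fun i => congrFun (Matrix.eq_zero_of_mulVec_eq_zero hm (v := c) ?_) i
  funext x
  have h1 := congrArg (fun y => (b (j + 1)).repr y (row x)) hc
  simp only [map_sum, map_smul, Finsupp.coe_finsetSum, Finset.sum_apply, Finsupp.smul_apply,
    smul_eq_mul, map_zero, Finsupp.zero_apply] at h1
  rw [Pi.zero_apply, ← h1, Matrix.mulVec, dotProduct]
  refine Finset.sum_congr rfl fun i _ => ?_
  have h2 := congrFun (congrFun (hR.1 j) (row x)) (col i)
  rw [LinearMap.toMatrix_apply] at h2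
  rw [h2, mul_comm]
  rfl

end AlmostExact

/-! ### Divisibility of minors -/

section Minors

variable {A : Type*} [CommRing A]

/-- The columns of a product `M V` are combinations of those of `M`, so its minors are combinations
of minors of `M` of the same size. -/
theorem dvd_det_submatrix_mul {ι κ κ' : Type*} [Fintype κ] {M : Matrix ι κ A} {x : A} {s : ℕ}
    (h : ∀ (row : Fin s → ι) (col : Fin s → κ), x ∣ (M.submatrix row col).det) (V : Matrix κ κ' A)
    (row : Fin s → ι) (col : Fin s → κ') : x ∣ ((M * V).submatrix row col).det := by
  classical
  rw [← Matrix.det_transpose]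
  have e : ((M * V).submatrix row col).transpose =
      fun i => ∑ k : κ, V k (col i) • fun j => M (row j) k := by
    ext i j
    rw [Matrix.transpose_apply, Matrix.submatrix_apply, Matrix.mul_apply, Finset.sum_apply]
    exact Finset.sum_congr rfl fun k _ => mul_comm _ _
  have e2 := (Matrix.detRowAlternating (n := Fin s) (R := A)).toMultilinearMap.map_sum
    (fun i (k : κ) => V k (col i) • fun j => M (row j) k)
  change Matrix.det (fun i => ∑ k : κ, V k (col i) • fun j => M (row j) k) = _ at e2
  rw [e, e2]
  refine Finset.dvd_sum fun k _ => ?_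
  rw [MultilinearMap.map_smul_univ]
  refine dvd_smul_of_dvd _ ?_
  have := h row k
  rwa [← Matrix.det_transpose] at this

theorem dvd_det_submatrix_mul' {ι ι' κ : Type*} [Fintype ι] {M : Matrix ι κ A} {x : A} {s : ℕ}
    (h : ∀ (row : Fin s → ι) (col : Fin s → κ), x ∣ (M.submatrix row col).det) (U : Matrix ι' ι A)
    (row : Fin s → ι') (col : Fin s → κ) : x ∣ ((U * M).submatrix row col).det := by
  have := dvd_det_submatrix_mul (M := M.transpose) (x := x) (fun c r => by
    rw [← Matrix.transpose_submatrix, Matrix.det_transpose]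
    exact h r c) U.transpose col row
  rwa [← Matrix.transpose_mul, ← Matrix.transpose_submatrix, Matrix.det_transpose] at this

/-- Laplace expansion along the last `q` columns. -/
theorem dvd_det_of_dvd_minor {x : A} {p q : ℕ} (B : Matrix (Fin (p + q)) (Fin (p + q)) A)
    (h : ∀ row : Fin p → Fin (p + q), x ∣ (B.submatrix row (Fin.castAdd q)).det) : x ∣ B.det := by
  induction q with
  | zero => exact h id
  | succ q ih =>
    have e := Matrix.det_succ_column (n := p + q) B (Fin.last _)
    rw [e]
    exact Finset.dvd_sum fun i _ => Dvd.dvd.mul_left (ih _ fun row => by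
      have hc : (Fin.last (p + q)).succAbove ∘ Fin.castAdd q = Fin.castAdd (q + 1) :=
        funext fun k => Fin.succAbove_last_apply _
      rw [Matrix.submatrix_submatrix, hc]
      exact h _) _

theorem dvd_liftDet {N : ℤ → ℕ} {M : ∀ j, Matrix (Fin (N (j + 1))) (Fin (N j)) A} {r : ℤ → ℕ}
    {I : ∀ j, Fin (r j) → Fin (N j)} {h : ∀ j, r j + r (j + 1) = N (j + 1)} {j : ℤ} {x : A}
    (hx : ∀ (row : Fin (r j) → Fin (N (j + 1))) (col : Fin (r j) → Fin (N j)),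
      x ∣ ((M j).submatrix row col).det) : x ∣ liftDet M I h j := by
  rw [liftDet, ← Matrix.det_submatrix_equiv_self (finCongr (h j))]
  refine dvd_det_of_dvd_minor _ fun row => ?_
  convert hx (finCongr (h j) ∘ row) (I j) using 2
  ext a c
  simp

/-- Minors with repeated rows or columns vanish, so that they do not matter. -/
theorem isGCDOf_of_rank_eq [IsDomain A] {ι κ : Type*} [Fintype κ] {M : Matrix ι κ A} {s : ℕ}
    (hs : (M.map (algebraMap A (FractionRing A))).rank = s) {g : A}
    (h1 : ∀ (row : Fin s → ι) (col : Fin s → κ), g ∣ (M.submatrix row col).det)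
    (h2 : ∀ x, (∀ (row : Fin s → ι) (col : Fin s → κ), x ∣ (M.submatrix row col).det) → x ∣ g) :
    IsGCDOf {m | IsMaximalMinor M m} g := by
  subst hs
  refine ⟨?_, fun x hx => h2 x fun row col => ?_⟩
  · rintro m ⟨row, col, rfl⟩
    exact h1 row col
  · by_cases hrow : Function.Injective row
    · by_cases hcol : Function.Injective col
      · exact hx _ ⟨⟨row, hrow⟩, ⟨col, hcol⟩, rfl⟩
      · obtain ⟨i, j, hij, hne⟩ := by
          simpa only [Function.Injective, not_forall] using hcol
        rw [Matrix.det_zero_of_column_eq hne fun k => by simp [hij]]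
        exact dvd_zero x
    · obtain ⟨i, j, hij, hne⟩ := by
        simpa only [Function.Injective, not_forall] using hrow
      rw [Matrix.det_zero_of_row_eq hne (funext fun k => by simp [hij])]
      exact dvd_zero x

theorem rank_map_mul_mul_le {K : Type*} [Field K] (φ : A →+* K) {ι ι' κ κ' : Type*} [Fintype ι]
    [Fintype κ] [Fintype κ'] (U : Matrix ι' ι A) (M : Matrix ι κ A) (V : Matrix κ κ' A) :
    ((U * M * V).map φ).rank ≤ (M.map φ).rank := by
  rw [Matrix.map_mul, Matrix.map_mul]
  exact (Matrix.rank_mul_le_left _ _).trans (Matrix.rank_mul_le_right _ _)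

/-- Splitting off the factor at an odd integer. -/
theorem evenProd_eq {N : ℤ → ℕ} (hN : {j | N j ≠ 0}.Finite) {f : ℤ → A}
    (hf : ∀ j, N (j + 1) = 0 → f j = 1) {k : ℤ} (hk : Even (k + 1)) :
    evenProd f = f k * evenProd (Function.update f k 1) := by
  have e : ∀ j : ℤ, (if Even (j + 1) then f j else 1) = (if j = k then f k else 1) *
      (if Even (j + 1) then Function.update f k 1 j else 1) := by
    intro j
    by_cases hj : j = k
    · subst hj
      simp [hk]
    · simp [hj]
  rw [evenProd, finprod_congr e, finprod_mul_distrib, finprod_eq_single _ k, if_pos rfl, evenProd]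
  · intro j hj
    exact if_neg hj
  · exact (Set.finite_singleton k).subset fun j hj => by
      by_contra h
      exact hj (if_neg h)
  · refine hasFiniteMulSupport_of_succ hN fun j hj => ?_
    by_cases hjk : j = k
    · subst hjk
      simp
    · simp [hjk, hf j hj]

theorem oddProd_eq {f : ℤ → A} {k : ℤ} (hk : Even (k + 1)) :
    oddProd f = oddProd (Function.update f k 1) := by
  refine finprod_congr fun j => ?_
  by_cases hj : j = k
  · subst hj
    simp [hk]
  · simp [hj]

end Minors

/-! ### The greatest common divisor of the maximal minors -/

section GCD

variable {n : ℕ} {d : Fin n → ℕ}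

/-- The coefficients of `X_1^{d_1}, …, X_{n-1}^{d_{n-1}}, 0` have a common zero, but the Koszul
complex is exact except at the terms of degrees `0` and `-1`. -/
theorem exists_almost_exact (hn : 1 ≤ n) (hd : ∀ i, 1 ≤ d i) (t : ℤ) : ∃ a : Coeffs d → ℂ,
    HasZero a ∧ ∀ j : ℤ, j ≠ -2 → j ≠ -2 + 1 →
      Function.Exact (coupledD a t j) (coupledD a t (j + 1)) := by
  let i₀ : Fin n := ⟨n - 1, by omega⟩
  let f : Fin n → MvPolynomial (Fin n) ℂ := fun i => if i = i₀ then 0 else X i ^ d i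
  have hf : ∀ i, f i ∈ S ℂ n (d i) := by
    intro i
    simp only [f]
    split_ifs
    · exact Submodule.zero_mem _
    · have h := (isHomogeneous_X ℂ i).pow (d i)
      rw [one_mul] at h
      exact mem_S_of_isHomogeneous h
  have hpoly := exists_poly_eq hf
  refine ⟨_, ⟨Pi.single i₀ 1, fun h => ?_, fun i => ?_⟩, fun j h1 h2 =>
    coupledD_exact_of_ne (fun c : Coeffs d => coeff c.2.1 (f c.1)) (fun p hp => ?_) t
      (by omega) (by omega)⟩
  · have := congrFun h i₀
    simp at this
  · rw [hpoly]
    by_cases hi : i = i₀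
    · simp [f, hi]
    · have := hd i
      simp [f, hi, show d i ≠ 0 by omega]
  · rw [hpoly]
    refine koszulExact_of_pow_mem f (m := n - 1) (by omega) d (fun i hi => ?_) (by omega)
    have : f i = X i ^ d i := if_neg fun h => by
      rw [h] at hi
      exact lt_irrefl _ hi
    rw [← this]
    exact Ideal.subset_span ⟨i, rfl⟩

variable (hn : 1 ≤ n) (hd : ∀ i, 1 ≤ d i) {t : ℕ}
  (o : ∀ j : ℤ, CoupledIdx d t j ≃ Fin (coupledRank d t j))

variable (d t) in
/-- The ranks of the differentials of the generic complex. -/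
def diffRank (j : ℤ) : ℕ := Module.finrank (FractionRing (CoeffRing d))
  (LinearMap.range (coupledD (genericFrac d) t j))

include hd in
/-- The generic complex is exact because its specialization at `X_1^{d_1}, …, X_n^{d_n}` is. -/
theorem isExactComplex_genericFrac : IsExactComplex (coupledD (genericFrac d) t) :=
  (exists_fraction (fun _ => Fintype.equivFin _) ((isExactComplex_iff hd
    (fun c : Coeffs d => (powerCoeffs d c : AlgebraicClosure ℚ)) t).2
      (not_hasZero_powerCoeffs hd _))).1

include hd in
theorem diffRank_add (j : ℤ) :
    diffRank d t j + diffRank d t (j + 1) = coupledRank d t (j + 1) :=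
  finrank_range_add_of_exact (ordBasis (fun _ => Fintype.equivFin _) _)
    (isExactComplex_genericFrac hd j)

include hn hd in
/-- A multiple of the resultant by an element prime to it is, up to such an element, one of the
determinants which make up the determinant of the generic complex. -/
theorem exists_resultant_mul_eq (hr : ∀ j, diffRank d t j + diffRank d t (j + 1) =
    coupledRank d t (j + 1)) : ∃ (I : ∀ j, Fin (diffRank d t j) → Fin (coupledRank d t j))
      (u v : CoeffRing d), ¬ resultant d ∣ u ∧ ¬ resultant d ∣ v ∧
        resultant d * u = liftDet (genericMatrix o) I hr (-1) * v ∧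
        (∀ j ≠ -1, ¬ resultant d ∣ liftDet (genericMatrix o) I hr j) := by
  have hN := coupledRank_finite d t
  let i₀ : Fin n := ⟨0, hn⟩
  obtain ⟨a, ha, hex⟩ := exists_almost_exact hn hd (t : ℤ)
  obtain ⟨I, hI⟩ := (realizes_evalAt o a).exists_liftDet_of_ne hN hr hex
  have hndvd : ∀ x, evalAt a x ≠ 0 → ¬ resultant d ∣ x := by
    rintro _ hx ⟨y, rfl⟩
    refine hx ?_
    rw [map_mul, evalAt_eq_zero ha (resultant_mem hd i₀), zero_mul]
  have hne : ∀ j, j ≠ -2 + 1 → liftDet (genericMatrix o) I hr j ≠ 0 := fun j hj h0 =>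
    hI j hj (by rw [h0, map_zero])
  have hinj := IsFractionRing.injective (CoeffRing d) (FractionRing (CoeffRing d))
  have hgen := (realizes_genericFrac o).liftDet_ne_zero hN (isExactComplex_genericFrac hd)
    (I := I) (h := hr) (k := -2) fun j hj => by
      rw [Ne, map_eq_zero_iff _ hinj]
      exact hne j hj
  have hD := (realizes_genericFrac o).isComplexDet hN hgen
  obtain ⟨z, hz⟩ := exists_isComplexDet_eq hd (prime_resultant hd i₀) (resultant_mem hd i₀) o
  have heq := genericDet_unique o hz hD
  have hL1 : ∀ j, coupledRank d t (j + 1) = 0 → liftDet (genericMatrix o) I hr j = 1 :=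
    fun j hj => liftDet_eq_one _ _ _ hj
  refine ⟨I, ?_⟩
  generalize liftDet (genericMatrix o) I hr = L at *
  have hL1' : ∀ j, coupledRank d t (j + 1) = 0 → Function.update L (-1) 1 j = 1 := by
    intro j hj
    by_cases h : j = -1
    · rw [h, Function.update_self]
    · rw [Function.update_of_ne h, hL1 j hj]
  have hL0 : ∀ j, evalAt a (Function.update L (-1) 1 j) ≠ 0 := by
    intro j
    by_cases h : j = -1
    · rw [h, Function.update_self, map_one]
      exact one_ne_zero
    · rw [Function.update_of_ne h]
      exact hI j h
  have heven : Even (-1 + 1 : ℤ) := by simp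
  refine ⟨((z : ℤ) : CoeffRing d) * oddProd (Function.update L (-1) 1),
    evenProd (Function.update L (-1) 1), hndvd _ ?_, hndvd _ ?_, ?_, fun j hj => hndvd _ (hI j hj)⟩
  · rw [map_mul, map_intCast]
    refine mul_ne_zero ?_ (map_oddProd_ne_zero _ hN hL1' hL0)
    rcases Int.units_eq_one_or z with rfl | rfl <;> simp
  · exact map_evenProd_ne_zero _ hN hL1' hL0
  · have h0 := map_oddProd_ne_zero _ hN hL1 hgen
    rw [eq_div_iff h0, zpow_one,
      ← map_intCast (algebraMap (CoeffRing d) (FractionRing (CoeffRing d))), ← map_mul,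
      ← map_mul] at heq
    rw [← evenProd_eq hN hL1 heven, ← oddProd_eq heven, ← hinj heq]
    ring

include hn hd in
/-- The resultant divides the minors of size `rank ∂_0`: if such a minor does not vanish at
coefficients over the prime ideal of the resultant, then the complex is exact there. -/
theorem resultant_dvd_minor (row : Fin (diffRank d t (-1)) → Fin (coupledRank d t (-1 + 1)))
    (col : Fin (diffRank d t (-1)) → Fin (coupledRank d t (-1))) :
    resultant d ∣ ((genericMatrix o (-1)).submatrix row col).det := by
  let i₀ : Fin n := ⟨0, hn⟩
  have hr := prime_resultant hd i₀
  obtain ⟨I, u, v, -, -, -, hI⟩ := exists_resultant_mul_eq hn hd o (diffRank_add hd)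
  have hprime : (Ideal.span {resultant d}).IsPrime :=
    (Ideal.span_singleton_prime hr.ne_zero).2 hr
  obtain ⟨K, _, _, a, ha⟩ := exists_evalAt_eq_zero_iff (Ideal.span {resultant d})
  simp only [Ideal.mem_span_singleton] at ha
  have hz := (evalAt_eq_zero_iff hd hr (resultant_mem hd i₀) a).1 ((ha _).2 dvd_rfl)
  by_contra hm
  refine (isExactComplex_iff hd a t).1 ?_ hz
  have hR := realizes_evalAt o a
  refine isExactComplex_of_linearIndependent (ordBasis o K) hR.2 (diffRank_add hd) fun j => ?_
  by_cases hj : j = -1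
  · subst hj
    exact ⟨_, hR.linearIndependent_of_minor fun h => hm ((ha _).1 h)⟩
  · have h1 : evalAt a (liftDet (genericMatrix o) I (diffRank_add hd) j) ≠ 0 := fun h =>
      hI j hj ((ha _).1 h)
    rw [← hR.det_liftFamily] at h1
    exact ⟨_, linearIndependent_of_det_liftFamily _ h1⟩

include hn hd in
/-- A common divisor `x` of the minors divides a multiple `Res ⋅ u` with `u` prime to the resultant
`Res`. A prime divisor of `x` other than `Res` would be the kernel of a specialization with an exact
complex, in which some minor does not vanish; so `x` is a unit times a power of `Res`, and the
exponent is at most one. -/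
theorem dvd_resultant_of_dvd_minor {x : CoeffRing d}
    (hx : ∀ (row : Fin (diffRank d t (-1)) → Fin (coupledRank d t (-1 + 1)))
      (col : Fin (diffRank d t (-1)) → Fin (coupledRank d t (-1))),
      x ∣ ((genericMatrix o (-1)).submatrix row col).det) : x ∣ resultant d := by
  let i₀ : Fin n := ⟨0, hn⟩
  have hr := prime_resultant hd i₀
  have hrm := resultant_mem hd i₀
  obtain ⟨I, u, v, hu, -, heq, -⟩ := exists_resultant_mul_eq hn hd o (diffRank_add hd)
  have hxL : ∀ (I : ∀ j, Fin (diffRank d t j) → Fin (coupledRank d t j))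
      (h : ∀ j, diffRank d t j + diffRank d t (j + 1) = coupledRank d t (j + 1)),
      x ∣ liftDet (genericMatrix o) I h (-1) := fun I h => dvd_liftDet (j := -1) hx
  have hxu : x ∣ resultant d * u := by
    rw [heq]
    exact (hxL I _).mul_right v
  have hx0 : x ≠ 0 := by
    rintro rfl
    refine hu ?_
    rw [(mul_eq_zero.1 (zero_dvd_iff.1 hxu)).resolve_left hr.ne_zero]
    exact dvd_zero _
  have key : ∀ p, Prime p → p ∣ x → Associated p (resultant d) := by
    intro p hp hpx
    have hprime : (Ideal.span {p}).IsPrime := (Ideal.span_singleton_prime hp.ne_zero).2 hp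
    obtain ⟨K, _, _, a, ha⟩ := exists_evalAt_eq_zero_iff (Ideal.span {p})
    simp only [Ideal.mem_span_singleton] at ha
    by_cases hz : HasZero a
    · exact hp.associated_of_dvd hr ((ha _).1 (evalAt_eq_zero hz hrm))
    · exfalso
      obtain ⟨s, J, h, hJ⟩ := (realizes_evalAt o a).exists_liftDet
        ((isExactComplex_iff hd a t).2 hz)
      obtain rfl := ranks_unique (coupledRank_finite d t) h (diffRank_add hd)
      exact hJ (-1) ((ha _).2 (hpx.trans (hxL J h)))
  obtain ⟨e, ε, rfl⟩ := exists_eq_unit_mul_pow hr hx0 key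
  rw [Units.mul_left_dvd] at hxu ⊢
  rcases Nat.lt_or_ge e 2 with he | he
  · calc resultant d ^ e ∣ resultant d ^ 1 := pow_dvd_pow _ (by omega)
      _ = resultant d := pow_one _
  · refine absurd ?_ hu
    have h2 : resultant d * resultant d ∣ resultant d * u := by
      rw [← sq]
      exact (pow_dvd_pow _ he).trans hxu
    exact (mul_dvd_mul_iff_left hr.ne_zero).1 h2

include hn hd in
/-- The resultant is the greatest common divisor of the maximal minors of any matrix of `∂_0`. -/
theorem isGCDOf_maximalMinors {ι κ : Type*} [Fintype ι] [DecidableEq ι] [Fintype κ]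
    [DecidableEq κ] (b : Module.Basis κ (CoeffRing d) (Coupled (CoeffRing d) d t (-1)))
    (b' : Module.Basis ι (CoeffRing d) (Coupled (CoeffRing d) d t (-1 + 1))) :
    IsGCDOf {m | IsMaximalMinor (LinearMap.toMatrix b b' (coupledD (generic d) t (-1))) m}
      (resultant d) := by
  let o : ∀ j : ℤ, CoupledIdx d t j ≃ Fin (coupledRank d t j) := fun j => Fintype.equivFin _
  let c := ordBasis o (CoeffRing d) (-1)
  let c' := ordBasis o (CoeffRing d) (-1 + 1)
  have e1 : b'.toMatrix c' * genericMatrix o (-1) * c.toMatrix b =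
      LinearMap.toMatrix b b' (coupledD (generic d) t (-1)) :=
    basis_toMatrix_mul_linearMap_toMatrix_mul_basis_toMatrix b c b' c' _
  have e2 : c'.toMatrix b' * LinearMap.toMatrix b b' (coupledD (generic d) t (-1)) *
      b.toMatrix c = genericMatrix o (-1) :=
    basis_toMatrix_mul_linearMap_toMatrix_mul_basis_toMatrix c b c' b' _
  have hrank : ((genericMatrix o (-1)).map
      (algebraMap _ (FractionRing (CoeffRing d)))).rank = diffRank d t (-1) := by
    rw [← (realizes_genericFrac o).1, Matrix.rank_eq_finrank_range_toLin _
      (ordBasis o _ (-1 + 1)) (ordBasis o _ (-1)), Matrix.toLin_toMatrix]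
    rfl
  refine isGCDOf_of_rank_eq (s := diffRank d t (-1)) ?_ ?_ ?_
  · rw [← hrank]
    refine le_antisymm ?_ ?_
    · rw [← e1]
      exact rank_map_mul_mul_le _ _ _ _
    · conv_lhs => rw [← e2]
      exact rank_map_mul_mul_le _ _ _ _
  · intro row col
    rw [← e1]
    exact dvd_det_submatrix_mul (dvd_det_submatrix_mul' (resultant_dvd_minor hn hd o) _) _ row col
  · intro x hx
    refine dvd_resultant_of_dvd_minor hn hd o fun row col => ?_
    rw [← e2]
    exact dvd_det_submatrix_mul (dvd_det_submatrix_mul' hx _) _ row col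

end GCD

/-! ### The sign of the determinant -/

section Sign

variable {n : ℕ} {d : Fin n → ℕ} {t : ℤ}

/-- Interchanging two elements of one of the bases changes the sign of the determinant. -/
theorem exists_isComplexDet_neg (o : ∀ j : ℤ, CoupledIdx d t j ≃ Fin (coupledRank d t j))
    {F : Type*} [Field F] {a : Coeffs d → F} {x : F}
    (hx : IsComplexDet (coupledD a t) (ordBasis o F) x) {k : ℤ} {y y' : CoupledIdx d t (k + 1)}
    (hy : y ≠ y') : ∃ o' : ∀ j : ℤ, CoupledIdx d t j ≃ Fin (coupledRank d t j),
      IsComplexDet (coupledD a t) (ordBasis o' F) (-x) := by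
  let s : Fin (coupledRank d t (k + 1)) ≃ Fin (coupledRank d t (k + 1)) :=
    Equiv.swap (o (k + 1) y) (o (k + 1) y')
  let o' : ∀ j : ℤ, CoupledIdx d t j ≃ Fin (coupledRank d t j) :=
    Function.update o (k + 1) ((o (k + 1)).trans s)
  have h1 : ∀ j, j ≠ k + 1 → o' j = o j := fun j hj => Function.update_of_ne hj _ _
  have h2 : o' (k + 1) = (o (k + 1)).trans s := Function.update_self _ _ _
  refine ⟨o', ?_⟩
  have h := IsComplexDet.map_equiv (ordBasis o F) (ordBasis o' F) (coupledRank_finite d t)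
    (fun j => LinearEquiv.refl F _) (fun j y => rfl) hx
  have hdet : (ordBasis o' F (k + 1)).det (ordBasis o F (k + 1)) = -1 := by
    have e : ordBasis o' F (k + 1) = (ordBasis o F (k + 1)).reindex s := by
      refine Module.Basis.eq_of_apply_eq fun i => ?_
      rw [ordBasis, h2]
      simp [ordBasis]
    rw [e, Module.Basis.det_reindex, AlternatingMap.map_swap _ _ ((o (k + 1)).injective.ne hy),
      Module.Basis.det_self]
  convert h using 1
  rw [finprod_eq_single _ k]
  · change _ = x * (ordBasis o' F (k + 1)).det (ordBasis o F (k + 1)) ^ _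
    rw [hdet]
    rcases Int.units_eq_one_or (k + 1).negOnePow with h | h <;> simp [h]
  · intro j hj
    have e : ordBasis o' F (j + 1) = ordBasis o F (j + 1) := by
      rw [ordBasis, h1 _ (by omega)]
      rfl
    rw [e]
    change (ordBasis o F (j + 1)).det (ordBasis o F (j + 1)) ^ _ = 1
    rw [Module.Basis.det_self, one_zpow]

/-- The determinant of a complex with just two terms, both of rank one, is the entry of the
differential between them; here this entry is `1`. -/
theorem isComplexDet_one (o : ∀ j : ℤ, CoupledIdx d t j ≃ Fin (coupledRank d t j))
    {F : Type*} [Field F] {a : Coeffs d → F} (k : ℤ)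
    (hN : ∀ j, coupledRank d t j = if j = k ∨ j = k + 1 then 1 else 0)
    (h1 : ∀ x y,
      (coupledBasis F d t (k + 1)).repr (coupledD a t k (coupledBasis F d t k x)) y = 1) :
    IsComplexDet (coupledD a t) (ordBasis o F) 1 := by
  let r : ℤ → ℕ := fun j => if j = k then 1 else 0
  have hr : ∀ j, r j + r (j + 1) = coupledRank d t (j + 1) := by
    intro j
    rw [hN]
    simp only [r]
    split_ifs <;> omega
  have hI : ∀ j, r j ≤ coupledRank d t j := by
    intro j
    rw [hN]
    simp only [r]
    split_ifs <;> omega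
  have hdet : ∀ j, (ordBasis o F (j + 1)).det (liftFamily (coupledD a t)
      (fun j i => ordBasis o F j (Fin.castLE (hI j) i)) hr j) = 1 := by
    intro j
    by_cases h : coupledRank d t (j + 1) = 0
    · exact Basis.det_of_fin_zero _ _ h
    have hle : coupledRank d t (j + 1) = 1 := by
      have := hN (j + 1)
      split_ifs at this
      · exact this
      · exact absurd this h
    have hs : Subsingleton (Fin (coupledRank d t (j + 1))) := by
      rw [hle]
      infer_instance
    let m : Fin (coupledRank d t (j + 1)) := ⟨0, by omega⟩
    rw [Module.Basis.det_apply, Matrix.det_eq_elem_of_subsingleton _ m, Module.Basis.toMatrix_apply]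
    by_cases hj : j = k
    · subst hj
      have hm : Fin.cast (hr j).symm m = Fin.castAdd _ (⟨0, by simp [r]⟩ : Fin (r j)) := rfl
      rw [liftFamily, hm, Fin.append_left]
      simp only [ordBasis, Module.Basis.reindex_apply, Module.Basis.repr_reindex_apply]
      exact h1 _ _
    · have hj' : j + 1 = k := by
        have h2 := hr j
        simp only [r, hj, if_false, hle] at h2
        by_contra h3
        rw [if_neg h3] at h2
        omega
      have hm : Fin.cast (hr j).symm m =
          Fin.natAdd _ (⟨0, by simp [r, hj']⟩ : Fin (r (j + 1))) := by
        ext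
        simp [r, hj, m]
      rw [liftFamily, hm, Fin.append_right, Module.Basis.repr_self,
        Subsingleton.elim (Fin.castLE _ _) m, Finsupp.single_eq_same]
  exact ⟨r, _, hr, fun j => by rw [hdet]; exact one_ne_zero, by simp [hdet]⟩

/-- The Bezoutian of `X_1^{d_1}, …, X_n^{d_n}`. -/
theorem bezoutian_pow {R : Type*} [CommRing R] (f : Fin n → MvPolynomial (Fin n) R)
    (hf : ∀ i, f i = X i ^ d i) :
    bezoutian f = ∏ i, ∑ b ∈ Finset.range (d i), xVar R i ^ b * yVar R i ^ (d i - 1 - b) := by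
  classical
  nontriviality R
  have hincr : ∀ i j, incr (f i) j = incrMonomial R (Finsupp.single i (d i)) j := by
    intro i j
    rw [hf, X_pow_eq_monomial, incr, support_monomial, if_neg one_ne_zero, Finset.sum_singleton,
      coeff_monomial, if_pos rfl, C_1, C_1, one_mul]
  have e : (Matrix.of fun i j => incr (f i) j) = Matrix.diagonal fun i =>
      ∑ b ∈ Finset.range (d i), xVar R i ^ b * yVar R i ^ (d i - 1 - b) := by
    ext1 i j
    rw [Matrix.of_apply, hincr, incrMonomial]
    by_cases h : i = j
    · subst h
      rw [Matrix.diagonal_apply_eq, Finsupp.single_eq_same, Finset.prod_eq_one, one_mul,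
        Finset.prod_eq_one, mul_one]
      · intro l hl
        rw [Finsupp.single_eq_of_ne (Finset.mem_Ioi.1 hl).ne', pow_zero]
      · intro l hl
        rw [Finsupp.single_eq_of_ne (Finset.mem_Iio.1 hl).ne, pow_zero]
    · rw [Matrix.diagonal_apply_ne _ h, Finsupp.single_eq_of_ne (Ne.symm h)]
      simp
  rw [bezoutian, e, Matrix.det_diagonal]

theorem poly_powerCoeffs {R : Type*} [CommRing R] (i : Fin n) :
    poly (fun c : Coeffs d => (powerCoeffs d c : R)) i = X i ^ d i := by
  have hdeg : (Finsupp.single i (d i)) ∈ monSet n (d i) := by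
    change ((Finsupp.single i (d i)).degree : ℤ) = d i
    simp
  rw [poly, Finset.sum_eq_single (⟨Finsupp.single i (d i), hdeg⟩ : Mon n (d i))]
  · simp [powerCoeffs, X_pow_eq_monomial]
  · intro α _ hα
    rw [powerCoeffs, if_neg fun h => hα (Subtype.ext h), Int.cast_zero, monomial_zero]
  · simp

theorem repr_bezoutMap {R : Type*} [CommRing R] (a : Coeffs d → R) (p q : ℤ) (hp : p = 0)
    (hq : q = 0) (x : KIdx d (critDeg d - t) p) (y : KIdx d t q) :
    (kBasis R d t q).repr (bezoutMap a t p q hp hq ((kBasis R d (critDeg d - t) p).coord x)) y =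
      coeff y.2.1 (bezoutCoeff (poly a) x.2.1) := by
  classical
  obtain ⟨⟨I, hI⟩, γ⟩ := x
  obtain rfl : I = ∅ := by
    rw [← Finset.card_eq_zero]
    omega
  rw [kBasis_repr, bezoutMap_coe, Finset.sum_eq_single γ]
  · rw [Module.Basis.coord_apply, Module.Basis.repr_self, Finsupp.single_eq_same, one_smul]
  · intro γ' _ hγ
    rw [Module.Basis.coord_apply, Module.Basis.repr_self, Finsupp.single_eq_of_ne, zero_smul]
    intro h
    simp only [Sigma.mk.injEq, heq_eq_eq, true_and] at h
    exact hγ h.symm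
  · simp

/-- For one variable, all the terms have rank at most one, and `∂_0` is multiplication by `X^d` or a
map `T_γ ↦ X^t` with `|γ| = d - 1 - t`. -/
theorem entry_of_fin_one {F : Type*} [Field F] {d : Fin 1 → ℕ} (t : ℕ)
    (x : CoupledIdx d t (-1)) (y : CoupledIdx d t (-1 + 1)) :
    (coupledBasis F d t (-1 + 1)).repr (coupledD (fun c => (powerCoeffs d c : F)) t (-1)
      (coupledBasis F d t (-1) x)) y = 1 := by
  classical
  have hdeg : ∀ {γ : Fin 1 →₀ ℕ}, γ.degree = γ 0 := by
    intro γ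
    rw [Finsupp.degree_eq_sum, Fin.sum_univ_one]
  have hcrit : critDeg d = d 0 - 1 := by rw [critDeg, Fin.sum_univ_one]
  have hI0 : ∀ I : Finset (Fin 1), (I.card : ℤ) = 0 → I = ∅ := by
    intro I hI
    rw [← Finset.card_eq_zero]
    omega
  have hI1 : ∀ I : Finset (Fin 1), (I.card : ℤ) = 1 → I = {0} := by
    intro I hI
    refine Finset.eq_of_subset_of_card_le (fun i _ => by simp [Subsingleton.elim i 0]) (by
      rw [Finset.card_singleton]
      omega)
  rcases y with ⟨⟨J, hJ⟩, δ, hδ⟩ | ⟨⟨J, hJ⟩, δ, hδ⟩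
  swap
  · exfalso
    obtain rfl := hI1 J (by omega)
    change (δ.degree : ℤ) = critDeg d - t - dSum d {0} at hδ
    rw [hcrit, dSum, Finset.sum_singleton] at hδ
    omega
  obtain rfl := hI0 J (by omega)
  change (δ.degree : ℤ) = t - dSum d ∅ at hδ
  rw [dSum_empty, sub_zero, hdeg] at hδ
  rw [coupledBasis_repr_inl, coupledD_fst' _ _ _ rfl]
  rcases x with ⟨⟨I, hI⟩, γ, hγ⟩ | ⟨⟨I, hI⟩, γ, hγ⟩
  · obtain rfl := hI1 I (by omega)
    have hγ' := hγ
    change (γ.degree : ℤ) = t - dSum d {0} at hγ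
    rw [dSum, Finset.sum_singleton, hdeg] at hγ
    rw [coupledBasis_inl]
    simp only [map_zero, add_zero]
    have hk : kExt (kBasis F d t (-(-1)) ⟨⟨{0}, hI⟩, ⟨γ, hγ'⟩⟩) {0} = monomial γ 1 := by
      rw [kExt, dif_pos hI, kBasis_coe, if_pos rfl]
    rw [kBasis_repr, koszulD_coe, Finset.sum_eq_single (0 : Fin 1), poly_powerCoeffs,
      LawfulSingleton.insert_empty_eq, hk, X_pow_eq_monomial, monomial_mul, mul_one]
    · have : Finsupp.single 0 (d 0) + γ = δ := by
        refine Finsupp.ext fun i => ?_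
        obtain rfl := Subsingleton.elim i 0
        rw [Finsupp.add_apply, Finsupp.single_eq_same]
        omega
      rw [this]
      simp [kSign]
    · exact fun i _ hi => absurd (Subsingleton.elim i 0) hi
    · simp
  · obtain rfl := hI0 I (by omega)
    change (γ.degree : ℤ) = critDeg d - t - dSum d ∅ at hγ
    rw [dSum_empty, sub_zero, hdeg, hcrit] at hγ
    rw [coupledBasis_inr]
    simp only [map_zero, zero_add]
    rw [Module.Basis.coe_dualBasis, repr_bezoutMap, bezoutCoeff,
      bezoutian_pow _ (fun i => poly_powerCoeffs i), Fin.prod_univ_one]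
    change coeff δ (coeff γ _) = 1
    rw [coeff_sum, Finset.sum_eq_single t]
    · rw [xVar, yVar, ← map_pow, coeff_C_mul, coeff_X_pow, if_pos, mul_one, coeff_X_pow, if_pos]
      · refine Finsupp.ext fun i => ?_
        obtain rfl := Subsingleton.elim i 0
        rw [Finsupp.single_eq_same]
        omega
      · refine Finsupp.ext fun i => ?_
        obtain rfl := Subsingleton.elim i 0
        rw [Finsupp.single_eq_same]
        omega
    · intro b hb hbt
      have hb' := Finset.mem_range.1 hb
      rw [xVar, yVar, ← map_pow, coeff_C_mul, coeff_X_pow, if_neg, mul_zero]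
      intro h
      have := DFunLike.congr_fun h 0
      rw [Finsupp.single_eq_same] at this
      omega
    · intro h
      exact absurd (Finset.mem_range.2 (by omega)) h

/-- For linear forms and `t = 0`, the map `∂_0` is `ψ_{1,0}`, and the Bezoutian of `X_1, …, X_n` is
`1`. -/
theorem entry_of_degree_one {F : Type*} [Field F] (hd : ∀ i, d i = 1)
    (x : CoupledIdx d 0 (-1)) (y : CoupledIdx d 0 (-1 + 1)) :
    (coupledBasis F d 0 (-1 + 1)).repr (coupledD (fun c => (powerCoeffs d c : F)) 0 (-1)
      (coupledBasis F d 0 (-1) x)) y = 1 := by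
  classical
  have hcrit : critDeg d = 0 := by simp [critDeg, hd]
  have hsum : ∀ I : Finset (Fin n), dSum d I = I.card := by
    intro I
    simp [dSum, hd]
  rcases y with ⟨J, δ, hδ⟩ | ⟨J, δ, hδ⟩
  swap
  · exfalso
    have hJ := J.2
    change (δ.degree : ℤ) = critDeg d - 0 - dSum d J.1 at hδ
    rw [hcrit, hsum] at hδ
    omega
  have hJ := J.2
  change (δ.degree : ℤ) = 0 - dSum d J.1 at hδ
  rw [hsum] at hδ
  rw [coupledBasis_repr_inl, coupledD_fst' _ _ _ rfl]
  rcases x with ⟨I, γ, hγ⟩ | ⟨I, γ, hγ⟩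
  · exfalso
    have hI := I.2
    change (γ.degree : ℤ) = 0 - dSum d I.1 at hγ
    rw [hsum] at hγ
    omega
  · have hI := I.2
    have hγ' := hγ
    change (γ.degree : ℤ) = critDeg d - 0 - dSum d I.1 at hγ
    rw [hsum, hcrit] at hγ
    rw [coupledBasis_inr]
    simp only [map_zero, zero_add]
    have h1 : γ = 0 := (Finsupp.degree_eq_zero_iff γ).1 (by omega)
    have h2 : δ = 0 := (Finsupp.degree_eq_zero_iff δ).1 (by omega)
    rw [Module.Basis.coe_dualBasis, repr_bezoutMap, bezoutCoeff,
      bezoutian_pow _ (fun i => poly_powerCoeffs i)]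
    simp [hd, h1, h2]

/-- The determinant of the complex of `X_1^{d_1}, …, X_n^{d_n}` is `1`, if all the terms have
rank at most one. -/
theorem isComplexDet_powerCoeffs (hn : 1 ≤ n) (hd : ∀ i, 1 ≤ d i) {t : ℕ}
    (o : ∀ j : ℤ, CoupledIdx d t j ≃ Fin (coupledRank d t j))
    (hs : ∀ j, Subsingleton (CoupledIdx d t j)) {F : Type*} [Field F] :
    IsComplexDet (coupledD (fun c : Coeffs d => (powerCoeffs d c : F)) t) (ordBasis o F) 1 := by
  let i₀ : Fin n := ⟨0, hn⟩
  have hmon : ∀ {u : ℤ} (i : Fin n), 0 ≤ u → Finsupp.single i u.toNat ∈ monSet n u := by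
    intro u i hu
    change ((Finsupp.single i u.toNat).degree : ℤ) = u
    rw [Finsupp.degree_single]
    omega
  have ht : (0 : ℤ) ≤ t - dSum d ∅ := by
    rw [dSum_empty]
    omega
  -- otherwise `S_t` or `S_{t_n - t}` contains powers of two different variables
  have hsit : n = 1 ∨ (t = 0 ∧ ∀ i, d i = 1) := by
    by_contra! h
    obtain ⟨hn1, h⟩ := h
    let i₁ : Fin n := ⟨1, by omega⟩
    have hi : i₀ ≠ i₁ := by simp [i₀, i₁]
    by_cases ht0 : t = 0
    · obtain ⟨i, hdi⟩ := h ht0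
      have hc : 1 ≤ critDeg d - t - dSum d ∅ := by
        rw [dSum_empty, sub_zero, critDeg, ht0, Nat.cast_zero, sub_zero]
        have h1 : (1 : ℤ) ≤ (d i : ℤ) - 1 := by
          have := hd i
          omega
        refine h1.trans (Finset.single_le_sum (f := fun i => (d i : ℤ) - 1) (fun l _ => ?_)
          (Finset.mem_univ i))
        have := hd l
        omega
      have h0 := (hs (-1)).elim
        (Sum.inr ⟨⟨∅, by simp⟩, ⟨_, hmon (u := critDeg d - t - dSum d ∅) i₀ (by omega)⟩⟩)
        (Sum.inr ⟨⟨∅, by simp⟩, ⟨_, hmon (u := critDeg d - t - dSum d ∅) i₁ (by omega)⟩⟩)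
      simp only [Sum.inr.injEq, Sigma.mk.injEq, heq_eq_eq, true_and, Subtype.mk.injEq] at h0
      rcases (Finsupp.single_eq_single_iff _ _ _ _).1 h0 with h2 | h2
      · exact hi h2.1
      · omega
    · have h0 := (hs 0).elim
        (Sum.inl ⟨⟨∅, by simp⟩, ⟨_, hmon i₀ ht⟩⟩) (Sum.inl ⟨⟨∅, by simp⟩, ⟨_, hmon i₁ ht⟩⟩)
      simp only [Sum.inl.injEq, Sigma.mk.injEq, heq_eq_eq, true_and, Subtype.mk.injEq] at h0
      rw [dSum_empty] at h0
      rcases (Finsupp.single_eq_single_iff _ _ _ _).1 h0 with h2 | h2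
      · exact hi h2.1
      · omega
  have hle : ∀ j, coupledRank d t j ≤ 1 := fun j => Fintype.card_le_one_iff_subsingleton.2 (hs j)
  have h0 : coupledRank d t (-1 + 1) = 1 := by
    refine le_antisymm (hle _) (Fintype.card_pos_iff.2 ⟨Sum.inl ⟨⟨∅, by simp⟩, ⟨_, hmon i₀ ht⟩⟩⟩)
  have hemp : ∀ j, j ≠ -1 → j ≠ -1 + 1 → coupledRank d t j = 0 := by
    intro j h1 h2
    refine Fintype.card_eq_zero_iff.2 ⟨?_⟩
    rcases hsit with rfl | ⟨ht0, hd1⟩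
    · rintro (⟨⟨I, hI⟩, -⟩ | ⟨⟨I, hI⟩, -⟩)
      · have := Finset.card_le_univ I
        rw [Fintype.card_fin] at this
        omega
      · have := Finset.card_le_univ I
        rw [Fintype.card_fin] at this
        omega
    · have hcrit : critDeg d = 0 := by simp [critDeg, hd1]
      have hsum : ∀ I : Finset (Fin n), dSum d I = I.card := by
        intro I
        simp [dSum, hd1]
      rintro (⟨⟨I, hI⟩, γ, hγ⟩ | ⟨⟨I, hI⟩, γ, hγ⟩)
      · change (γ.degree : ℤ) = t - dSum d I at hγ
        rw [hsum] at hγ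
        omega
      · change (γ.degree : ℤ) = critDeg d - t - dSum d I at hγ
        rw [hsum] at hγ
        omega
  have h1 : coupledRank d t (-1) = 1 := by
    refine le_antisymm (hle _) ?_
    have e1 := diffRank_add (t := t) hd (-1)
    have e2 := diffRank_add (t := t) hd (-1 + 1)
    have e3 := diffRank_add (t := t) hd (-2)
    rw [hemp (-1 + 1 + 1) (by omega) (by omega)] at e2
    change _ + diffRank d t (-1) = coupledRank d t (-1) at e3
    omega
  refine isComplexDet_one o (-1) (fun j => ?_) fun x y => ?_
  · split_ifs with h
    · rcases h with rfl | rfl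
      · exact h1
      · exact h0
    · rw [not_or] at h
      exact hemp j h.1 h.2
  · rcases hsit with rfl | ⟨ht0, hd1⟩
    · exact entry_of_fin_one t x y
    · subst ht0
      exact entry_of_degree_one hd1 x y

variable (hn : 1 ≤ n) (hd : ∀ i, 1 ≤ d i) {t : ℕ}

include hn hd in
/-- The determinant exists, is unique, and is the resultant up to a sign. -/
theorem exists_sign (o : ∀ j : ℤ, CoupledIdx d t j ≃ Fin (coupledRank d t j)) :
    ∃ ε : ℤˣ, ∀ x : FractionRing (CoeffRing d),
      IsComplexDet (coupledD (genericFrac d) t) (ordBasis o _) x ↔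
        x = ((ε : ℤ) : FractionRing (CoeffRing d)) * algebraMap (CoeffRing d) _ (resultant d) := by
  obtain ⟨z, hz⟩ := exists_isComplexDet_eq hd (prime_resultant hd ⟨0, hn⟩)
    (resultant_mem hd ⟨0, hn⟩) o
  rw [zpow_one] at hz
  exact ⟨z, fun x => ⟨fun hx => genericDet_unique o hx hz, fun hx => hx ▸ hz⟩⟩

include hn hd in
/-- If some term has rank at least two, the sign can be changed by interchanging two basis elements.
Otherwise the determinant at `X_1^{d_1}, …, X_n^{d_n}` is `1`, as is the value of the resultant. -/
theorem exists_order : ∃ o : ∀ j : ℤ, CoupledIdx d t j ≃ Fin (coupledRank d t j),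
    ∀ x : FractionRing (CoeffRing d),
      IsComplexDet (coupledD (genericFrac d) t) (ordBasis o _) x ↔
        x = algebraMap (CoeffRing d) _ (resultant d) := by
  let i₀ : Fin n := ⟨0, hn⟩
  suffices h : ∃ o : ∀ j : ℤ, CoupledIdx d t j ≃ Fin (coupledRank d t j),
      IsComplexDet (coupledD (genericFrac d) t) (ordBasis o _)
        (algebraMap (CoeffRing d) (FractionRing (CoeffRing d)) (resultant d)) by
    obtain ⟨o, ho⟩ := h
    exact ⟨o, fun x => ⟨fun hx => genericDet_unique o hx ho, fun hx => hx ▸ ho⟩⟩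
  let o : ∀ j : ℤ, CoupledIdx d t j ≃ Fin (coupledRank d t j) := fun j => Fintype.equivFin _
  obtain ⟨z, hz⟩ := exists_isComplexDet_eq hd (prime_resultant hd i₀) (resultant_mem hd i₀) o
  rcases Int.units_eq_one_or z with rfl | rfl
  · exact ⟨o, by simpa using hz⟩
  by_cases hs : ∀ j, Subsingleton (CoupledIdx d t j)
  -- with the sign `-1`, comparing both sides at `X_1^{d_1}, …, X_n^{d_n}` would give `1 = -1`
  · exfalso
    have hex := (isExactComplex_iff hd (fun c : Coeffs d => (powerCoeffs d c : AlgebraicClosure ℚ))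
      t).2 (not_hasZero_powerCoeffs hd _)
    have h1 := (isComplexDet_evalAt (prime_resultant hd i₀).ne_zero hz hex).1
    have h2 := h1.unique _ (coupledRank_finite d t) (fun j x => coupledD_coupledD _ _ j x)
      (isComplexDet_powerCoeffs hn hd o hs)
    have h3 := map_evalAt (Int.castRingHom (AlgebraicClosure ℚ)) (powerCoeffs d) (resultant d)
    rw [← aeval_eq_evalAt, (isResultant_resultant hd i₀).normalized, map_one] at h3
    change _ * evalAt (Int.castRingHom (AlgebraicClosure ℚ) ∘ powerCoeffs d) (resultant d) ^ _ = _
      at h2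
    rw [← h3] at h2
    norm_num at h2
  · push Not at hs
    obtain ⟨j, hj⟩ := hs
    obtain ⟨y, y', hy⟩ := hj
    obtain ⟨k, rfl⟩ : ∃ k, j = k + 1 := ⟨j - 1, by omega⟩
    obtain ⟨o', ho'⟩ := exists_isComplexDet_neg o hz hy
    exact ⟨o', by simpa using ho'⟩

end Sign

end ResultantComplex

end

theorem mainTheorem2 {n : ℕ} (hn : 1 ≤ n) (d : Fin n → ℕ) (hd : ∀ i, 1 ≤ d i) (t : ℕ) :
    -- the complex is generically exact
    ResultantComplex.IsExactComplex
      (ResultantComplex.coupledD (ResultantComplex.genericFrac d) t) ∧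
    -- a specialization is exact if and only if the resultant does not vanish
    (∀ (k : Type*) [Field k] [IsAlgClosed k] (a : ResultantComplex.Coeffs d → k),
      ResultantComplex.IsExactComplex (ResultantComplex.coupledD a t) ↔
        MvPolynomial.aeval a (ResultantComplex.resultant d) ≠ 0) ∧
    -- the determinant with respect to the monomial bases, in any order, is well defined and equals
    -- the resultant up to the sign, which depends on the order
    (∀ o : ∀ j : ℤ, ResultantComplex.CoupledIdx d t j ≃
        Fin (Fintype.card (ResultantComplex.CoupledIdx d t j)),
      ∃ ε : ℤˣ, ∀ x : FractionRing (ResultantComplex.CoeffRing d),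
        ResultantComplex.IsComplexDet
            (ResultantComplex.coupledD (ResultantComplex.genericFrac d) t)
            (fun j => (ResultantComplex.coupledBasis _ d t j).reindex (o j)) x ↔
          x = ((ε : ℤ) : FractionRing (ResultantComplex.CoeffRing d)) *
            algebraMap (ResultantComplex.CoeffRing d) _ (ResultantComplex.resultant d)) ∧
    -- the sign is `1` for a suitable order
    (∃ o : ∀ j : ℤ, ResultantComplex.CoupledIdx d t j ≃
        Fin (Fintype.card (ResultantComplex.CoupledIdx d t j)),
      ∀ x : FractionRing (ResultantComplex.CoeffRing d),
        ResultantComplex.IsComplexDet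
            (ResultantComplex.coupledD (ResultantComplex.genericFrac d) t)
            (fun j => (ResultantComplex.coupledBasis _ d t j).reindex (o j)) x ↔
          x = algebraMap (ResultantComplex.CoeffRing d) _ (ResultantComplex.resultant d)) ∧
    -- the resultant is the gcd of the maximal minors of any matrix of `∂_0 : C^{-1} → C^0`
    (∀ (ι κ : Type) [Fintype ι] [DecidableEq ι] [Fintype κ] [DecidableEq κ]
      (b : Module.Basis κ (ResultantComplex.CoeffRing d)
        (ResultantComplex.Coupled (ResultantComplex.CoeffRing d) d t (-1)))
      (b' : Module.Basis ι (ResultantComplex.CoeffRing d)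
        (ResultantComplex.Coupled (ResultantComplex.CoeffRing d) d t (-1 + 1))),
      ResultantComplex.IsGCDOf
        {m | ResultantComplex.IsMaximalMinor
          (LinearMap.toMatrix b b'
            (ResultantComplex.coupledD (ResultantComplex.generic d) t (-1))) m}
        (ResultantComplex.resultant d)) := by
  have i₀ : Fin n := ⟨0, hn⟩
  refine ⟨ResultantComplex.isExactComplex_genericFrac hd, fun k _ _ a => ?_,
    ResultantComplex.exists_sign hn hd, ResultantComplex.exists_order hn hd,
    fun ι κ _ _ _ _ => ResultantComplex.isGCDOf_maximalMinors hn hd⟩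
  rw [ResultantComplex.aeval_eq_evalAt, Ne, ResultantComplex.evalAt_eq_zero_iff hd
    (ResultantComplex.prime_resultant hd i₀) (ResultantComplex.resultant_mem hd i₀)]
  exact ResultantComplex.isExactComplex_iff hd a t
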